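/- For $a\in[\sqrt2,2]$ let $f_a(x)=1-a|x|$ be the tent map on $I_a=[1-a,1]$, and write $c_n(a)=f_a^n(0)$, so that $c_2(a)=1-a$. A fair measure of $f_a$ is an atomless Borel probability measure $\mu$ on $I_a$ such that for every Borel set $E\subset I_a$ $$\mu(E)=\tfrac12\,\mu\big(f_a(E\cap[1-a,0])\big)+\tfrac12\,\mu\big(f_a(E\cap[0,a-1])\big)+\mu\big(f_a(E\cap[a-1,1])\big).$$ For every $a\in[\sqrt2,2]$ there is exactly one fair measure $\mu_a$; it is $f_a$-invariant, and its measure-theoretic (Kolmogorov–Sinai) entropy $h_{\mu_a}(f_a)$ is finite. Put $$\mathcal H(a)=\frac{h_{\mu_a}(f_a)}{2\log 2},\qquad \alpha(r,b)=\frac{(r-1)\log 2}{r\log b}.$$ **Theorem.** There is a strictly increasing sequence $\sqrt2=\mathbb a_2<\mathbb a_3<\cdots$ with $\mathbb a_r\to2$, where for each $r\ge2$ the number $\mathbb a_r$ is the unique $a\in[\sqrt2,2]$ with $$c_2(a)<c_3(a)<\cdots<c_r(a)<0<c_{r+1}(a)=-c_2(a),$$ such that the following hold for each integer $r\ge 2$.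 1. For every $b$ with $\mathbb a_r<b\le2$, $\mathcal H$ is Hölder continuous on $[\mathbb a_r,b]$ with exponent $\alpha(r,b)$. In particular, $\mathcal H$ is $\frac12$-Hölder continuous on $[\sqrt2,2]$. 2. These exponents are optimal: for every nondegenerate interval $J\subset[\sqrt2,2]$ with $b=\sup J\le\mathbb a_{r+1}$ and every $\alpha>\alpha(r,b)$, $\mathcal H$ is not $\alpha$-Hölder continuous on $J$. -/

import Mathlib

open Set Filter Topology MeasureTheory
open scoped NNReal ENNReal

namespace FairEntropy

/-! ### Kolmogorov-Sinai entropy -/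

/-- Shannon entropy (natural logarithm) of the finite partition of `X` into the fibres of
`P : X → ι`. -/
noncomputable def partitionEntropy {X ι : Type*} [MeasurableSpace X] [Fintype ι]
    (μ : Measure X) (P : X → ι) : ℝ :=
  ∑ i, Real.negMulLog (μ.real (P ⁻¹' {i}))

/-- The join of `P, T⁻¹ P, …, T⁻⁽ⁿ⁻¹⁾ P`: a point is sent to its itinerary of length `n`. -/
def itinerary {X ι : Type*} (T : X → X) (P : X → ι) (n : ℕ) (x : X) : Fin n → ι :=
  fun i => P (T^[i] x)

/-- Entropy of `T` relative to the finite partition given by the fibres of `P`. For an invariant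
probability measure `μ` and a measurable `P` the limit exists, so `limsup` is this limit. -/
noncomputable def entropyOfPartition {X ι : Type*} [MeasurableSpace X] [Fintype ι]
    (T : X → X) (μ : Measure X) (P : X → ι) : EReal :=
  limsup (fun n : ℕ => ((partitionEntropy μ (itinerary T P n) / (n : ℝ) : ℝ) : EReal)) atTop

/-- Measure-theoretic (Kolmogorov-Sinai) entropy `h_μ(T)`: the supremum over all finite measurable
partitions, each one being the family of fibres of a measurable map to some `Fin k`. -/
noncomputable def measureEntropy {X : Type*} [MeasurableSpace X]
    (T : X → X) (μ : Measure X) : EReal :=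
  ⨆ (k : ℕ) (P : X → Fin k) (_ : Measurable P), entropyOfPartition T μ P

/-! ### Tent maps and their fair measures -/

/-- The tent map `f_a(x) = 1 - a |x|`. It maps `I_a = [1 - a, 1]` onto itself if `1 < a ≤ 2`. -/
def tent (a x : ℝ) : ℝ := 1 - a * |x|

/-- The critical orbit `c_n(a) = f_a^n(0)`. -/
def critOrbit (a : ℝ) (n : ℕ) : ℝ := (tent a)^[n] 0

/-- `μ` (a Borel measure on `ℝ` that is concentrated on `I_a = [1 - a, 1]`) is a fair measure of
`f_a`: an atomless probability measure such that the mass at each point is divided equally among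
its preimages. Here `c_2(a) = 1 - a` and `-c_2(a) = a - 1`, so that points of
`[1 - a, a - 1] \ {0}` have a sibling with the same image and points of `(a - 1, 1]` have none. -/
structure IsFairMeasure (a : ℝ) (μ : Measure ℝ) : Prop where
  isProbabilityMeasure : IsProbabilityMeasure μ
  atomless : ∀ x : ℝ, μ {x} = 0
  concentrated : μ (Icc (1 - a) 1)ᶜ = 0
  fair : ∀ E : Set ℝ, MeasurableSet E → E ⊆ Icc (1 - a) 1 →
    μ E = 2⁻¹ * μ (tent a '' (E ∩ Icc (1 - a) 0)) + 2⁻¹ * μ (tent a '' (E ∩ Icc 0 (a - 1)))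
      + μ (tent a '' (E ∩ Icc (a - 1) 1))

open Classical in
/-- The fair measure `μ_a` of `f_a` (with the value `0` if there were none). -/
noncomputable def fairMeasure (a : ℝ) : Measure ℝ :=
  if h : ∃ μ, IsFairMeasure a μ then h.choose else 0

/-- The normalized fair entropy `h_{μ_a}(f_a) / (2 log 2)`. -/
noncomputable def fairEntropy (a : ℝ) : ℝ :=
  (measureEntropy (tent a) (fairMeasure a)).toReal / (2 * Real.log 2)

/-! ### The parameters and exponents -/

/-- `c_2(a) < c_3(a) < ⋯ < c_r(a) < 0 < c_{r+1}(a) = -c_2(a)`. -/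
def IsWindowParameter (r : ℕ) (a : ℝ) : Prop :=
  (∀ k, 2 ≤ k → k < r → critOrbit a k < critOrbit a (k + 1)) ∧
    critOrbit a r < 0 ∧ 0 < critOrbit a (r + 1) ∧ critOrbit a (r + 1) = -critOrbit a 2

/-- `α(r, b) = (r - 1) log 2 / (r log b)`. -/
noncomputable def holderExponent (r : ℕ) (b : ℝ) : ℝ :=
  ((r : ℝ) - 1) * Real.log 2 / ((r : ℝ) * Real.log b)

/-- `f` is Hölder continuous on `s` with exponent `α` (used for `α > 0` only). -/
def IsHolderOn (α : ℝ) (f : ℝ → ℝ) (s : Set ℝ) : Prop :=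
  ∃ C : ℝ≥0, HolderOnWith C α.toNNReal f s

end FairEntropy

/-!
# Fair measures of tent maps: the fair entropy and its optimal Hölder exponents

Write `f = f_a`, `I = [1 - a, 1]` and `c_n = f^n(0)`. A fair measure is determined by its
distribution function `F` on `I`, and `F` is exactly a monotone semiconjugacy of `f` with the
piecewise linear map that has the slopes `2`, `-2`, `-1` on `[0, H]`, `[H, 2H]`, `[2H, 1]`, where
`H = F 0` (`IsFairCdf`). Such an `F` exists as a limit, along an ultrafilter, of averages of
iterates of the operator that halves the mass on the two-to-one part of `I`.

*Uniqueness and comparison of parameters.* Let `d_n = F' (c_n') - F (c_n)` for two parameters and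
`h = H' - H`. While both critical orbits visit corresponding pieces, `d_{n+1}` is `±(2 d_n - 2 h)`,
or `-d_n` at visits to `(a - 1, 1]`. Starting with `d_3 = -2 h` this amplifies `h` by a factor `2`
at every step that is not such a visit (`IsFairCdf.amplify`). For equal parameters this gives
`h = 0` and then uniqueness.

*Entropy.* An `n`-cylinder on which `f^n` is injective has mass at most `2^{-k}`, where `k` counts
the steps outside `(a - 1, 1]`; comparing the cylinder masses with the weights `2^{-k}`, whose sum
grows only linearly, shows that the entropy is `log 2` times the mass `2 H` of `[1 - a, a - 1]`. So
the normalized fair entropy is `H` itself (`fairEntropy_eq`).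

*Hölder continuity.* For `a ≥ 𝕒_r` an orbit that has visited `(a - 1, 1]` stays to the left of the
negative critical values `c_3, …, c_r`, so that visits are at least `r` steps apart and masses decay
like `2^{-n(r-1)/r}` while lengths are multiplied by `a^n`. This gives `μ(J) ≤ C |J|^α` with
`α = α(r, b)`. A loss occurs whenever an iterate of `J` covers the turning point; it is controlled
by the masses of the intervals `[1 - t, 1]`, for which the count of visits between two returns to
the turning point has no additive error (`IsLongRun.visits_mul_le_of_near_one`), so that one
constant works for all returns. At the first time at which two critical orbits visit different
pieces, `|d_n| - 2 |h|` is then at most `C (|c_n - c_n'| + |a - a'|)^α`, and amplification of `h`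
yields the Hölder estimate for `H`.

*Optimality.* Between `𝕒_r` and `𝕒_{r+1}` there is an orbit of period `r` that visits `(a - 1, 1]`
once per period (`leftPeriodicPoint`). Expansion of `a ↦ c_n(a)` on parameter intervals without
crossings of the turning point shows that for a dense set of parameters the critical orbit falls on
this orbit (`exists_critOrbit_eq_leftPeriodicPoint`). Near such a parameter the pieces first differ
after at most about `log (1 / |a - a'|) / log a` steps. Then `|d_n| + 2 |h|` is bounded below, while
it has grown from the order of `|h|` at most at the rate `2^{(r-1)/r}`; hence `|h|` is at least of
order `|a - a'|^α`.
-/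

namespace FairEntropy

/-! ### Tent maps, their critical orbits and visits to the one-to-one part -/

lemma param_bounds {a : ℝ} (ha : a ∈ Icc (√2) 2) : 7 / 5 < a ∧ a ≤ 2 ∧ 2 ≤ a * a := by
  have h2 : √2 * √2 = 2 := Real.mul_self_sqrt (by norm_num)
  have h0 : 0 ≤ √2 := Real.sqrt_nonneg 2
  refine ⟨?_, ha.2, ?_⟩
  · have : 7 / 5 < √2 := by nlinarith
    exact this.trans_le ha.1
  · nlinarith [ha.1]

lemma tent_of_nonneg {a x : ℝ} (hx : 0 ≤ x) : tent a x = 1 - a * x := by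
  rw [tent, abs_of_nonneg hx]

lemma tent_of_nonpos {a x : ℝ} (hx : x ≤ 0) : tent a x = 1 + a * x := by
  rw [tent, abs_of_nonpos hx]; ring

lemma tent_le_one {a : ℝ} (ha : a ∈ Icc (√2) 2) (x : ℝ) : tent a x ≤ 1 := by
  have := mul_nonneg (by linarith [(param_bounds ha).1] : (0 : ℝ) ≤ a) (abs_nonneg x)
  unfold tent; linarith

lemma continuous_tent (a : ℝ) : Continuous (tent a) := by
  unfold tent; fun_prop

lemma tent_mem {a x : ℝ} (ha : a ∈ Icc (√2) 2) (hx : x ∈ Icc (1 - a) 1) :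
    tent a x ∈ Icc (1 - a) 1 := by
  obtain ⟨h1, h2, _⟩ := param_bounds ha
  refine ⟨?_, tent_le_one ha x⟩
  have : |x| ≤ 1 := abs_le.2 ⟨by linarith [hx.1], hx.2⟩
  unfold tent
  nlinarith

lemma iterate_mem {a x : ℝ} (ha : a ∈ Icc (√2) 2) (hx : x ∈ Icc (1 - a) 1) (n : ℕ) :
    (tent a)^[n] x ∈ Icc (1 - a) 1 := by
  induction n with
  | zero => exact hx
  | succ n ih => rw [Function.iterate_succ_apply']; exact tent_mem ha ih

lemma critOrbit_succ (a : ℝ) (n : ℕ) : critOrbit a (n + 1) = tent a (critOrbit a n) :=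
  Function.iterate_succ_apply' _ _ _

lemma iterate_critOrbit (a : ℝ) (k n : ℕ) :
    (tent a)^[k] (critOrbit a n) = critOrbit a (n + k) := by
  rw [critOrbit, ← Function.iterate_add_apply, Nat.add_comm, critOrbit]

lemma iterate_one_eq (a : ℝ) (n : ℕ) : (tent a)^[n] 1 = critOrbit a (n + 1) := by
  have h : critOrbit a 1 = 1 := by simp [critOrbit, tent]
  conv_lhs => rw [← h]
  rw [iterate_critOrbit, Nat.add_comm]

lemma critOrbit_one (a : ℝ) : critOrbit a 1 = 1 := by simp [critOrbit, tent]

lemma critOrbit_two (a : ℝ) : critOrbit a 2 = 1 - a := by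
  rw [critOrbit_succ, critOrbit_one]; simp [tent]

lemma critOrbit_three {a : ℝ} (ha : a ∈ Icc (√2) 2) : critOrbit a 3 = 1 - a * (a - 1) := by
  rw [critOrbit_succ, critOrbit_two, tent_of_nonpos (by linarith [(param_bounds ha).1])]; ring

lemma critOrbit_three_le {a : ℝ} (ha : a ∈ Icc (√2) 2) : critOrbit a 3 ≤ a - 1 := by
  rw [critOrbit_three ha]; nlinarith [(param_bounds ha).2.2]

lemma zero_mem_interval {a : ℝ} (ha : a ∈ Icc (√2) 2) : (0 : ℝ) ∈ Icc (1 - a) 1 :=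
  ⟨by linarith [(param_bounds ha).1], zero_le_one⟩

lemma one_mem_interval {a : ℝ} (ha : a ∈ Icc (√2) 2) : (1 : ℝ) ∈ Icc (1 - a) 1 :=
  ⟨by linarith [(param_bounds ha).1], le_rfl⟩

lemma critOrbit_mem {a : ℝ} (ha : a ∈ Icc (√2) 2) (n : ℕ) : critOrbit a n ∈ Icc (1 - a) 1 :=
  iterate_mem ha (zero_mem_interval ha) n

lemma abs_le_one_of_mem {a x : ℝ} (ha : a ∈ Icc (√2) 2) (hx : x ∈ Icc (1 - a) 1) : |x| ≤ 1 :=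
  abs_le.2 ⟨by linarith [hx.1, (param_bounds ha).2.1], hx.2⟩

lemma abs_tent_sub_le {a : ℝ} (ha : a ∈ Icc (√2) 2) (x y : ℝ) :
    |tent a x - tent a y| ≤ a * |x - y| := by
  have h0 : 0 ≤ a := by linarith [(param_bounds ha).1]
  have : tent a x - tent a y = a * (|y| - |x|) := by unfold tent; ring
  rw [this, abs_mul, abs_of_nonneg h0, abs_sub_comm x y]
  exact mul_le_mul_of_nonneg_left (abs_abs_sub_abs_le y x) h0

lemma abs_iterate_sub_le {a : ℝ} (ha : a ∈ Icc (√2) 2) (x y : ℝ) (n : ℕ) :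
    |(tent a)^[n] x - (tent a)^[n] y| ≤ a ^ n * |x - y| := by
  have h0 : 0 ≤ a := by linarith [(param_bounds ha).1]
  induction n with
  | zero => simp
  | succ n ih =>
    rw [Function.iterate_succ_apply', Function.iterate_succ_apply', pow_succ']
    calc _ ≤ a * |(tent a)^[n] x - (tent a)^[n] y| := abs_tent_sub_le ha _ _
      _ ≤ a * (a ^ n * |x - y|) := mul_le_mul_of_nonneg_left ih h0
      _ = _ := by ring

lemma tent_le_of_right {a x : ℝ} (ha : a ∈ Icc (√2) 2) (hx : a - 1 ≤ x) :
    tent a x ≤ critOrbit a 3 := by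
  have h := (param_bounds ha).1
  rw [critOrbit_three ha, tent_of_nonneg (by linarith)]
  nlinarith

/-- The number of visits of the orbit `x, f x, …, f^{n-1} x` to `(a - 1, 1]`, the part of the
interval on which the fair measure is not halved. -/
noncomputable def visits (a x : ℝ) (n : ℕ) : ℕ :=
  Nat.count (fun i => a - 1 < (tent a)^[i] x) n

lemma visits_zero (a x : ℝ) : visits a x 0 = 0 := Nat.count_zero _

lemma visits_succ (a x : ℝ) (n : ℕ) :
    visits a x (n + 1) = visits a x n + if a - 1 < (tent a)^[n] x then 1 else 0 :=
  Nat.count_succ _ _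

lemma visits_succ' (a x : ℝ) (n : ℕ) :
    visits a x (n + 1) = visits a (tent a x) n + if a - 1 < x then 1 else 0 := by
  rw [visits, Nat.count_succ']
  rfl

lemma visits_add (a x : ℝ) (m n : ℕ) :
    visits a x (m + n) = visits a x m + visits a ((tent a)^[m] x) n := by
  rw [visits, Nat.count_add, visits, visits]
  congr 1
  congr 1
  funext k
  rw [← Function.iterate_add_apply, Nat.add_comm]

/-- The critical values `c_2(a), …, c_r(a)` are negative and `c_{r+1}(a) ≤ a - 1`. This forces two
visits of any orbit to `(a - 1, 1]` to be at least `r` steps apart. -/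
def IsLongRun (r : ℕ) (a : ℝ) : Prop :=
  (∀ k, 2 ≤ k → k ≤ r → critOrbit a k < 0) ∧ critOrbit a (r + 1) ≤ a - 1

lemma isLongRun_two {a : ℝ} (ha : a ∈ Icc (√2) 2) : IsLongRun 2 a := by
  refine ⟨fun k h2 hk => ?_, critOrbit_three_le ha⟩
  obtain rfl : k = 2 := le_antisymm hk h2
  rw [critOrbit_two]; linarith [(param_bounds ha).1]

lemma IsLongRun.critOrbit_le {r : ℕ} {a : ℝ} (ha : a ∈ Icc (√2) 2) (h : IsLongRun r a) {k : ℕ}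
    (h2 : 2 ≤ k) (hk : k ≤ r + 1) : critOrbit a k ≤ a - 1 := by
  rcases Nat.lt_or_ge r k with hlt | hle
  · obtain rfl : k = r + 1 := by omega
    exact h.2
  · linarith [h.1 k h2 hle, (param_bounds ha).1]

/-- An orbit that has just left `(a - 1, 1]` stays to the left of the critical orbit as long as the
latter is negative. -/
lemma IsLongRun.iterate_lt {r : ℕ} {a x : ℝ} (ha : a ∈ Icc (√2) 2) (h : IsLongRun r a)
    (hx : a - 1 < x) {i : ℕ} (h1 : 1 ≤ i) (hi : i < r) :
    (tent a)^[i] x < critOrbit a (i + 2) := by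
  have hb := (param_bounds ha).1
  induction i, h1 using Nat.le_induction with
  | base =>
    rw [Function.iterate_one, critOrbit_three ha, tent_of_nonneg (by linarith)]
    nlinarith
  | succ i h1 ih =>
    have ih' := ih (by omega)
    have hc := h.1 (i + 2) (by omega) (by omega)
    rw [Function.iterate_succ_apply', show i + 1 + 2 = (i + 2) + 1 by ring, critOrbit_succ,
      tent_of_nonpos hc.le, tent_of_nonpos (ih'.trans hc).le]
    nlinarith

lemma IsLongRun.not_right {r : ℕ} {a x : ℝ} (ha : a ∈ Icc (√2) 2) (h : IsLongRun r a)
    (hx : a - 1 < x) {i : ℕ} (h1 : 1 ≤ i) (hi : i < r) : (tent a)^[i] x ≤ a - 1 :=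
  (h.iterate_lt ha hx h1 hi).le.trans (h.critOrbit_le ha (by omega) (by omega))

lemma IsLongRun.visits_le_one {r : ℕ} {a x : ℝ} (ha : a ∈ Icc (√2) 2) (h : IsLongRun r a)
    (hx : a - 1 < x) {n : ℕ} (hn : n ≤ r) : visits a x n ≤ 1 := by
  rcases n with _ | n
  · simp [visits_zero]
  · rw [visits_succ', if_pos hx]
    have : visits a (tent a x) n = 0 := by
      refine Nat.count_of_forall_not fun m hm => not_lt.2 ?_
      rw [← Function.iterate_succ_apply]
      exact h.not_right ha hx (by omega) (by omega)
    omega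

lemma IsLongRun.visits_mul_le {r : ℕ} {a : ℝ} (ha : a ∈ Icc (√2) 2) (hr : 1 ≤ r)
    (h : IsLongRun r a) (n : ℕ) (x : ℝ) : r * visits a x n + 1 ≤ n + r := by
  induction n using Nat.strong_induction_on generalizing x with
  | _ n ih =>
    rcases n with _ | n
    · simp [visits_zero]; omega
    by_cases hx : a - 1 < x
    · rcases Nat.lt_or_ge r (n + 1) with hn | hn
      · have h1 := h.visits_le_one ha hx le_rfl
        have h2 := ih (n + 1 - r) (by omega) ((tent a)^[r] x)
        have h3 : visits a x (n + 1) = visits a x r + visits a ((tent a)^[r] x) (n + 1 - r) := by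
          rw [← visits_add]; congr 1; omega
        rw [h3]
        nlinarith [Nat.mul_le_mul_left r h1, Nat.sub_add_cancel hn.le]
      · nlinarith [Nat.mul_le_mul_left r (h.visits_le_one ha hx hn)]
    · rw [visits_succ', if_neg hx, add_zero]
      have := ih n (by omega) (tent a x)
      omega

/-! ### Distribution functions of fair measures and their uniqueness -/

/-- The distribution functions of the fair measures of `f_a`, restricted to `[1 - a, 1]`: `F`
semiconjugates `f_a` to the piecewise linear map with slopes `2`, `-2`, `-1` on `[0, F 0]`,
`[F 0, 2 F 0]`, `[2 F 0, 1]`. -/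
structure IsFairCdf (a : ℝ) (F : ℝ → ℝ) : Prop where
  monotoneOn : MonotoneOn F (Icc (1 - a) 1)
  map_left : F (1 - a) = 0
  map_one : F 1 = 1
  nonpos : ∀ x ∈ Icc (1 - a) 0, F (tent a x) = 2 * F x + 1 - 2 * F 0
  center : ∀ x ∈ Icc 0 (a - 1), F (tent a x) = 1 - 2 * F x + 2 * F 0
  right : ∀ x ∈ Icc (a - 1) 1, F (tent a x) = 1 - F x

lemma IsFairCdf.mem_Icc {a : ℝ} {F : ℝ → ℝ} (ha : a ∈ Icc (√2) 2) (hF : IsFairCdf a F) {x : ℝ}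
    (hx : x ∈ Icc (1 - a) 1) : F x ∈ Icc (0 : ℝ) 1 := by
  have h := (param_bounds ha).1
  constructor
  · rw [← hF.map_left]
    exact hF.monotoneOn ⟨le_rfl, by linarith⟩ hx hx.1
  · rw [← hF.map_one]
    exact hF.monotoneOn hx ⟨by linarith, le_rfl⟩ hx.2

lemma IsFairCdf.map_sub_one {a : ℝ} {F : ℝ → ℝ} (ha : a ∈ Icc (√2) 2) (hF : IsFairCdf a F) :
    F (a - 1) = 2 * F 0 := by
  have h := param_bounds ha
  have h1 := hF.center (a - 1) ⟨by linarith, le_rfl⟩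
  have h2 := hF.right (a - 1) ⟨le_rfl, by linarith⟩
  linarith

/-- `x` and `x'` lie in corresponding pieces `[1 - a, 0]`, `[0, a - 1]`, `(a - 1, 1]` of the
intervals of `f_a` and `f_{a'}`. -/
def SamePiece (a x a' x' : ℝ) : Prop :=
  (x ≤ 0 ∧ x' ≤ 0) ∨ (0 ≤ x ∧ x ≤ a - 1 ∧ 0 ≤ x' ∧ x' ≤ a' - 1) ∨ (a - 1 < x ∧ a' - 1 < x')

/-- While the critical orbits of two parameters visit corresponding pieces, the difference of their
images under the distribution functions is governed by an affine recursion, and the difference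
`F' 0 - F 0` is amplified at every step outside `(a - 1, 1]`. -/
lemma IsFairCdf.amplify {a a' : ℝ} {F F' : ℝ → ℝ} (ha : a ∈ Icc (√2) 2) (ha' : a' ∈ Icc (√2) 2)
    (hF : IsFairCdf a F) (hF' : IsFairCdf a' F') (n : ℕ)
    (hs : ∀ k, 3 ≤ k → k < 4 + n → SamePiece a (critOrbit a k) a' (critOrbit a' k)) :
    4 * |F' 0 - F 0| * 2 ^ n ≤ (|F' (critOrbit a' (4 + n)) - F (critOrbit a (4 + n))|
      - 2 * |F' 0 - F 0|) * 2 ^ visits a (critOrbit a 4) n := by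
  have hb := param_bounds ha
  have hb' := param_bounds ha'
  set h := F' 0 - F 0 with hh
  have step : ∀ k, SamePiece a (critOrbit a k) a' (critOrbit a' k) →
      (critOrbit a k ≤ a - 1 ∧
        |F' (critOrbit a' (k + 1)) - F (critOrbit a (k + 1))|
          = |2 * (F' (critOrbit a' k) - F (critOrbit a k)) - 2 * h|) ∨
      (a - 1 < critOrbit a k ∧
        |F' (critOrbit a' (k + 1)) - F (critOrbit a (k + 1))|
          = |F' (critOrbit a' k) - F (critOrbit a k)|) := by
    intro k hk
    have m := critOrbit_mem ha k
    have m' := critOrbit_mem ha' k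
    rw [critOrbit_succ, critOrbit_succ]
    rcases hk with ⟨h1, h2⟩ | ⟨h1, h2, h3, h4⟩ | ⟨h1, h2⟩
    · left
      refine ⟨by linarith, ?_⟩
      rw [hF.nonpos _ ⟨m.1, h1⟩, hF'.nonpos _ ⟨m'.1, h2⟩]
      congr 1; rw [hh]; ring
    · left
      refine ⟨h2, ?_⟩
      rw [hF.center _ ⟨h1, h2⟩, hF'.center _ ⟨h3, h4⟩, ← abs_neg]
      congr 1; rw [hh]; ring
    · right
      refine ⟨h1, ?_⟩
      rw [hF.right _ ⟨h1.le, m.2⟩, hF'.right _ ⟨h2.le, m'.2⟩, ← abs_neg]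
      congr 1; ring
  induction n with
  | zero =>
    have h3 : F' (critOrbit a' 3) - F (critOrbit a 3) = -2 * h := by
      rw [critOrbit_succ a 2, critOrbit_succ a' 2, critOrbit_two, critOrbit_two,
        hF.nonpos _ ⟨le_rfl, by linarith⟩, hF'.nonpos _ ⟨le_rfl, by linarith⟩, hF.map_left,
        hF'.map_left, hh]
      ring
    rcases step 3 (hs 3 le_rfl (by omega)) with ⟨_, h4⟩ | ⟨h4, _⟩
    · have : |2 * (-2 * h) - 2 * h| = 6 * |h| := by
        rw [show 2 * (-2 * h) - 2 * h = (-6) * h by ring, abs_mul]; norm_num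
      simp only [visits_zero, Nat.add_zero, pow_zero, mul_one]
      rw [h4, h3, this]
      linarith
    · linarith [critOrbit_three_le ha]
  | succ n ih =>
    have ih' := ih fun k h3 hk => hs k h3 (by omega)
    rw [visits_succ, iterate_critOrbit, pow_succ, ← Nat.add_assoc]
    rcases step (4 + n) (hs _ (by omega) (by omega)) with ⟨h1, h2⟩ | ⟨h1, h2⟩
    · simp only [if_neg (not_lt.2 h1), add_zero, h2]
      have h5 : 2 * |F' (critOrbit a' (4 + n)) - F (critOrbit a (4 + n))| - 2 * |h| ≤
          |2 * (F' (critOrbit a' (4 + n)) - F (critOrbit a (4 + n))) - 2 * h| := by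
        have := abs_sub_abs_le_abs_sub (2 * (F' (critOrbit a' (4 + n)) - F (critOrbit a (4 + n))))
          (2 * h)
        rwa [abs_mul, abs_mul, abs_two] at this
      have hp : (0 : ℝ) < 2 ^ visits a (critOrbit a 4) n := by positivity
      nlinarith
    · rw [if_pos h1, h2, pow_succ]
      linarith

/-- A fair measure is determined by the kneading data of `f_a`: the value at `0` by the
amplification of differences along the critical orbit, the rest by contraction. -/
theorem IsFairCdf.eqOn {a : ℝ} {F F' : ℝ → ℝ} (ha : a ∈ Icc (√2) 2) (hF : IsFairCdf a F)
    (hF' : IsFairCdf a F') : EqOn F F' (Icc (1 - a) 1) := by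
  have hb := param_bounds ha
  have same : ∀ x, SamePiece a x a x := by
    intro x
    unfold SamePiece
    rcases le_total x 0 with h | h
    · exact Or.inl ⟨h, h⟩
    rcases le_or_gt x (a - 1) with h' | h'
    · exact Or.inr (Or.inl ⟨h, h', h, h'⟩)
    · exact Or.inr (Or.inr ⟨h', h'⟩)
  have dist_le : ∀ x ∈ Icc (1 - a) 1, |F' x - F x| ≤ 1 := by
    intro x hx
    have h1 := hF.mem_Icc ha hx
    have h2 := hF'.mem_Icc ha hx
    exact abs_le.2 ⟨by linarith [h1.2, h2.1], by linarith [h1.1, h2.2]⟩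
  have h0 : F' 0 - F 0 = 0 := by
    by_contra hne
    have hpos : 0 < |F' 0 - F 0| := abs_pos.2 hne
    obtain ⟨m, hm⟩ := pow_unbounded_of_one_lt (1 / |F' 0 - F 0|) (one_lt_two (α := ℝ))
    have key := hF.amplify ha ha hF' (2 * m) (fun k _ _ => same _)
    have hv := (isLongRun_two ha).visits_mul_le ha (by norm_num) (2 * m) (critOrbit a 4)
    have hv' : visits a (critOrbit a 4) (2 * m) ≤ m := by omega
    have h2 : (2 : ℝ) ^ visits a (critOrbit a 4) (2 * m) ≤ 2 ^ m :=
      pow_le_pow_right₀ one_le_two hv'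
    have h3 := dist_le _ (critOrbit_mem ha (4 + 2 * m))
    rw [div_lt_iff₀ hpos] at hm
    have hpm : (0 : ℝ) < 2 ^ m := by positivity
    have h4 : (|F' (critOrbit a (4 + 2 * m)) - F (critOrbit a (4 + 2 * m))| - 2 * |F' 0 - F 0|)
        * 2 ^ visits a (critOrbit a 4) (2 * m) ≤ 1 * 2 ^ m := by
      rcases le_total (|F' (critOrbit a (4 + 2 * m)) - F (critOrbit a (4 + 2 * m))|
        - 2 * |F' 0 - F 0|) 0 with h5 | h5
      · exact (mul_nonpos_of_nonpos_of_nonneg h5 (by positivity)).trans (by positivity)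
      · exact mul_le_mul (by linarith) h2 (by positivity) zero_le_one
    rw [show (2 : ℝ) ^ (2 * m) = 2 ^ m * 2 ^ m by rw [two_mul, pow_add]] at key
    nlinarith
  have half : ∀ x ∈ Icc (1 - a) (a - 1), |F' x - F x| ≤ |F' (tent a x) - F (tent a x)| / 2 := by
    intro x hx
    rcases le_total x 0 with h | h
    · rw [hF.nonpos x ⟨hx.1, h⟩, hF'.nonpos x ⟨hx.1, h⟩,
        show 2 * F' x + 1 - 2 * F' 0 - (2 * F x + 1 - 2 * F 0) = 2 * (F' x - F x) by linarith,
        abs_mul, abs_two]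
      linarith
    · rw [hF.center x ⟨h, hx.2⟩, hF'.center x ⟨h, hx.2⟩,
        show 1 - 2 * F' x + 2 * F' 0 - (1 - 2 * F x + 2 * F 0) = -(2 * (F' x - F x)) by linarith,
        abs_neg, abs_mul, abs_two]
      linarith
  have small : ∀ n : ℕ, ∀ x ∈ Icc (1 - a) 1, |F' x - F x| ≤ (1 / 2) ^ n := by
    intro n
    induction n with
    | zero => simpa using dist_le
    | succ n ih =>
      have low : ∀ x ∈ Icc (1 - a) (a - 1), |F' x - F x| ≤ (1 / 2) ^ (n + 1) := by
        intro x hx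
        have hx1 : x ∈ Icc (1 - a) 1 := ⟨hx.1, by linarith [hx.2]⟩
        rw [pow_succ]
        linarith [half x hx, ih _ (tent_mem ha hx1)]
      intro x hx
      rcases le_total x (a - 1) with h | h
      · exact low x ⟨hx.1, h⟩
      · have h1 : |F' x - F x| = |F' (tent a x) - F (tent a x)| := by
          rw [hF.right x ⟨h, hx.2⟩, hF'.right x ⟨h, hx.2⟩, ← abs_neg]
          congr 1; ring
        rw [h1]
        exact low _ ⟨(tent_mem ha hx).1, (tent_le_of_right ha h).trans (critOrbit_three_le ha)⟩
  intro x hx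
  have : |F' x - F x| ≤ 0 :=
    ge_of_tendsto' (tendsto_pow_atTop_nhds_zero_of_lt_one (by norm_num) (by norm_num))
      fun n => small n x hx
  linarith [abs_nonpos_iff.1 this]

/-! ### Existence of a fair distribution function -/

/-- The operator on distribution functions that is dual to choosing a preimage under `f_a` with
equal probabilities. Its fixed points are the fair distribution functions. -/
noncomputable def fairOp (a : ℝ) (F : ℝ → ℝ) (x : ℝ) : ℝ :=
  if x ≤ 0 then (F (tent a x) - F (critOrbit a 3)) / 2
  else if x ≤ a - 1 then 1 - (F (critOrbit a 3) + F (tent a x)) / 2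
  else 1 - F (tent a x)

/-- Distribution functions of probability measures without mass at `1 - a`. -/
structure IsCdfOn (a : ℝ) (F : ℝ → ℝ) : Prop where
  monotoneOn : MonotoneOn F (Icc (1 - a) 1)
  map_left : F (1 - a) = 0
  map_one : F 1 = 1

lemma tent_sub_one {a : ℝ} (ha : a ∈ Icc (√2) 2) : tent a (a - 1) = critOrbit a 3 := by
  rw [critOrbit_three ha, tent_of_nonneg (by linarith [(param_bounds ha).1])]

lemma tent_one_sub {a : ℝ} (ha : a ∈ Icc (√2) 2) : tent a (1 - a) = critOrbit a 3 := by
  rw [critOrbit_three ha, tent_of_nonpos (by linarith [(param_bounds ha).1])]; ring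

lemma tent_one (a : ℝ) : tent a 1 = 1 - a := by simp [tent]

lemma tent_zero (a : ℝ) : tent a 0 = 1 := by simp [tent]

lemma fairOp_nonpos {a : ℝ} (F : ℝ → ℝ) {x : ℝ} (hx : x ≤ 0) :
    fairOp a F x = (F (tent a x) - F (critOrbit a 3)) / 2 := by
  rw [fairOp, if_pos hx]

lemma fairOp_center {a : ℝ} {F : ℝ → ℝ} (h1 : F 1 = 1) {x : ℝ} (hx : x ∈ Icc 0 (a - 1)) :
    fairOp a F x = 1 - (F (critOrbit a 3) + F (tent a x)) / 2 := by
  rcases hx.1.eq_or_lt with rfl | h0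
  · rw [fairOp_nonpos F le_rfl, tent_zero, h1]; ring
  · rw [fairOp, if_neg (not_le.2 h0), if_pos hx.2]

lemma fairOp_right {a : ℝ} (ha : a ∈ Icc (√2) 2) {F : ℝ → ℝ} {x : ℝ} (hx : a - 1 ≤ x) :
    fairOp a F x = 1 - F (tent a x) := by
  have h := (param_bounds ha).1
  rcases hx.eq_or_lt with rfl | h0
  · rw [fairOp, if_neg (by linarith), if_pos le_rfl, tent_sub_one ha]; ring
  · rw [fairOp, if_neg (by linarith), if_neg (by linarith)]

lemma IsCdfOn.fairOp {a : ℝ} (ha : a ∈ Icc (√2) 2) {F : ℝ → ℝ} (hF : IsCdfOn a F) :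
    IsCdfOn a (fairOp a F) := by
  obtain ⟨h1, h2, h3⟩ := param_bounds ha
  have m0 := zero_mem_interval ha
  have ms : a - 1 ∈ Icc (1 - a) 1 := ⟨by linarith, by linarith⟩
  have mL : MonotoneOn (FairEntropy.fairOp a F) (Icc (1 - a) 0) := by
    intro x hx y hy hxy
    rw [fairOp_nonpos F hx.2, fairOp_nonpos F hy.2]
    have := hF.monotoneOn (tent_mem ha ⟨hx.1, hx.2.trans zero_le_one⟩)
      (tent_mem ha ⟨hy.1, hy.2.trans zero_le_one⟩) (by
        rw [tent_of_nonpos hx.2, tent_of_nonpos hy.2]; nlinarith)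
    linarith
  have mC : MonotoneOn (FairEntropy.fairOp a F) (Icc 0 (a - 1)) := by
    intro x hx y hy hxy
    rw [fairOp_center hF.map_one hx, fairOp_center hF.map_one hy]
    have := hF.monotoneOn (tent_mem ha ⟨by linarith [hy.1], by linarith [hy.2]⟩)
      (tent_mem ha ⟨by linarith [hx.1], by linarith [hx.2]⟩) (by
        rw [tent_of_nonneg hx.1, tent_of_nonneg hy.1]; nlinarith : tent a y ≤ tent a x)
    linarith
  have mR : MonotoneOn (FairEntropy.fairOp a F) (Icc (a - 1) 1) := by
    intro x hx y hy hxy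
    rw [fairOp_right ha hx.1, fairOp_right ha hy.1]
    have := hF.monotoneOn (tent_mem ha ⟨by linarith [hy.1], by linarith [hy.2]⟩)
      (tent_mem ha ⟨by linarith [hx.1], by linarith [hx.2]⟩) (by
        rw [tent_of_nonneg (show 0 ≤ x by linarith [hx.1]),
          tent_of_nonneg (show 0 ≤ y by linarith [hy.1])]
        nlinarith : tent a y ≤ tent a x)
    linarith
  refine ⟨?_, ?_, ?_⟩
  · have e1 : Icc (1 - a) (a - 1) = Icc (1 - a) 0 ∪ Icc 0 (a - 1) :=
      (Icc_union_Icc_eq_Icc (by linarith) (by linarith)).symm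
    have e2 : Icc (1 - a) 1 = Icc (1 - a) (a - 1) ∪ Icc (a - 1) 1 :=
      (Icc_union_Icc_eq_Icc (by linarith) (by linarith)).symm
    rw [e2]
    refine MonotoneOn.union_right ?_ mR (isGreatest_Icc (by linarith)) (isLeast_Icc (by linarith))
    rw [e1]
    exact mL.union_right mC (isGreatest_Icc (by linarith)) (isLeast_Icc (by linarith))
  · rw [fairOp_nonpos F (by linarith), tent_one_sub ha]; ring
  · rw [fairOp_right ha (by linarith), tent_one, hF.map_left]; ring

lemma IsCdfOn.mem_Icc {a : ℝ} {F : ℝ → ℝ} (ha : a ∈ Icc (√2) 2) (hF : IsCdfOn a F) {x : ℝ}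
    (hx : x ∈ Icc (1 - a) 1) : F x ∈ Icc (0 : ℝ) 1 := by
  have h := (param_bounds ha).1
  constructor
  · rw [← hF.map_left]
    exact hF.monotoneOn ⟨le_rfl, by linarith⟩ hx hx.1
  · rw [← hF.map_one]
    exact hF.monotoneOn hx ⟨by linarith, le_rfl⟩ hx.2

/-- A fair distribution function exists: a limit along an ultrafilter of the Cesàro averages of the
iterates of `fairOp` is a fixed point, since `fairOp` only evaluates its argument at points. -/
theorem exists_isFairCdf {a : ℝ} (ha : a ∈ Icc (√2) 2) : ∃ F, IsFairCdf a F := by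
  obtain ⟨h1, h2, h3⟩ := param_bounds ha
  have m0 := zero_mem_interval ha
  have m1 := one_mem_interval ha
  set G : ℕ → ℝ → ℝ := fun n => (fairOp a)^[n] (fun x => (x - (1 - a)) / a) with hG
  have hGs : ∀ n, G (n + 1) = fairOp a (G n) := fun n => Function.iterate_succ_apply' _ _ _
  have hcdf : ∀ n, IsCdfOn a (G n) := by
    intro n
    induction n with
    | zero =>
      refine ⟨fun x _ y _ hxy => ?_, ?_, ?_⟩
      · exact div_le_div_of_nonneg_right (by linarith) (by linarith)
      · simp [hG]
      · have : a ≠ 0 := by linarith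
        simp [hG, this]
    | succ n ih => rw [hGs]; exact ih.fairOp ha
  set avg : ℕ → ℝ → ℝ := fun N x => (∑ i ∈ Finset.range (N + 1), G i x) / (N + 1) with havg
  have hpos : ∀ N : ℕ, (0 : ℝ) < N + 1 := fun N => by positivity
  have hmem : ∀ x ∈ Icc (1 - a) 1, ∀ N, avg N x ∈ Icc (0 : ℝ) 1 := by
    intro x hx N
    constructor
    · exact div_nonneg (Finset.sum_nonneg fun i _ => ((hcdf i).mem_Icc ha hx).1) (hpos N).le
    · rw [div_le_one (hpos N)]
      calc _ ≤ ∑ i ∈ Finset.range (N + 1), (1 : ℝ) :=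
            Finset.sum_le_sum fun i _ => ((hcdf i).mem_Icc ha hx).2
        _ = _ := by simp
  have hex : ∀ x, ∃ l, x ∈ Icc (1 - a) 1 →
      Tendsto (fun N => avg N x) (hyperfilter ℕ : Filter ℕ) (𝓝 l) := by
    intro x
    by_cases hx : x ∈ Icc (1 - a) 1
    · obtain ⟨l, -, hl⟩ := (isCompact_Icc (a := (0 : ℝ)) (b := 1)).ultrafilter_le_nhds
        ((hyperfilter ℕ).map fun N => avg N x)
        (by rw [Ultrafilter.coe_map, le_principal_iff]
            exact Filter.mem_map.2 (univ_mem' (hmem x hx)))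
      exact ⟨l, fun _ => by rwa [Ultrafilter.coe_map] at hl⟩
    · exact ⟨0, fun h => absurd h hx⟩
  choose F hF using hex
  have hshift : ∀ x ∈ Icc (1 - a) 1,
      Tendsto (fun N : ℕ => (∑ i ∈ Finset.range (N + 1), G (i + 1) x) / (N + 1))
        (hyperfilter ℕ : Filter ℕ) (𝓝 (F x)) := by
    intro x hx
    have hz : Tendsto (fun N : ℕ => (G (N + 1) x - G 0 x) / ((N : ℝ) + 1))
        (hyperfilter ℕ : Filter ℕ) (𝓝 0) := by
      refine Tendsto.mono_left ?_ Nat.hyperfilter_le_atTop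
      refine squeeze_zero_norm (fun N => ?_) tendsto_one_div_add_atTop_nhds_zero_nat
      have i1 := (hcdf (N + 1)).mem_Icc ha hx
      have i2 := (hcdf 0).mem_Icc ha hx
      rw [Real.norm_eq_abs, abs_div, abs_of_pos (hpos N)]
      exact div_le_div_of_nonneg_right (abs_le.2 ⟨by linarith [i1.1, i2.2], by
        linarith [i1.2, i2.1]⟩) (hpos N).le
    have := (hF x hx).add hz
    rw [add_zero] at this
    refine this.congr fun N => ?_
    rw [havg, ← add_div]
    congr 1
    have e1 := Finset.sum_range_succ (fun i => G i x) (N + 1)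
    have e2 := Finset.sum_range_succ' (fun i => G i x) (N + 1)
    linarith
  have rel : ∀ x ∈ Icc (1 - a) 1, ∀ p q c : ℝ,
      (∀ n, fairOp a (G n) x = c + p * G n (critOrbit a 3) + q * G n (tent a x)) →
      F x = c + p * F (critOrbit a 3) + q * F (tent a x) := by
    intro x hx p q c h
    refine tendsto_nhds_unique (hshift x hx) ?_
    refine (((hF _ (critOrbit_mem ha 3)).const_mul p).const_add c |>.add
      ((hF _ (tent_mem ha hx)).const_mul q)).congr fun N => ?_
    have hne := (hpos N).ne'
    simp only [hGs, h, havg, Finset.sum_add_distrib, ← Finset.mul_sum]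
    simp only [Finset.sum_const, Finset.card_range, nsmul_eq_mul]
    push_cast
    field_simp
  have hleft : ∀ x ∈ Icc (1 - a) 0, F x = (F (tent a x) - F (critOrbit a 3)) / 2 := by
    intro x hx
    have := rel x ⟨hx.1, hx.2.trans zero_le_one⟩ (-1 / 2) (1 / 2) 0 fun n => by
      rw [fairOp_nonpos _ hx.2]; ring
    rw [this]; ring
  have hone : F 1 = 1 := by
    refine tendsto_nhds_unique (hF 1 m1) (tendsto_const_nhds.congr fun N => ?_)
    have hne := (hpos N).ne'
    simp only [havg, (hcdf _).map_one]
    simp [hne]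
  have hzero : F 0 = (1 - F (critOrbit a 3)) / 2 := by
    rw [hleft 0 ⟨m0.1, le_rfl⟩, tent_zero, hone]
  refine ⟨F, ?_, ?_, hone, ?_, ?_, ?_⟩
  · intro x hx y hy hxy
    refine le_of_tendsto_of_tendsto' (hF x hx) (hF y hy) fun N => ?_
    exact div_le_div_of_nonneg_right
      (Finset.sum_le_sum fun i _ => (hcdf i).monotoneOn hx hy hxy) (hpos N).le
  · rw [hleft _ ⟨le_rfl, m0.1⟩, tent_one_sub ha]; ring
  · intro x hx
    rw [hzero, hleft x hx]; ring
  · intro x hx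
    have := rel x ⟨by linarith [hx.1], by linarith [hx.2]⟩ (-1 / 2) (-1 / 2) 1 fun n => by
      rw [fairOp_center (hcdf n).map_one hx]; ring
    rw [hzero, this]; ring
  · intro x hx
    have := rel x ⟨by linarith [hx.1], by linarith [hx.2]⟩ 0 (-1) 1 fun n => by
      rw [fairOp_right ha hx.1]; ring
    rw [this]; ring

/-- Along two steps a fair distribution function contracts oscillations, hence it is continuous. -/
lemma IsFairCdf.continuousOn {a : ℝ} (ha : a ∈ Icc (√2) 2) {F : ℝ → ℝ} (hF : IsFairCdf a F) :
    ContinuousOn F (Icc (1 - a) 1) := by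
  obtain ⟨h1, h2, h3⟩ := param_bounds ha
  let Share : ℝ → ℝ → Prop := fun x y => (x ≤ 0 ∧ y ≤ 0) ∨
    (0 ≤ x ∧ x ≤ a - 1 ∧ 0 ≤ y ∧ y ≤ a - 1) ∨ (a - 1 ≤ x ∧ a - 1 ≤ y)
  have share : ∀ x, ∀ᶠ y in 𝓝 x, Share x y := by
    intro x
    rcases lt_or_ge x 0 with h | h
    · filter_upwards [eventually_lt_nhds h] with y hy using Or.inl ⟨h.le, hy.le⟩
    rcases lt_or_ge x (a - 1) with h' | h'
    · rcases h.eq_or_lt with rfl | h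
      · filter_upwards [eventually_lt_nhds h'] with y hy
        rcases le_total y 0 with h4 | h4
        · exact Or.inl ⟨le_rfl, h4⟩
        · exact Or.inr (Or.inl ⟨le_rfl, h'.le, h4, hy.le⟩)
      · filter_upwards [eventually_lt_nhds h', eventually_gt_nhds h] with y hy hy'
        exact Or.inr (Or.inl ⟨h.le, h'.le, hy'.le, hy.le⟩)
    · filter_upwards [eventually_gt_nhds (show 0 < x by linarith),
        (h'.eq_or_lt.elim (fun e => by
          subst e; exact Eventually.of_forall fun y => Or.inl rfl)
          (fun l => (eventually_gt_nhds l).mono fun y hy => Or.inr hy.le) :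
          ∀ᶠ y in 𝓝 x, x = a - 1 ∨ a - 1 ≤ y)] with y hy hy'
      rcases le_total y (a - 1) with h4 | h4
      · rcases hy' with rfl | h5
        · exact Or.inr (Or.inl ⟨by linarith, le_rfl, hy.le, h4⟩)
        · exact Or.inr (Or.inr ⟨h', h5⟩)
      · exact Or.inr (Or.inr ⟨h', h4⟩)
  have halve : ∀ x ∈ Icc (1 - a) 1, ∀ y ∈ Icc (1 - a) 1, Share x y → x ≤ a - 1 → y ≤ a - 1 →
      |F y - F x| ≤ |F (tent a y) - F (tent a x)| / 2 := by
    rintro x hx y hy hs hxa hya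
    rcases hs with ⟨h4, h5⟩ | ⟨h4, h5, h6, h7⟩ | ⟨h4, h5⟩
    · rw [hF.nonpos x ⟨hx.1, h4⟩, hF.nonpos y ⟨hy.1, h5⟩,
        show 2 * F y + 1 - 2 * F 0 - (2 * F x + 1 - 2 * F 0) = 2 * (F y - F x) by ring,
        abs_mul, abs_two]
      linarith
    · rw [hF.center x ⟨h4, h5⟩, hF.center y ⟨h6, h7⟩,
        show 1 - 2 * F y + 2 * F 0 - (1 - 2 * F x + 2 * F 0) = -(2 * (F y - F x)) by ring,
        abs_neg, abs_mul, abs_two]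
      linarith
    · have : x = y := by linarith
      simp [this]
  have small : ∀ n : ℕ, ∀ x ∈ Icc (1 - a) 1,
      ∀ᶠ y in 𝓝[Icc (1 - a) 1] x, |F y - F x| ≤ (1 / 2) ^ n := by
    intro n
    induction n with
    | zero =>
      intro x hx
      filter_upwards [self_mem_nhdsWithin] with y hy
      have i1 := hF.mem_Icc ha hx
      have i2 := hF.mem_Icc ha hy
      rw [pow_zero]
      exact abs_le.2 ⟨by linarith [i1.2, i2.1], by linarith [i1.1, i2.2]⟩
    | succ n ih =>
      intro x hx
      have ct : ∀ z ∈ Icc (1 - a) 1, Tendsto (tent a) (𝓝[Icc (1 - a) 1] z)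
          (𝓝[Icc (1 - a) 1] (tent a z)) := fun z _ =>
        tendsto_nhdsWithin_iff.2 ⟨(continuous_tent a).continuousAt.tendsto.mono_left
          nhdsWithin_le_nhds, eventually_mem_nhdsWithin.mono fun y hy => tent_mem ha hy⟩
      have e1 := (ct x hx).eventually (ih _ (tent_mem ha hx))
      have e2 := (ct x hx).eventually ((ct _ (tent_mem ha hx)).eventually
        (ih _ (tent_mem ha (tent_mem ha hx))))
      have e3 := (ct x hx).eventually
        ((share (tent a x)).filter_mono (nhdsWithin_le_nhds (s := Icc (1 - a) 1)))
      filter_upwards [self_mem_nhdsWithin, e1, e2, e3,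
        (share x).filter_mono nhdsWithin_le_nhds] with y hy h4 h5 h6 h7
      rw [pow_succ]
      by_cases h8 : x ≤ a - 1 ∧ y ≤ a - 1
      · linarith [halve x hx y hy h7 h8.1 h8.2]
      · have h9 : a - 1 ≤ x ∧ a - 1 ≤ y := by
          rcases h7 with h | h | h
          · exact absurd ⟨by linarith [h.1], by linarith [h.2]⟩ h8
          · exact absurd ⟨h.2.1, h.2.2.2⟩ h8
          · exact h
        have h10 : |F y - F x| = |F (tent a y) - F (tent a x)| := by
          rw [hF.right x ⟨h9.1, hx.2⟩, hF.right y ⟨h9.2, hy.2⟩, ← abs_neg]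
          congr 1; ring
        have := halve _ (tent_mem ha hx) _ (tent_mem ha hy) h6
          ((tent_le_of_right ha h9.1).trans (critOrbit_three_le ha))
          ((tent_le_of_right ha h9.2).trans (critOrbit_three_le ha))
        linarith
  intro x hx
  refine Metric.tendsto_nhds.2 fun ε hε => ?_
  obtain ⟨n, hn⟩ := exists_pow_lt_of_lt_one hε (show (1 / 2 : ℝ) < 1 by norm_num)
  filter_upwards [small n x hx] with y hy
  rw [Real.dist_eq]
  exact hy.trans_lt hn

/-! ### Fair measures and fair distribution functions -/

lemma image_tent_nonpos {a : ℝ} (ha : a ∈ Icc (√2) 2) (E : Set ℝ) :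
    tent a '' (E ∩ Icc (1 - a) 0) =
      (fun y => (y - 1) / a) ⁻¹' E ∩ Icc (critOrbit a 3) 1 := by
  have h := (param_bounds ha).1
  have h0 : a ≠ 0 := by linarith
  rw [critOrbit_three ha]
  ext y
  constructor
  · rintro ⟨x, ⟨hE, hx1, hx0⟩, rfl⟩
    rw [tent_of_nonpos hx0]
    refine ⟨?_, by nlinarith, by nlinarith⟩
    rw [mem_preimage, show (1 + a * x - 1) / a = x by field_simp; ring]
    exact hE
  · rintro ⟨hE, hy1, hy2⟩
    have h1 : (y - 1) / a ≤ 0 := div_nonpos_of_nonpos_of_nonneg (by linarith) (by linarith)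
    refine ⟨(y - 1) / a, ⟨hE, ?_, h1⟩, ?_⟩
    · rw [le_div_iff₀ (by linarith)]; nlinarith
    · rw [tent_of_nonpos h1]; field_simp; ring

lemma image_tent_nonneg {a : ℝ} (ha : a ∈ Icc (√2) 2) (E : Set ℝ) {u v : ℝ} (hu : 0 ≤ u) :
    tent a '' (E ∩ Icc u v) = (fun y => (1 - y) / a) ⁻¹' E ∩ Icc (1 - a * v) (1 - a * u) := by
  have h := (param_bounds ha).1
  have h0 : a ≠ 0 := by linarith
  ext y
  constructor
  · rintro ⟨x, ⟨hE, hx1, hx0⟩, rfl⟩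
    rw [tent_of_nonneg (hu.trans hx1)]
    refine ⟨?_, by nlinarith, by nlinarith⟩
    rw [mem_preimage, show (1 - (1 - a * x)) / a = x by field_simp; ring]
    exact hE
  · rintro ⟨hE, hy1, hy2⟩
    have h1 : u ≤ (1 - y) / a := by rw [le_div_iff₀ (by linarith)]; linarith
    refine ⟨(1 - y) / a, ⟨hE, h1, ?_⟩, ?_⟩
    · rw [div_le_iff₀ (by linarith)]; linarith
    · rw [tent_of_nonneg (hu.trans h1)]; field_simp; ring

lemma image_tent_center {a : ℝ} (ha : a ∈ Icc (√2) 2) (E : Set ℝ) :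
    tent a '' (E ∩ Icc 0 (a - 1)) =
      (fun y => (1 - y) / a) ⁻¹' E ∩ Icc (critOrbit a 3) 1 := by
  rw [image_tent_nonneg ha E le_rfl, critOrbit_three ha, mul_zero, sub_zero]

lemma image_tent_right {a : ℝ} (ha : a ∈ Icc (√2) 2) (E : Set ℝ) :
    tent a '' (E ∩ Icc (a - 1) 1) =
      (fun y => (1 - y) / a) ⁻¹' E ∩ Icc (1 - a) (critOrbit a 3) := by
  rw [image_tent_nonneg ha E (by linarith [(param_bounds ha).1]), critOrbit_three ha, mul_one]

/-- The measure with a given fair distribution function is fair. -/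
theorem IsFairCdf.exists_isFairMeasure {a : ℝ} (ha : a ∈ Icc (√2) 2) {F : ℝ → ℝ}
    (hF : IsFairCdf a F) : ∃ μ : Measure ℝ, IsFairMeasure a μ := by
  obtain ⟨h1, h2, h3⟩ := param_bounds ha
  have h01 : 1 - a ≤ 1 := by linarith
  have m0 := zero_mem_interval ha
  have m1 := one_mem_interval ha
  have mc := critOrbit_mem ha 3
  have c3 := critOrbit_three ha
  have c3le := critOrbit_three_le ha
  -- `F` is extended by constants
  have hmem : ∀ x, max (1 - a) (min x 1) ∈ Icc (1 - a) 1 := fun x =>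
    ⟨le_max_left _ _, max_le h01 (min_le_right _ _)⟩
  have hcont : Continuous fun x => F (max (1 - a) (min x 1)) :=
    (hF.continuousOn ha).comp_continuous (by fun_prop) hmem
  let S : StieltjesFunction ℝ :=
    { toFun := fun x => F (max (1 - a) (min x 1))
      mono' := fun x y hxy => hF.monotoneOn (hmem x) (hmem y)
        (max_le_max le_rfl (min_le_min hxy le_rfl))
      right_continuous' := fun x => hcont.continuousWithinAt }
  have S_apply : ∀ x, S x = F (max (1 - a) (min x 1)) := fun x => rfl
  have S_mem : ∀ x ∈ Icc (1 - a) 1, S x = F x := fun x hx => by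
    rw [S_apply, min_eq_left hx.2, max_eq_right hx.1]
  have S_lt : ∀ x, x ≤ 1 - a → S x = 0 := fun x hx => by
    rw [S_apply, min_eq_left (hx.trans h01), max_eq_left hx, hF.map_left]
  have S_gt : ∀ x, 1 ≤ x → S x = 1 := fun x hx => by
    rw [S_apply, min_eq_right hx, max_eq_right h01, hF.map_one]
  have hleft : ∀ x, Function.leftLim S x = S x := fun x =>
    ContinuousWithinAt.leftLim_eq hcont.continuousWithinAt
  have hbot : Tendsto S atBot (𝓝 0) := tendsto_const_nhds.congr'
    ((eventually_le_atBot (1 - a)).mono fun x hx => (S_lt x hx).symm)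
  have htop : Tendsto S atTop (𝓝 1) := tendsto_const_nhds.congr'
    ((eventually_ge_atTop 1).mono fun x hx => (S_gt x hx).symm)
  have hIic : ∀ x, S.measure (Iic x) = ENNReal.ofReal (S x) := fun x => by
    rw [S.measure_Iic hbot, sub_zero]
  have hIcc : ∀ u v, S.measure (Icc u v) = ENNReal.ofReal (S v - S u) := fun u v => by
    rw [S.measure_Icc, hleft]
  have hatom : ∀ x, S.measure {x} = 0 := fun x => by
    rw [S.measure_singleton, hleft, sub_self, ENNReal.ofReal_zero]
  have hprob : IsProbabilityMeasure S.measure := S.isProbabilityMeasure hbot htop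
  set μ := S.measure with hμ
  -- the right-hand side of the fairness condition, as a measure
  let ν : Measure ℝ := (2⁻¹ : ℝ≥0∞) • (μ.restrict (Icc (critOrbit a 3) 1)).map (fun y => (y - 1) / a)
    + (2⁻¹ : ℝ≥0∞) • (μ.restrict (Icc (critOrbit a 3) 1)).map (fun y => (1 - y) / a)
    + (μ.restrict (Icc (1 - a) (critOrbit a 3))).map (fun y => (1 - y) / a)
  have ms : Measurable fun y : ℝ => (y - 1) / a := by fun_prop
  have mt : Measurable fun y : ℝ => (1 - y) / a := by fun_prop
  have hν : ∀ E, MeasurableSet E → ν E =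
      2⁻¹ * μ ((fun y => (y - 1) / a) ⁻¹' E ∩ Icc (critOrbit a 3) 1)
      + 2⁻¹ * μ ((fun y => (1 - y) / a) ⁻¹' E ∩ Icc (critOrbit a 3) 1)
      + μ ((fun y => (1 - y) / a) ⁻¹' E ∩ Icc (1 - a) (critOrbit a 3)) := by
    intro E hE
    simp only [ν, Measure.add_apply, Measure.smul_apply, smul_eq_mul]
    rw [Measure.map_apply ms hE, Measure.map_apply mt hE, Measure.map_apply mt hE,
      Measure.restrict_apply (ms hE), Measure.restrict_apply (mt hE),
      Measure.restrict_apply (mt hE)]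
  have half : ∀ t : ℝ, 0 ≤ t → 2⁻¹ * ENNReal.ofReal t = ENNReal.ofReal (t / 2) := by
    intro t _
    rw [div_eq_inv_mul, ENNReal.ofReal_mul (by norm_num), ENNReal.ofReal_inv_of_pos two_pos]
    norm_num
  have key : μ = ν := by
    refine Measure.ext_of_Iic μ ν fun x => ?_
    rw [hν _ measurableSet_Iic, hIic]
    have p1 : (fun y => (y - 1) / a) ⁻¹' Iic x = Iic (1 + a * x) := by
      ext y
      rw [mem_preimage, mem_Iic, mem_Iic, div_le_iff₀ (by linarith)]
      constructor <;> intro h <;> linarith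
    have p2 : (fun y => (1 - y) / a) ⁻¹' Iic x = Ici (1 - a * x) := by
      ext y
      rw [mem_preimage, mem_Iic, mem_Ici, div_le_iff₀ (by linarith)]
      constructor <;> intro h <;> linarith
    rw [p1, p2]
    have F01 : ∀ z ∈ Icc (1 - a) 1, 0 ≤ F z ∧ F z ≤ 1 := fun z hz => hF.mem_Icc ha hz
    have z0 := hF.nonpos (1 - a) ⟨le_rfl, m0.1⟩
    rw [tent_one_sub ha, hF.map_left] at z0
    rcases lt_or_ge x (1 - a) with hx | hx
    · have q1 : Iic (1 + a * x) ∩ Icc (critOrbit a 3) 1 = ∅ := by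
        ext y
        simp only [mem_inter_iff, mem_Iic, Set.mem_Icc, mem_empty_iff_false, iff_false]
        rintro ⟨h5, h6, h7⟩
        nlinarith
      have q2 : ∀ z ≤ 1, Ici (1 - a * x) ∩ Icc z 1 = ∅ := by
        intro z hz
        ext y
        simp only [mem_inter_iff, mem_Ici, Set.mem_Icc, mem_empty_iff_false, iff_false]
        rintro ⟨h5, h6, h7⟩
        nlinarith
      have q3 : Ici (1 - a * x) ∩ Icc (1 - a) (critOrbit a 3) = ∅ :=
        subset_empty_iff.1 ((inter_subset_inter_right _ (Icc_subset_Icc_right mc.2)).trans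
          (q2 _ h01).subset)
      rw [q1, q2 _ mc.2, q3, S_lt x hx.le]
      simp
    rcases lt_or_ge 1 x with hx1 | hx1
    · have q1 : Iic (1 + a * x) ∩ Icc (critOrbit a 3) 1 = Icc (critOrbit a 3) 1 :=
        inter_eq_right.2 fun y hy => by
          have := hy.2
          simp only [mem_Iic]; nlinarith
      have q2 : Ici (1 - a * x) ∩ Icc (critOrbit a 3) 1 = Icc (critOrbit a 3) 1 :=
        inter_eq_right.2 fun y hy => by
          have := hy.1
          have := mc.1
          simp only [mem_Ici]; nlinarith
      have q3 : Ici (1 - a * x) ∩ Icc (1 - a) (critOrbit a 3) = Icc (1 - a) (critOrbit a 3) :=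
        inter_eq_right.2 fun y hy => by
          have := hy.1
          simp only [mem_Ici]; nlinarith
      have f1 := F01 _ mc
      rw [q1, q2, q3, hIcc, hIcc, S_mem _ mc, S_mem _ m1, S_gt x hx1.le, S_lt _ le_rfl, hF.map_one,
        half _ (by linarith), ← ENNReal.ofReal_add (by linarith) (by linarith),
        ← ENNReal.ofReal_add (by linarith) (by linarith)]
      congr 1; ring
    have mx : x ∈ Icc (1 - a) 1 := ⟨hx, hx1⟩
    have mfx := tent_mem ha mx
    have f1 := F01 _ mc
    have f2 := F01 _ mfx
    have f3 := F01 _ mx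
    rw [S_mem x mx]
    rcases le_total x 0 with hx0 | hx0
    · have e := hF.nonpos x ⟨hx, hx0⟩
      have ft := tent_of_nonpos (a := a) hx0
      have q1 : Iic (1 + a * x) ∩ Icc (critOrbit a 3) 1 = Icc (critOrbit a 3) (tent a x) := by
        rw [ft]
        ext y
        simp only [mem_inter_iff, mem_Iic, Set.mem_Icc]
        constructor
        · rintro ⟨h5, h6, h7⟩; exact ⟨h6, h5⟩
        · rintro ⟨h5, h6⟩; exact ⟨h6, h5, by nlinarith⟩
      have q2 : ∀ z, μ (Ici (1 - a * x) ∩ Icc z 1) = 0 := fun z =>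
        measure_mono_null (fun y hy => by
          have h5 := hy.1
          have h6 := hy.2.2
          simp only [mem_Ici] at h5
          exact le_antisymm h6 (by nlinarith)) (hatom 1)
      have q3 : μ (Ici (1 - a * x) ∩ Icc (1 - a) (critOrbit a 3)) = 0 :=
        measure_mono_null (inter_subset_inter_right _ (Icc_subset_Icc_right mc.2)) (q2 _)
      rw [q1, q2, q3, hIcc, S_mem _ mfx, S_mem _ mc, mul_zero, add_zero, add_zero, half _ (by linarith)]
      congr 1; linarith
    have q1 : Iic (1 + a * x) ∩ Icc (critOrbit a 3) 1 = Icc (critOrbit a 3) 1 :=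
      inter_eq_right.2 fun y hy => by
        have := hy.2
        simp only [mem_Iic]; nlinarith
    have ft := tent_of_nonneg (a := a) hx0
    rw [q1, hIcc, S_mem _ mc, S_mem _ m1, hF.map_one]
    rcases le_total x (a - 1) with hxa | hxa
    · have e := hF.center x ⟨hx0, hxa⟩
      have q2 : Ici (1 - a * x) ∩ Icc (critOrbit a 3) 1 = Icc (tent a x) 1 := by
        rw [ft]
        ext y
        simp only [mem_inter_iff, mem_Ici, Set.mem_Icc]
        constructor
        · rintro ⟨h5, h6, h7⟩; exact ⟨h5, h7⟩
        · rintro ⟨h5, h6⟩; exact ⟨h5, by nlinarith, h6⟩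
      have q3 : μ (Ici (1 - a * x) ∩ Icc (1 - a) (critOrbit a 3)) = 0 :=
        measure_mono_null (fun y hy => by
          have h5 := hy.1
          have h6 := hy.2.2
          simp only [mem_Ici] at h5
          exact le_antisymm h6 (by nlinarith)) (hatom (critOrbit a 3))
      rw [q2, q3, hIcc, S_mem _ mfx, S_mem _ m1, hF.map_one, add_zero, half _ (by linarith),
        half _ (by linarith), ← ENNReal.ofReal_add (by linarith) (by linarith)]
      congr 1; linarith
    · have e := hF.right x ⟨hxa, hx1⟩
      have q2 : Ici (1 - a * x) ∩ Icc (critOrbit a 3) 1 = Icc (critOrbit a 3) 1 :=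
        inter_eq_right.2 fun y hy => by
          have := hy.1
          simp only [mem_Ici]; nlinarith
      have q3 : Ici (1 - a * x) ∩ Icc (1 - a) (critOrbit a 3) = Icc (tent a x) (critOrbit a 3) := by
        rw [ft]
        ext y
        simp only [mem_inter_iff, mem_Ici, Set.mem_Icc]
        constructor
        · rintro ⟨h5, h6, h7⟩; exact ⟨h5, h7⟩
        · rintro ⟨h5, h6⟩; exact ⟨h5, by nlinarith, h6⟩
      have f4 : F (tent a x) ≤ F (critOrbit a 3) :=
        hF.monotoneOn mfx mc (tent_le_of_right ha hxa)
      rw [q2, q3, hIcc, hIcc, S_mem _ mfx, S_mem _ m1, S_mem _ mc, hF.map_one, half _ (by linarith),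
        ← ENNReal.ofReal_add (by linarith) (by linarith),
        ← ENNReal.ofReal_add (by linarith) (by linarith)]
      congr 1; linarith
  refine ⟨μ, hprob, hatom, ?_, ?_⟩
  · rw [prob_compl_eq_zero_iff measurableSet_Icc, hIcc, S_gt _ le_rfl, S_lt _ le_rfl]
    simp
  · intro E hE _
    rw [image_tent_nonpos ha, image_tent_center ha, image_tent_right ha, ← hν E hE, ← key]

namespace IsFairMeasure

variable {a : ℝ} {μ : Measure ℝ}

lemma null_of_subset_singleton (hμ : IsFairMeasure a μ) {s : Set ℝ} {x : ℝ} (h : s ⊆ {x}) :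
    μ s = 0 := measure_mono_null h (hμ.atomless x)

lemma measure_nonpos (ha : a ∈ Icc (√2) 2) (hμ : IsFairMeasure a μ) {E : Set ℝ}
    (hE : MeasurableSet E) (hs : E ⊆ Icc (1 - a) 0) : μ E = 2⁻¹ * μ (tent a '' E) := by
  have h := (param_bounds ha).1
  have e1 : E ∩ Icc (1 - a) 0 = E := inter_eq_left.2 hs
  have e2 : tent a '' (E ∩ Icc 0 (a - 1)) ⊆ {1} := by
    rintro _ ⟨x, hx, rfl⟩
    have : x = 0 := le_antisymm (hs hx.1).2 hx.2.1
    rw [this, tent_zero]; rfl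
  have e3 : E ∩ Icc (a - 1) 1 = ∅ := by
    refine eq_empty_of_forall_notMem fun x hx => ?_
    linarith [(hs hx.1).2, hx.2.1]
  rw [hμ.fair E hE (hs.trans (Icc_subset_Icc_right zero_le_one)), e1,
    hμ.null_of_subset_singleton e2, e3]
  simp

lemma measure_center (ha : a ∈ Icc (√2) 2) (hμ : IsFairMeasure a μ) {E : Set ℝ}
    (hE : MeasurableSet E) (hs : E ⊆ Icc 0 (a - 1)) : μ E = 2⁻¹ * μ (tent a '' E) := by
  have h := param_bounds ha
  have e1 : E ∩ Icc 0 (a - 1) = E := inter_eq_left.2 hs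
  have e2 : tent a '' (E ∩ Icc (1 - a) 0) ⊆ {1} := by
    rintro _ ⟨x, hx, rfl⟩
    have : x = 0 := le_antisymm hx.2.2 (hs hx.1).1
    rw [this, tent_zero]; rfl
  have e3 : tent a '' (E ∩ Icc (a - 1) 1) ⊆ {critOrbit a 3} := by
    rintro _ ⟨x, hx, rfl⟩
    have : x = a - 1 := le_antisymm (hs hx.1).2 hx.2.1
    rw [this, tent_sub_one ha]; rfl
  rw [hμ.fair E hE (hs.trans (Icc_subset_Icc (by linarith) (by linarith))), e1,
    hμ.null_of_subset_singleton e2, hμ.null_of_subset_singleton e3]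
  simp

lemma measure_right (ha : a ∈ Icc (√2) 2) (hμ : IsFairMeasure a μ) {E : Set ℝ}
    (hE : MeasurableSet E) (hs : E ⊆ Icc (a - 1) 1) : μ E = μ (tent a '' E) := by
  have h := param_bounds ha
  have e1 : E ∩ Icc (a - 1) 1 = E := inter_eq_left.2 hs
  have e2 : E ∩ Icc (1 - a) 0 = ∅ := by
    refine eq_empty_of_forall_notMem fun x hx => ?_
    linarith [(hs hx.1).1, hx.2.2]
  have e3 : tent a '' (E ∩ Icc 0 (a - 1)) ⊆ {critOrbit a 3} := by
    rintro _ ⟨x, hx, rfl⟩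
    have : x = a - 1 := le_antisymm hx.2.2 (hs hx.1).1
    rw [this, tent_sub_one ha]; rfl
  rw [hμ.fair E hE (hs.trans (Icc_subset_Icc_left (by linarith))), e1, e2,
    hμ.null_of_subset_singleton e3]
  simp

lemma measureReal_Icc (hμ : IsFairMeasure a μ) {u v : ℝ} (h : u ≤ v) :
    μ.real (Icc u v) = μ.real (Iic v) - μ.real (Iic u) := by
  have := hμ.isProbabilityMeasure
  have e : Icc u v = {u} ∪ (Iic v \ Iic u) := by
    ext x
    simp only [Set.mem_Icc, mem_union, mem_singleton_iff, Set.mem_sdiff, mem_Iic, not_le]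
    constructor
    · rintro ⟨h1, h2⟩
      exact h1.eq_or_lt.imp Eq.symm fun h3 => ⟨h2, h3⟩
    · rintro (rfl | ⟨h1, h2⟩)
      exacts [⟨le_rfl, h⟩, ⟨h2.le, h1⟩]
  have : μ (Icc u v) = μ (Iic v \ Iic u) := by
    rw [e]
    refine le_antisymm ((measure_union_le _ _).trans ?_) (measure_mono subset_union_right)
    rw [hμ.atomless, zero_add]
  rw [measureReal_def, this, ← measureReal_def, measureReal_sdiff (Iic_subset_Iic.2 h) measurableSet_Iic]

lemma measureReal_Iic_left (hμ : IsFairMeasure a μ) {x : ℝ} (hx : x ≤ 1 - a) :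
    μ.real (Iic x) = 0 := by
  rw [measureReal_def, ENNReal.toReal_eq_zero_iff]
  left
  refine measure_mono_null (t := {1 - a} ∪ (Icc (1 - a) 1)ᶜ) (fun y hy => ?_)
    (measure_union_null (hμ.atomless _) hμ.concentrated)
  rw [mem_Iic] at hy
  rcases (hy.trans hx).eq_or_lt with h | h
  · exact Or.inl h
  · exact Or.inr fun h' => absurd h'.1 (not_le.2 h)

lemma measureReal_Iic_right (hμ : IsFairMeasure a μ) {x : ℝ} (hx : 1 ≤ x) :
    μ.real (Iic x) = 1 := by
  have := hμ.isProbabilityMeasure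
  have : (Icc (1 - a) 1) ⊆ Iic x := fun y hy => hy.2.trans hx
  have h2 : μ (Iic x)ᶜ = 0 := measure_mono_null (compl_subset_compl.2 this) hμ.concentrated
  rw [prob_compl_eq_zero_iff measurableSet_Iic] at h2
  rw [measureReal_def, h2, ENNReal.toReal_one]

/-- The distribution function of a fair measure. -/
theorem isFairCdf (ha : a ∈ Icc (√2) 2) (hμ : IsFairMeasure a μ) :
    IsFairCdf a (fun x => μ.real (Iic x)) := by
  have := hμ.isProbabilityMeasure
  obtain ⟨h1, h2, h3⟩ := param_bounds ha
  have hz := hμ.measureReal_Iic_left le_rfl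
  have ho := hμ.measureReal_Iic_right le_rfl
  have real_eq : ∀ {s t : Set ℝ}, μ s = 2⁻¹ * μ t → μ.real t = 2 * μ.real s := by
    intro s t h
    rw [measureReal_def, measureReal_def, h, ENNReal.toReal_mul]
    norm_num
    ring
  have im0 : ∀ u v, v ≤ 0 → tent a '' Icc u v = Icc (1 + a * u) (1 + a * v) := by
    intro u v hv
    ext y
    constructor
    · rintro ⟨x, hx, rfl⟩
      rw [tent_of_nonpos (hx.2.trans hv)]
      exact ⟨by nlinarith [hx.1], by nlinarith [hx.2]⟩
    · rintro ⟨hy1, hy2⟩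
      have i1 : u ≤ (y - 1) / a := by rw [le_div_iff₀ (by linarith)]; linarith
      have i2 : (y - 1) / a ≤ v := by rw [div_le_iff₀ (by linarith)]; linarith
      refine ⟨(y - 1) / a, ⟨i1, i2⟩, ?_⟩
      have : a ≠ 0 := by linarith
      rw [tent_of_nonpos (i2.trans hv)]; field_simp; ring
  have im1 : ∀ u v, 0 ≤ u → tent a '' Icc u v = Icc (1 - a * v) (1 - a * u) := by
    intro u v hu
    have := image_tent_nonneg ha univ (v := v) hu
    rwa [univ_inter, preimage_univ, univ_inter] at this
  refine ⟨fun x _ y _ hxy => measureReal_mono (Iic_subset_Iic.2 hxy), hz, ho, ?_, ?_, ?_⟩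
  · have key : ∀ x ∈ Icc (1 - a) 0,
        μ.real (Iic (tent a x)) - μ.real (Iic (critOrbit a 3)) = 2 * μ.real (Iic x) := by
      intro x hx
      have := real_eq (hμ.measure_nonpos ha measurableSet_Icc (Icc_subset_Icc_right hx.2) :
        μ (Icc (1 - a) x) = _)
      rw [im0 _ _ hx.2, hμ.measureReal_Icc hx.1, hz, hμ.measureReal_Icc (by nlinarith [hx.1])] at this
      rw [tent_of_nonpos hx.2, critOrbit_three ha, show 1 - a * (a - 1) = 1 + a * (1 - a) by ring]
      linarith
    intro x hx
    have k0 := key 0 ⟨by linarith, le_rfl⟩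
    have k1 := key x hx
    rw [tent_zero, ho] at k0
    linarith
  · intro x hx
    have := real_eq (hμ.measure_center ha measurableSet_Icc (Icc_subset_Icc_right hx.2) :
      μ (Icc 0 x) = _)
    rw [im1 _ _ le_rfl, hμ.measureReal_Icc hx.1, hμ.measureReal_Icc (by nlinarith [hx.1]), mul_zero,
      sub_zero, ho] at this
    rw [tent_of_nonneg hx.1]
    linarith
  · intro x hx
    have := hμ.measure_right ha measurableSet_Icc (Icc_subset_Icc_left hx.1 :
      Icc x 1 ⊆ Icc (a - 1) 1)
    have this : μ.real (Icc x 1) = μ.real (tent a '' Icc x 1) := by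
      rw [measureReal_def, this, measureReal_def]
    have hx0 : 0 ≤ x := by linarith [hx.1]
    rw [im1 _ _ hx0, hμ.measureReal_Icc hx.2, hμ.measureReal_Icc (by nlinarith [hx.2]), mul_one,
      hz, ho] at this
    rw [tent_of_nonneg hx0]
    linarith

theorem unique (ha : a ∈ Icc (√2) 2) {ν : Measure ℝ} (hμ : IsFairMeasure a μ)
    (hν : IsFairMeasure a ν) : μ = ν := by
  have := hμ.isProbabilityMeasure
  have := hν.isProbabilityMeasure
  refine Measure.ext_of_Iic μ ν fun x => ?_
  rw [← ENNReal.toReal_eq_toReal_iff' (measure_ne_top _ _) (measure_ne_top _ _)]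
  change μ.real (Iic x) = ν.real (Iic x)
  rcases le_total x (1 - a) with h | h
  · rw [hμ.measureReal_Iic_left h, hν.measureReal_Iic_left h]
  rcases le_total 1 x with h' | h'
  · rw [hμ.measureReal_Iic_right h', hν.measureReal_Iic_right h']
  exact (hμ.isFairCdf ha).eqOn ha (hν.isFairCdf ha) ⟨h, h'⟩

theorem measurePreserving (ha : a ∈ Icc (√2) 2) (hμ : IsFairMeasure a μ) :
    MeasurePreserving (tent a) μ μ := by
  obtain ⟨h1, h2, h3⟩ := param_bounds ha
  have h0 : a ≠ 0 := by linarith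
  have mf : Measurable (tent a) := (continuous_tent a).measurable
  refine ⟨mf, Measure.ext fun B hB => ?_⟩
  rw [Measure.map_apply mf hB]
  have conc : ∀ s : Set ℝ, μ s = μ (s ∩ Icc (1 - a) 1) := fun s =>
    (measure_inter_conull hμ.concentrated).symm
  have c3 := critOrbit_three ha
  have mc := critOrbit_mem ha 3
  have s1 : (fun y => (y - 1) / a) ⁻¹' (tent a ⁻¹' B ∩ Icc (1 - a) 1) ∩ Icc (critOrbit a 3) 1
      = B ∩ Icc (critOrbit a 3) 1 := by
    ext y
    simp only [mem_inter_iff, mem_preimage]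
    refine and_congr_left fun hy => ?_
    have i1 : (y - 1) / a ≤ 0 := div_nonpos_of_nonpos_of_nonneg (by linarith [hy.2]) (by linarith)
    have i2 : 1 - a ≤ (y - 1) / a := by rw [le_div_iff₀ (by linarith)]; nlinarith [hy.1]
    have : tent a ((y - 1) / a) = y := by rw [tent_of_nonpos i1]; field_simp; ring
    rw [this]
    exact and_iff_left ⟨i2, by linarith⟩
  have s2 : ∀ u v, 1 - a ≤ u → v ≤ 1 →
      (fun y => (1 - y) / a) ⁻¹' (tent a ⁻¹' B ∩ Icc (1 - a) 1) ∩ Icc u v = B ∩ Icc u v := by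
    intro u v hu hv
    ext y
    simp only [mem_inter_iff, mem_preimage]
    refine and_congr_left fun hy => ?_
    have i1 : 0 ≤ (1 - y) / a := div_nonneg (by linarith [hy.2]) (by linarith)
    have i2 : (1 - y) / a ≤ 1 := by rw [div_le_one (by linarith)]; linarith [hy.1]
    have : tent a ((1 - y) / a) = y := by rw [tent_of_nonneg i1]; field_simp; ring
    rw [this]
    exact and_iff_left ⟨by linarith, i2⟩
  rw [conc, hμ.fair _ ((mf hB).inter measurableSet_Icc) inter_subset_right, image_tent_nonpos ha,
    image_tent_center ha, image_tent_right ha, s1, s2 _ _ mc.1 le_rfl, s2 _ _ le_rfl mc.2, ← add_mul,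
    ENNReal.inv_two_add_inv_two, one_mul, conc B]
  have e : B ∩ Icc (1 - a) 1 = (B ∩ Icc (critOrbit a 3) 1) ∪ (B ∩ Icc (1 - a) (critOrbit a 3)) := by
    rw [← inter_union_distrib_left, union_comm, Icc_union_Icc_eq_Icc mc.1 mc.2]
  rw [e]
  refine (measure_union₀ (hB.inter measurableSet_Icc).nullMeasurableSet ?_).symm
  exact hμ.null_of_subset_singleton (x := critOrbit a 3) fun y hy =>
    le_antisymm hy.2.2.2 hy.1.2.1

end IsFairMeasure

theorem existsUnique_isFairMeasure {a : ℝ} (ha : a ∈ Icc (√2) 2) :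
    ∃! μ : Measure ℝ, IsFairMeasure a μ := by
  obtain ⟨F, hF⟩ := exists_isFairCdf ha
  obtain ⟨μ, hμ⟩ := hF.exists_isFairMeasure ha
  exact ⟨μ, hμ, fun ν hν => hν.unique ha hμ⟩

theorem isFairMeasure_fairMeasure {a : ℝ} (ha : a ∈ Icc (√2) 2) :
    IsFairMeasure a (fairMeasure a) := by
  have h := (existsUnique_isFairMeasure ha).exists
  rw [fairMeasure, dif_pos h]
  exact h.choose_spec

/-- The distribution function of the fair measure `μ_a`. -/
noncomputable def fairCdf (a x : ℝ) : ℝ := (fairMeasure a).real (Iic x)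

lemma isFairCdf_fairCdf {a : ℝ} (ha : a ∈ Icc (√2) 2) : IsFairCdf a (fairCdf a) :=
  (isFairMeasure_fairMeasure ha).isFairCdf ha

/-! ### Fair measures under iteration -/

lemma continuous_iterate_tent (a : ℝ) (n : ℕ) : Continuous (tent a)^[n] :=
  (continuous_tent a).iterate n

namespace IsFairMeasure

variable {a : ℝ} {μ : Measure ℝ}

lemma measure_low (ha : a ∈ Icc (√2) 2) (hμ : IsFairMeasure a μ) {E : Set ℝ}
    (hE : MeasurableSet E) (hs : E ⊆ Icc (1 - a) (a - 1)) (hi : InjOn (tent a) E) :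
    μ E = 2⁻¹ * μ (tent a '' E) := by
  have d : Disjoint (E ∩ Iic 0) (E ∩ Ioi 0) :=
    disjoint_left.2 fun x hx hx' => (lt_irrefl x) (lt_of_le_of_lt hx.2 hx'.2)
  have e : E = (E ∩ Iic 0) ∪ (E ∩ Ioi 0) := by
    rw [← inter_union_distrib_left, Iic_union_Ioi, inter_univ]
  have m1 := hE.inter (measurableSet_Iic (a := (0 : ℝ)))
  have m2 := hE.inter (measurableSet_Ioi (a := (0 : ℝ)))
  have d' : Disjoint (tent a '' (E ∩ Iic 0)) (tent a '' (E ∩ Ioi 0)) := by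
    rw [disjoint_left]
    rintro _ ⟨x, hx, rfl⟩ ⟨y, hy, hxy⟩
    rw [hi hy.1 hx.1 hxy] at hy
    exact lt_irrefl _ (lt_of_le_of_lt (mem_Iic.1 hx.2) (mem_Ioi.1 hy.2))
  have m3 := m2.image_of_continuousOn_injOn (continuous_tent a).continuousOn
    (hi.mono inter_subset_left)
  conv_lhs => rw [e]
  conv_rhs => rw [e]
  rw [measure_union d m2, image_union, measure_union d' m3, mul_add,
    hμ.measure_nonpos ha m1 fun x hx => ⟨(hs hx.1).1, hx.2⟩,
    hμ.measure_center ha m2 fun x hx => ⟨hx.2.le, (hs hx.1).2⟩]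

/-- If `f^n` is injective on `E` and the orbits of the points of `E` visit `(a - 1, 1]` at most `m`
times before time `n`, then `μ E ≤ 2^{m-n} μ (f^n E)`. -/
theorem measure_mul_le (ha : a ∈ Icc (√2) 2) (hμ : IsFairMeasure a μ) (n : ℕ) :
    ∀ (m : ℕ) (E : Set ℝ), MeasurableSet E → E ⊆ Icc (1 - a) 1 → InjOn (tent a)^[n] E →
      (∀ x ∈ E, visits a x n ≤ m) → μ E * 2 ^ n ≤ 2 ^ m * μ ((tent a)^[n] '' E) := by
  induction n with
  | zero =>
    intro m E _ _ _ _
    simp only [pow_zero, mul_one, Function.iterate_zero, image_id]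
    exact le_mul_of_one_le_left (zero_le) (one_le_pow₀ one_le_two)
  | succ n ih =>
    intro m E hE hs hi hv
    rw [Function.iterate_succ] at hi
    have hi1 : InjOn (tent a) E := fun x hx y hy h => hi hx hy (by simp [h])
    have hi2 : ∀ E' ⊆ E, InjOn (tent a)^[n] (tent a '' E') := by
      rintro E' hE' _ ⟨x, hx, rfl⟩ _ ⟨y, hy, rfl⟩ h
      rw [hi (hE' hx) (hE' hy) h]
    have sub : ∀ E' ⊆ E, tent a '' E' ⊆ Icc (1 - a) 1 := by
      rintro E' hE' _ ⟨x, hx, rfl⟩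
      exact tent_mem ha (hs (hE' hx))
    have mE : ∀ E' ⊆ E, MeasurableSet E' → MeasurableSet (tent a '' E') := fun E' h h' =>
      h'.image_of_continuousOn_injOn (continuous_tent a).continuousOn (hi1.mono h)
    set E1 := E ∩ Iic (a - 1) with hE1
    set E2 := E ∩ Ioi (a - 1) with hE2
    have s1 : E1 ⊆ E := inter_subset_left
    have s2 : E2 ⊆ E := inter_subset_left
    have m1 : MeasurableSet E1 := hE.inter measurableSet_Iic
    have m2 : MeasurableSet E2 := hE.inter measurableSet_Ioi
    have d : Disjoint E1 E2 := disjoint_left.2 fun x hx hx' => (lt_irrefl x) (lt_of_le_of_lt hx.2 hx'.2)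
    have e : E = E1 ∪ E2 := by
      rw [hE1, hE2, ← inter_union_distrib_left, Iic_union_Ioi, inter_univ]
    have b1 : μ E1 * 2 ^ (n + 1) ≤ 2 ^ m * μ ((tent a)^[n] '' (tent a '' E1)) := by
      have h1 := hμ.measure_low ha m1 (fun x hx => ⟨(hs hx.1).1, hx.2⟩) (hi1.mono s1)
      have h2 := ih m _ (mE _ s1 m1) (sub _ s1) (hi2 _ s1) (by
        rintro _ ⟨x, hx, rfl⟩
        have := hv x (s1 hx)
        rw [visits_succ'] at this
        omega)
      rw [h1, pow_succ']
      calc 2⁻¹ * μ (tent a '' E1) * (2 * 2 ^ n)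
          = (2⁻¹ * 2) * (μ (tent a '' E1) * 2 ^ n) := by ring
        _ = μ (tent a '' E1) * 2 ^ n := by
            rw [ENNReal.inv_mul_cancel two_ne_zero ENNReal.ofNat_ne_top, one_mul]
        _ ≤ _ := h2
    have b2 : μ E2 * 2 ^ (n + 1) ≤ 2 ^ m * μ ((tent a)^[n] '' (tent a '' E2)) := by
      rcases E2.eq_empty_or_nonempty with h0 | ⟨z, hz⟩
      · simp [h0]
      · have hm : ∀ x ∈ E2, visits a (tent a x) n + 1 ≤ m := fun x hx => by
          have := hv x (s2 hx)
          rwa [visits_succ', if_pos (mem_Ioi.1 hx.2)] at this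
        have hm1 : 1 ≤ m := le_trans (Nat.le_add_left _ _) (hm z hz)
        have h1 := hμ.measure_right ha m2 (fun x hx => ⟨hx.2.le, (hs hx.1).2⟩)
        have h2 := ih (m - 1) _ (mE _ s2 m2) (sub _ s2) (hi2 _ s2) (by
          rintro _ ⟨x, hx, rfl⟩
          have := hm x hx
          omega)
        rw [h1, pow_succ]
        calc μ (tent a '' E2) * (2 ^ n * 2) = 2 * (μ (tent a '' E2) * 2 ^ n) := by ring
          _ ≤ 2 * (2 ^ (m - 1) * μ ((tent a)^[n] '' (tent a '' E2))) := by gcongr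
          _ = 2 ^ m * μ ((tent a)^[n] '' (tent a '' E2)) := by
            rw [← mul_assoc, ← pow_succ', Nat.sub_add_cancel hm1]
    have mm : MeasurableSet ((tent a)^[n] '' (tent a '' E2)) :=
      (mE _ s2 m2).image_of_continuousOn_injOn (continuous_iterate_tent a n).continuousOn (hi2 _ s2)
    have d' : Disjoint ((tent a)^[n] '' (tent a '' E1)) ((tent a)^[n] '' (tent a '' E2)) := by
      rw [disjoint_left]
      rintro _ ⟨_, ⟨x, hx, rfl⟩, rfl⟩ ⟨_, ⟨y, hy, rfl⟩, hxy⟩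
      have := hi (s2 hy) (s1 hx) hxy
      subst this
      exact lt_irrefl _ (lt_of_le_of_lt (mem_Iic.1 hx.2) (mem_Ioi.1 hy.2))
    have himg : (tent a)^[n + 1] '' E
        = ((tent a)^[n] '' (tent a '' E1)) ∪ ((tent a)^[n] '' (tent a '' E2)) := by
      rw [Function.iterate_succ, image_comp]
      conv_lhs => rw [e, image_union, image_union]
    rw [himg, measure_union d' mm, mul_add]
    conv_lhs => rw [e, measure_union d m2, add_mul]
    exact add_le_add b1 b2

lemma measure_image_null (ha : a ∈ Icc (√2) 2) (hμ : IsFairMeasure a μ) {E : Set ℝ}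
    (hE : MeasurableSet E) (hs : E ⊆ Icc (1 - a) 1) (h0 : μ E = 0) : μ (tent a '' E) = 0 := by
  have h := (param_bounds ha).1
  have := hμ.fair E hE hs
  rw [h0, eq_comm, add_eq_zero, add_eq_zero, mul_eq_zero, mul_eq_zero] at this
  have h2 : (2⁻¹ : ℝ≥0∞) ≠ 0 := by simp
  refine measure_mono_null (t := tent a '' (E ∩ Icc (1 - a) 0) ∪ tent a '' (E ∩ Icc 0 (a - 1))
    ∪ tent a '' (E ∩ Icc (a - 1) 1)) ?_ (measure_union_null (measure_union_null
      (this.1.1.resolve_left h2) (this.1.2.resolve_left h2)) this.2)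
  rw [← image_union, ← image_union]
  refine image_mono fun x hx => ?_
  rcases le_total x 0 with h1 | h1
  · exact Or.inl (Or.inl ⟨hx, (hs hx).1, h1⟩)
  rcases le_total x (a - 1) with h2 | h2
  · exact Or.inl (Or.inr ⟨hx, h1, h2⟩)
  · exact Or.inr ⟨hx, h2, (hs hx).2⟩

lemma null_Icc_nonpos (ha : a ∈ Icc (√2) 2) (hμ : IsFairMeasure a μ) {u v : ℝ} (hu : 1 - a ≤ u)
    (hv : v ≤ 0) (h0 : μ (Icc u v) = 0) : μ (Icc (1 + a * u) (1 + a * v)) = 0 := by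
  have h := (param_bounds ha).1
  refine measure_mono_null (fun y hy => ?_) (hμ.measure_image_null ha measurableSet_Icc
    (Icc_subset_Icc hu (hv.trans zero_le_one)) h0)
  have i1 : u ≤ (y - 1) / a := by rw [le_div_iff₀ (by linarith)]; linarith [hy.1]
  have i2 : (y - 1) / a ≤ v := by rw [div_le_iff₀ (by linarith)]; linarith [hy.2]
  refine ⟨(y - 1) / a, ⟨i1, i2⟩, ?_⟩
  have : a ≠ 0 := by linarith
  rw [tent_of_nonpos (i2.trans hv)]; field_simp; ring

lemma null_Icc_nonneg (ha : a ∈ Icc (√2) 2) (hμ : IsFairMeasure a μ) {u v : ℝ} (hu : 0 ≤ u)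
    (hv : v ≤ 1) (h0 : μ (Icc u v) = 0) : μ (Icc (1 - a * v) (1 - a * u)) = 0 := by
  have h := (param_bounds ha).1
  refine measure_mono_null (fun y hy => ?_) (hμ.measure_image_null ha measurableSet_Icc
    (Icc_subset_Icc (by linarith) hv) h0)
  have i1 : u ≤ (1 - y) / a := by rw [le_div_iff₀ (by linarith)]; linarith [hy.2]
  have i2 : (1 - y) / a ≤ v := by rw [div_le_iff₀ (by linarith)]; linarith [hy.1]
  refine ⟨(1 - y) / a, ⟨i1, i2⟩, ?_⟩
  have : a ≠ 0 := by linarith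
  rw [tent_of_nonneg (hu.trans i1)]; field_simp; ring

/-- A null interval is stretched until it contains the turning point, and then the image of its
longer half is a null interval with right end point `1`. -/
lemma exists_null_top (ha : a ∈ Icc (√2) 2) (hμ : IsFairMeasure a μ) {u v : ℝ} (huv : u < v)
    (hu : 1 - a ≤ u) (hv : v ≤ 1) (h0 : μ (Icc u v) = 0) :
    ∃ t, a * (v - u) / 2 ≤ t ∧ μ (Icc (1 - t) 1) = 0 := by
  obtain ⟨h1, h2, h3⟩ := param_bounds ha
  by_contra hne
  push Not at hne
  have grow : ∀ n : ℕ, ∃ u' v', 1 - a ≤ u' ∧ v' ≤ 1 ∧ a ^ n * (v - u) ≤ v' - u' ∧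
      μ (Icc u' v') = 0 := by
    intro n
    induction n with
    | zero => exact ⟨u, v, hu, hv, by simp, h0⟩
    | succ n ih =>
      obtain ⟨u', v', hu', hv', hl, hz⟩ := ih
      have hpos : 0 < v - u := by linarith
      have hge : v - u ≤ v' - u' :=
        (le_mul_of_one_le_left hpos.le (one_le_pow₀ (by linarith))).trans hl
      have hl' : a ^ (n + 1) * (v - u) ≤ a * (v' - u') := by
        rw [pow_succ', mul_assoc]; exact mul_le_mul_of_nonneg_left hl (by linarith)
      rcases le_or_gt v' 0 with hs | hs
      · exact ⟨_, _, by nlinarith, by nlinarith, by linarith, hμ.null_Icc_nonpos ha hu' hs hz⟩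
      rcases le_or_gt 0 u' with hs' | hs'
      · exact ⟨_, _, by nlinarith, by nlinarith, by linarith, hμ.null_Icc_nonneg ha hs' hv' hz⟩
      rcases le_total (-u') v' with hm | hm
      · refine absurd ?_ (hne (a * v') (by nlinarith))
        simpa using hμ.null_Icc_nonneg ha le_rfl hv' (measure_mono_null (Icc_subset_Icc_left hs'.le) hz)
      · refine absurd ?_ (hne (a * -u') (by nlinarith))
        have := hμ.null_Icc_nonpos ha hu' le_rfl
          (measure_mono_null (Icc_subset_Icc_right hs.le) hz)
        simpa using this
  obtain ⟨n, hn⟩ := pow_unbounded_of_one_lt (a / (v - u)) (show 1 < a by linarith)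
  obtain ⟨u', v', hu', hv', hl, -⟩ := grow n
  rw [div_lt_iff₀ (by linarith)] at hn
  linarith

/-- A fair measure charges every nondegenerate interval. -/
theorem measure_Icc_pos (ha : a ∈ Icc (√2) 2) (hμ : IsFairMeasure a μ) {u v : ℝ} (huv : u < v)
    (hu : 1 - a ≤ u) (hv : v ≤ 1) : 0 < μ (Icc u v) := by
  obtain ⟨h1, h2, h3⟩ := param_bounds ha
  have := hμ.isProbabilityMeasure
  rw [pos_iff_ne_zero]
  intro h0
  have full : μ (Icc (1 - a) 1) ≠ 0 := by
    rw [(prob_compl_eq_zero_iff measurableSet_Icc).1 hμ.concentrated]; exact one_ne_zero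
  have half : μ (Icc 0 1) ≠ 0 := fun h => full (by
    simpa using hμ.null_Icc_nonneg ha le_rfl le_rfl h)
  have step : ∀ t, 0 < t → μ (Icc (1 - t) 1) = 0 →
      ∃ t', 13 / 10 * t ≤ t' ∧ μ (Icc (1 - t') 1) = 0 := by
    intro t ht hz
    have ht1 : t < 1 := by
      by_contra h
      exact half (measure_mono_null (Icc_subset_Icc_left (by linarith)) hz)
    have hz2 := hμ.null_Icc_nonneg ha (by linarith) le_rfl hz
    rw [mul_one] at hz2
    rcases lt_or_ge (a * t) (a - 1) with hat | hat
    · have hz3 := hμ.null_Icc_nonpos ha le_rfl (by nlinarith) hz2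
      have e : 1 + a * (1 - a * (1 - t)) - (1 + a * (1 - a)) = a * a * t := by ring
      obtain ⟨t', ht', hz'⟩ := hμ.exists_null_top ha (by nlinarith) (by nlinarith) (by nlinarith) hz3
      refine ⟨t', ?_, hz'⟩
      rw [e] at ht'
      have i1 : 2 * t ≤ a * a * t := mul_le_mul_of_nonneg_right h3 ht.le
      have i2 : 7 / 5 * (2 * t) ≤ a * (a * a * t) :=
        mul_le_mul h1.le i1 (by linarith) (by linarith)
      linarith
    · exfalso
      have hz3 := hμ.null_Icc_nonpos ha le_rfl le_rfl
        (measure_mono_null (Icc_subset_Icc_right (by nlinarith)) hz2)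
      rw [mul_zero, add_zero] at hz3
      rcases le_total (1 + a * (1 - a)) 0 with hc | hc
      · exact half (measure_mono_null (Icc_subset_Icc_left hc) hz3)
      · have hz4 := hμ.null_Icc_nonneg ha hc le_rfl hz3
        rw [mul_one] at hz4
        refine full (measure_mono_null (fun x hx => ?_) (measure_union_null hz3 hz4))
        rcases le_total (1 + a * (1 - a)) x with hx' | hx'
        · exact Or.inl ⟨hx', hx.2⟩
        · refine Or.inr ⟨hx.1, hx'.trans ?_⟩
          nlinarith
  obtain ⟨t, ht, hz⟩ := hμ.exists_null_top ha huv hu hv h0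
  have ht0 : 0 < t := lt_of_lt_of_le (by nlinarith) ht
  have iter : ∀ n : ℕ, ∃ t', (13 / 10) ^ n * t ≤ t' ∧ μ (Icc (1 - t') 1) = 0 := by
    intro n
    induction n with
    | zero => exact ⟨t, by simp, hz⟩
    | succ n ih =>
      obtain ⟨s, hs, hs0⟩ := ih
      obtain ⟨t', ht', hz'⟩ := step s (lt_of_lt_of_le (by positivity) hs) hs0
      exact ⟨t', by rw [pow_succ']; linarith, hz'⟩
  obtain ⟨n, hn⟩ := pow_unbounded_of_one_lt (2 / t) (show (1 : ℝ) < 13 / 10 by norm_num)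
  obtain ⟨s, hs, hs0⟩ := iter n
  rw [div_lt_iff₀ ht0] at hn
  exact full (measure_mono_null (Icc_subset_Icc_left (by linarith)) hs0)

end IsFairMeasure

lemma fairCdf_strictMonoOn {a : ℝ} (ha : a ∈ Icc (√2) 2) :
    StrictMonoOn (fairCdf a) (Icc (1 - a) 1) := by
  intro x hx y hy hxy
  have hμ := isFairMeasure_fairMeasure ha
  have := hμ.isProbabilityMeasure
  have h := hμ.measure_Icc_pos ha hxy hx.1 hy.2
  have h2 : 0 < (fairMeasure a).real (Icc x y) := ENNReal.toReal_pos h.ne' (measure_ne_top _ _)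
  rw [hμ.measureReal_Icc hxy.le] at h2
  exact sub_pos.1 h2

/-! ### Entropy of finite partitions -/

lemma integral_comp_fintype {X : Type*} [MeasurableSpace X] {μ : Measure X} [IsProbabilityMeasure μ]
    {ζ : Type*} [Fintype ζ] [MeasurableSpace ζ]
    [MeasurableSingletonClass ζ] {Z : X → ζ} (hZ : Measurable Z) (f : ζ → ℝ) :
    ∫ x, f (Z x) ∂μ = ∑ z, μ.real (Z ⁻¹' {z}) * f z := by
  have := Measure.isProbabilityMeasure_map (μ := μ) hZ.aemeasurable
  rw [← integral_map hZ.aemeasurable (f := f) Measurable.of_discrete.aestronglyMeasurable,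
    integral_fintype .of_finite]
  simp_rw [smul_eq_mul, map_measureReal_apply hZ (measurableSet_singleton _)]

lemma integrable_comp_fintype {X : Type*} [MeasurableSpace X] {μ : Measure X} [IsProbabilityMeasure μ]
    {ζ : Type*} [Fintype ζ] [MeasurableSpace ζ]
    [MeasurableSingletonClass ζ] {Z : X → ζ} (hZ : Measurable Z) (f : ζ → ℝ) :
    Integrable (fun x => f (Z x)) μ := by
  have := Measure.isProbabilityMeasure_map (μ := μ) hZ.aemeasurable
  exact (Integrable.of_finite (μ := μ.map Z) (f := f)).comp_measurable hZ

/-- The Gibbs inequality: the entropy of a factor of the finite partition `Z` is at most the mean of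
`-log q` for every subprobability vector `q` on the atoms of `Z`. -/
theorem partitionEntropy_comp_le {X : Type*} [MeasurableSpace X] {μ : Measure X} [IsProbabilityMeasure μ]
    {ζ ι : Type*} [Fintype ζ] [MeasurableSpace ζ]
    [MeasurableSingletonClass ζ] [Fintype ι] {Z : X → ζ} (hZ : Measurable Z) (g : ζ → ι)
    {q : ζ → ℝ} (hq : ∀ z, 0 ≤ q z) (hq1 : ∑ z, q z ≤ 1)
    (hpq : ∀ z, μ.real (Z ⁻¹' {z}) ≠ 0 → 0 < q z) :
    partitionEntropy μ (fun x => g (Z x)) ≤ ∑ z, μ.real (Z ⁻¹' {z}) * -Real.log (q z) := by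
  classical
  set p : ζ → ℝ := fun z => μ.real (Z ⁻¹' {z}) with hp
  have p0 : ∀ z, 0 ≤ p z := fun z => measureReal_nonneg
  have psum : ∑ z, p z = 1 := by
    have := integral_comp_fintype (μ := μ) hZ (fun _ => (1 : ℝ))
    simpa using this.symm
  have fib : ∀ i, μ.real ((fun x => g (Z x)) ⁻¹' {i}) = ∑ z with g z = i, p z := by
    intro i
    rw [hp, sum_measureReal_preimage_singleton _ fun z _ => hZ (measurableSet_singleton z)]
    congr 1
    ext x
    simp
  calc partitionEntropy μ (fun x => g (Z x))
      = ∑ i, ∑ z with g z = i, p z * -Real.log (∑ z with g z = i, p z) := by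
        refine Finset.sum_congr rfl fun i _ => ?_
        rw [fib, ← Finset.sum_mul, Real.negMulLog]
        ring
    _ ≤ ∑ i, ∑ z with g z = i, p z * -Real.log (p z) := by
        refine Finset.sum_le_sum fun i _ => Finset.sum_le_sum fun z hz => ?_
        rcases (p0 z).eq_or_lt with h | h
        · rw [← h, zero_mul, zero_mul]
        · refine mul_le_mul_of_nonneg_left (neg_le_neg (Real.log_le_log h ?_)) h.le
          exact Finset.single_le_sum (f := p) (fun y _ => p0 y) hz
    _ = ∑ z, p z * -Real.log (p z) := Finset.sum_fiberwise _ _ _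
    _ ≤ ∑ z, (p z * -Real.log (q z) + (q z - p z)) := by
        refine Finset.sum_le_sum fun z _ => ?_
        rcases (p0 z).eq_or_lt with h | h
        · rw [← h]; simpa using hq z
        · have hqz := hpq z h.ne'
          have := Real.log_le_sub_one_of_pos (div_pos hqz h)
          rw [Real.log_div hqz.ne' h.ne'] at this
          have h2 := mul_le_mul_of_nonneg_left this h.le
          have h3 : p z * (q z / p z - 1) = q z - p z := by field_simp
          rw [h3] at h2
          linarith
    _ = ∑ z, p z * -Real.log (q z) + (∑ z, q z - 1) := by
        rw [Finset.sum_add_distrib, Finset.sum_sub_distrib, psum]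
    _ ≤ _ := by linarith

/-- The entropy of a partition is at least the mean of `-log q` if no atom has more mass than `q`. -/
lemma le_partitionEntropy {X : Type*} [MeasurableSpace X] {μ : Measure X}
    {ι : Type*} [Fintype ι] {Z : X → ι} {q : ι → ℝ}
    (hq : ∀ z, μ.real (Z ⁻¹' {z}) ≤ q z) :
    ∑ z, μ.real (Z ⁻¹' {z}) * -Real.log (q z) ≤ partitionEntropy μ Z := by
  refine Finset.sum_le_sum fun z _ => ?_
  rw [Real.negMulLog]
  rcases (measureReal_nonneg (μ := μ) (s := Z ⁻¹' {z})).eq_or_lt with h | h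
  · rw [← h]; simp
  · have := mul_le_mul_of_nonneg_left (Real.log_le_log h (hq z)) h.le
    linarith

lemma measurable_itinerary {X ι : Type*} [MeasurableSpace X] [MeasurableSpace ι] {T : X → X} (hT : Measurable T)
    {P : X → ι} (hP : Measurable P) (n : ℕ) : Measurable (itinerary T P n) :=
  measurable_pi_iff.2 fun i => hP.comp (hT.iterate i)

lemma itinerary_eq_iff {X ι : Type*} {T : X → X} {P : X → ι} {n : ℕ} {x y : X} :
    itinerary T P n x = itinerary T P n y ↔ ∀ i < n, P (T^[i] x) = P (T^[i] y) := by
  rw [funext_iff]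
  exact ⟨fun h i hi => h ⟨i, hi⟩, fun h i => h i i.2⟩

/-! ### Cylinders of the tent map -/

/-- The partition of the interval into `[1 - a, 0)`, `[0, a - 1]` and `(a - 1, 1]`. -/
noncomputable def piece (a x : ℝ) : Fin 3 := if x < 0 then 0 else if x ≤ a - 1 then 1 else 2

lemma measurable_piece (a : ℝ) : Measurable (piece a) :=
  Measurable.ite measurableSet_Iio measurable_const
    (Measurable.ite measurableSet_Iic measurable_const measurable_const)

lemma piece_eq_two {a x : ℝ} (ha : a ∈ Icc (√2) 2) : piece a x = 2 ↔ a - 1 < x := by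
  have := (param_bounds ha).1
  unfold piece
  split_ifs with h1 h2
  · simp; linarith
  · simpa using h2
  · simpa using h2

lemma piece_eq_zero {a x : ℝ} : piece a x = 0 ↔ x < 0 := by
  unfold piece
  split_ifs with h1 h2
  · simpa using h1
  · simpa using h1
  · simpa using h1

lemma piece_mono {a x y : ℝ} (ha : a ∈ Icc (√2) 2) (h : x ≤ y) : piece a x ≤ piece a y := by
  have := (param_bounds ha).1
  unfold piece
  split_ifs <;> first | decide | (exfalso; linarith)

lemma abs_tent_sub_of_piece {a x y : ℝ} (ha : a ∈ Icc (√2) 2) (h : piece a x = piece a y) :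
    |tent a x - tent a y| = a * |x - y| := by
  have h0 : 0 ≤ a := by linarith [(param_bounds ha).1]
  by_cases hx : x < 0
  · have hy : y < 0 := piece_eq_zero.1 (h ▸ piece_eq_zero.2 hx)
    rw [tent_of_nonpos hx.le, tent_of_nonpos hy.le,
      show 1 + a * x - (1 + a * y) = a * (x - y) by ring, abs_mul, abs_of_nonneg h0]
  · have hy : ¬ y < 0 := fun hy => hx (piece_eq_zero.1 (h.trans (piece_eq_zero.2 hy)))
    rw [tent_of_nonneg (not_lt.1 hx), tent_of_nonneg (not_lt.1 hy),
      show 1 - a * x - (1 - a * y) = -(a * (x - y)) by ring, abs_neg, abs_mul, abs_of_nonneg h0]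

lemma abs_iterate_sub_of_itinerary {a x y : ℝ} (ha : a ∈ Icc (√2) 2) {n : ℕ}
    (h : itinerary (tent a) (piece a) n x = itinerary (tent a) (piece a) n y) :
    |(tent a)^[n] x - (tent a)^[n] y| = a ^ n * |x - y| := by
  induction n with
  | zero => simp
  | succ n ih =>
    rw [itinerary_eq_iff] at h
    rw [Function.iterate_succ_apply', Function.iterate_succ_apply',
      abs_tent_sub_of_piece ha (h n (by omega)),
      ih (itinerary_eq_iff.2 fun i hi => h i (by omega)), pow_succ']
    ring

/-- Cylinders are intervals. -/
lemma piece_iterate_between {a : ℝ} (ha : a ∈ Icc (√2) 2) (n : ℕ) :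
    ∀ x y z : ℝ, x ≤ z → z ≤ y →
      (∀ i < n, piece a ((tent a)^[i] x) = piece a ((tent a)^[i] y)) →
      ∀ i < n, piece a ((tent a)^[i] x) = piece a ((tent a)^[i] z) := by
  have h0 : 0 ≤ a := by linarith [(param_bounds ha).1]
  induction n with
  | zero => intro x y z _ _ _ i hi; omega
  | succ n ih =>
    intro x y z hxz hzy h i hi
    have hp : piece a x = piece a y := h 0 (by omega)
    have hz : piece a x = piece a z :=
      le_antisymm (piece_mono ha hxz) ((piece_mono ha hzy).trans hp.ge)
    rcases i with _ | i
    · exact hz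
    have h' : ∀ j < n, piece a ((tent a)^[j] (tent a x)) = piece a ((tent a)^[j] (tent a y)) :=
      fun j hj => h (j + 1) (by omega)
    rw [Function.iterate_succ_apply, Function.iterate_succ_apply]
    by_cases hy : y < 0
    · refine ih (tent a x) (tent a y) (tent a z) ?_ ?_ h' i (by omega)
      · rw [tent_of_nonpos (by linarith), tent_of_nonpos (by linarith)]; nlinarith
      · rw [tent_of_nonpos (by linarith), tent_of_nonpos (by linarith)]; nlinarith
    · have hx : ¬ x < 0 := fun hx => hy (piece_eq_zero.1 (hp ▸ piece_eq_zero.2 hx))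
      rw [not_lt] at hx
      have := ih (tent a y) (tent a x) (tent a z) (by
        rw [tent_of_nonneg (by linarith), tent_of_nonneg (by linarith)]; nlinarith) (by
        rw [tent_of_nonneg (by linarith), tent_of_nonneg (by linarith)]; nlinarith)
        (fun j hj => (h' j hj).symm) i (by omega)
      rw [h' i (by omega), this]

/-- The logarithm of the factor by which the mass is divided on a piece. -/
noncomputable def pieceCost (s : Fin 3) : ℝ := if s = 2 then 0 else Real.log 2

lemma sum_pieceCost_itinerary {a : ℝ} (ha : a ∈ Icc (√2) 2) (n : ℕ) (x : ℝ) :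
    ∑ i, pieceCost (itinerary (tent a) (piece a) n x i) = (n - visits a x n) * Real.log 2 := by
  have : ∑ i : Fin n, pieceCost (itinerary (tent a) (piece a) n x i)
      = ∑ i ∈ Finset.range n, pieceCost (piece a ((tent a)^[i] x)) :=
    Fin.sum_univ_eq_sum_range (fun i => pieceCost (piece a ((tent a)^[i] x))) n
  rw [this]
  clear this
  induction n with
  | zero => simp [visits_zero]
  | succ n ih =>
    rw [Finset.sum_range_succ, ih, visits_succ, pieceCost]
    by_cases h : a - 1 < (tent a)^[n] x
    · rw [if_pos ((piece_eq_two ha).2 h), if_pos h]; push_cast; ring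
    · rw [if_neg (mt (piece_eq_two ha).1 h), if_neg h]; push_cast; ring

/-- The words that are itineraries of points of the interval. -/
def words (a : ℝ) (n : ℕ) : Set (Fin n → Fin 3) :=
  itinerary (tent a) (piece a) n '' Icc (1 - a) 1

open Classical in
/-- The total weight of the cylinders grows at most linearly: prepending a symbol to a cylinder
`C` gives total weight at most one, unless `C` is the cylinder of `c_3`. -/
lemma sum_words_le {a : ℝ} (ha : a ∈ Icc (√2) 2) (n : ℕ) :
    ∑ w : Fin n → Fin 3, (if w ∈ words a n then ∏ i, Real.exp (-pieceCost (w i)) else 0)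
      ≤ n + 1 := by
  have hb := param_bounds ha
  have c3 := critOrbit_three ha
  have e2 : Real.exp (-Real.log 2) = 1 / 2 := by
    rw [Real.exp_neg, Real.exp_log two_pos]; norm_num
  have wt0 : ∀ (n : ℕ) (w : Fin n → Fin 3), 0 ≤ ∏ i, Real.exp (-pieceCost (w i)) := fun n w =>
    Finset.prod_nonneg fun i _ => (Real.exp_pos _).le
  have wt1 : ∀ (n : ℕ) (w : Fin n → Fin 3), ∏ i, Real.exp (-pieceCost (w i)) ≤ 1 := fun n w =>
    Finset.prod_le_one (fun i _ => (Real.exp_pos _).le) fun i _ => by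
      rw [Real.exp_le_one_iff, neg_nonpos, pieceCost]
      split_ifs
      · exact le_rfl
      · exact Real.log_nonneg one_le_two
  induction n with
  | zero =>
    rw [Finset.univ_unique, Finset.sum_singleton, Finset.univ_eq_empty, Finset.prod_empty,
      Nat.cast_zero, zero_add]
    split_ifs <;> norm_num
  | succ n ih =>
    set w3 := itinerary (tent a) (piece a) n (critOrbit a 3) with hw3
    rw [← (Fin.consEquiv fun _ => Fin 3).sum_comp, Fintype.sum_prod_type_right]
    have main : ∀ w : Fin n → Fin 3, ∑ s : Fin 3,
        (if (Fin.consEquiv fun _ => Fin 3) (s, w) ∈ words a (n + 1) then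
          ∏ i, Real.exp (-pieceCost ((Fin.consEquiv fun _ => Fin 3) (s, w) i)) else 0)
        ≤ (if w ∈ words a n then ∏ i, Real.exp (-pieceCost (w i)) else 0)
          + if w = w3 then 1 else 0 := by
      intro w
      set c := ∏ i, Real.exp (-pieceCost (w i)) with hc
      have hc0 : 0 ≤ c := wt0 n w
      have hc1 : c ≤ 1 := wt1 n w
      have hprod : ∀ s, ∏ i, Real.exp (-pieceCost ((Fin.consEquiv fun _ => Fin 3) (s, w) i))
          = Real.exp (-pieceCost s) * c := by
        intro s
        rw [Fin.prod_univ_succ]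
        simp [Fin.consEquiv, hc]
      have hcons : ∀ s, (Fin.consEquiv fun _ => Fin 3) (s, w) ∈ words a (n + 1) →
          ∃ x ∈ Icc (1 - a) 1, piece a x = s ∧
            itinerary (tent a) (piece a) n (tent a x) = w := by
        rintro s ⟨x, hx, hxs⟩
        refine ⟨x, hx, ?_, ?_⟩
        · have := congrFun hxs 0
          simpa [Fin.consEquiv, itinerary] using this
        · funext i
          have := congrFun hxs i.succ
          simpa [Fin.consEquiv, itinerary] using this
      simp only [hprod]
      by_cases hw : w ∈ words a n
      · rw [if_pos hw]
        -- one of the symbols `0, 1` and the symbol `2` are possible only if `w` is the word of `c_3`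
        have excl : ∀ s, s ≠ 2 → (Fin.consEquiv fun _ => Fin 3) (s, w) ∈ words a (n + 1) →
            (Fin.consEquiv fun _ => Fin 3) ((2 : Fin 3), w) ∈ words a (n + 1) → w = w3 := by
          intro s hs h1 h2
          obtain ⟨x, hx, hxs, hxw⟩ := hcons s h1
          obtain ⟨y, hy, hys, hyw⟩ := hcons 2 h2
          have hy' := (piece_eq_two ha).1 hys
          have hx' : x ≤ a - 1 := by
            by_contra h
            exact hs (hxs ▸ (piece_eq_two ha).2 (not_le.1 h))
          have i1 : tent a y ≤ critOrbit a 3 := tent_le_of_right ha hy'.le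
          have i2 : critOrbit a 3 ≤ tent a x := by
            have : |x| ≤ a - 1 := abs_le.2 ⟨by linarith [hx.1], hx'⟩
            rw [c3, tent]
            nlinarith
          rw [hw3, ← hyw]
          exact itinerary_eq_iff.2 (piece_iterate_between ha n _ _ _ i1 i2
            (itinerary_eq_iff.1 (hyw.trans hxw.symm)))
        have p0 : pieceCost 0 = Real.log 2 := by simp [pieceCost]
        have p1 : pieceCost 1 = Real.log 2 := by simp [pieceCost]
        have p2 : pieceCost 2 = 0 := by simp [pieceCost]
        rw [Fin.sum_univ_three, p0, p1, p2, e2, neg_zero, Real.exp_zero]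
        have x0 := excl 0 (by decide)
        have x1 := excl 1 (by decide)
        by_cases h3 : w = w3
        · rw [if_pos h3]
          split_ifs <;> linarith
        · rw [if_neg h3]
          split_ifs with j0 j1 j2 j2 j1 j2 <;>
            first | linarith | exact absurd (x0 ‹_› ‹_›) h3 | exact absurd (x1 ‹_› ‹_›) h3
      · have : ∀ s, (Fin.consEquiv fun _ => Fin 3) (s, w) ∉ words a (n + 1) := by
          intro s hs
          obtain ⟨x, hx, -, hxw⟩ := hcons s hs
          exact hw ⟨_, tent_mem ha hx, hxw⟩
        simp only [this, if_false, Finset.sum_const_zero]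
        split_ifs <;> norm_num
    refine (Finset.sum_le_sum fun w _ => main w).trans ?_
    rw [Finset.sum_add_distrib, Finset.sum_ite_eq', if_pos (Finset.mem_univ _)]
    push_cast
    linarith

/-! ### The entropy of a fair measure -/

namespace IsFairMeasure

variable {a : ℝ} {μ : Measure ℝ}

lemma integral_comp_iterate (ha : a ∈ Icc (√2) 2) (hμ : IsFairMeasure a μ) {g : ℝ → ℝ}
    (hg : Measurable g) (n : ℕ) : ∫ x, g ((tent a)^[n] x) ∂μ = ∫ x, g x ∂μ := by
  have h := (hμ.measurePreserving ha).iterate n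
  conv_rhs => rw [← h.map_eq]
  rw [integral_map h.measurable.aemeasurable hg.aestronglyMeasurable]

lemma integral_pieceCost (ha : a ∈ Icc (√2) 2) (hμ : IsFairMeasure a μ) :
    ∫ x, pieceCost (piece a x) ∂μ = 2 * Real.log 2 * μ.real (Iic 0) := by
  have h : (fun x => pieceCost (piece a x)) = (Iic (a - 1)).indicator fun _ => Real.log 2 := by
    funext x
    rw [pieceCost]
    by_cases hx : a - 1 < x
    · rw [if_pos ((piece_eq_two ha).2 hx), indicator_of_notMem (by simpa using hx)]
    · rw [if_neg (mt (piece_eq_two ha).1 hx), indicator_of_mem (by simpa using hx)]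
  rw [h, integral_indicator_const _ measurableSet_Iic, (hμ.isFairCdf ha).map_sub_one ha, smul_eq_mul]
  ring

lemma integral_sum_pieceCost (ha : a ∈ Icc (√2) 2) (hμ : IsFairMeasure a μ) (n : ℕ) :
    ∫ x, ∑ i, pieceCost (itinerary (tent a) (piece a) n x i) ∂μ
      = n * (2 * Real.log 2 * μ.real (Iic 0)) := by
  have := hμ.isProbabilityMeasure
  have mf := (continuous_tent a).measurable
  rw [integral_finsetSum]
  · have : ∀ i : Fin n, ∫ x, pieceCost (itinerary (tent a) (piece a) n x i) ∂μ
        = 2 * Real.log 2 * μ.real (Iic 0) := fun i => by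
      rw [← hμ.integral_pieceCost ha]
      exact hμ.integral_comp_iterate ha (g := fun x => pieceCost (piece a x))
        ((Measurable.of_discrete (f := pieceCost)).comp (measurable_piece a)) i
    simp [this]
  · intro i _
    exact integrable_comp_fintype (measurable_itinerary mf (measurable_piece a) n)
      fun w => pieceCost (w i)

/-- The mass of a cylinder. -/
lemma measureReal_cylinder_le (ha : a ∈ Icc (√2) 2) (hμ : IsFairMeasure a μ) {n : ℕ}
    (w : Fin n → Fin 3) :
    μ.real (itinerary (tent a) (piece a) n ⁻¹' {w}) ≤ Real.exp (-∑ i, pieceCost (w i)) := by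
  have := hμ.isProbabilityMeasure
  have hb := param_bounds ha
  have mf := (continuous_tent a).measurable
  set E := itinerary (tent a) (piece a) n ⁻¹' {w} ∩ Icc (1 - a) 1 with hE
  have hm : μ.real (itinerary (tent a) (piece a) n ⁻¹' {w}) = μ.real E := by
    rw [measureReal_def, measureReal_def, hE, measure_inter_conull hμ.concentrated]
  rw [hm]
  rcases E.eq_empty_or_nonempty with h0 | ⟨z, hz⟩
  · rw [h0, measureReal_empty]; exact (Real.exp_pos _).le
  have same : ∀ x ∈ E, ∀ y ∈ E,
      itinerary (tent a) (piece a) n x = itinerary (tent a) (piece a) n y := fun x hx y hy =>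
    hx.1.trans hy.1.symm
  have hvis : ∀ x ∈ E, visits a x n = visits a z n := by
    intro x hx
    have h1 := sum_pieceCost_itinerary ha n x
    rw [same x hx z hz, sum_pieceCost_itinerary ha] at h1
    have := mul_right_cancel₀ (Real.log_pos one_lt_two).ne' h1
    exact_mod_cast (sub_right_injective this).symm
  have hinj : InjOn (tent a)^[n] E := by
    intro x hx y hy hxy
    have h := abs_iterate_sub_of_itinerary ha (same x hx y hy)
    rw [hxy, sub_self, abs_zero, eq_comm, mul_eq_zero] at h
    have hp : a ^ n ≠ 0 := pow_ne_zero _ (by linarith)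
    exact sub_eq_zero.1 (abs_eq_zero.1 (h.resolve_left hp))
  have key := hμ.measure_mul_le ha n (visits a z n) E
    ((measurable_itinerary mf (measurable_piece a) n (measurableSet_singleton w)).inter
      measurableSet_Icc) inter_subset_right hinj (fun x hx => (hvis x hx).le)
  have key2 : μ E * 2 ^ n ≤ 2 ^ visits a z n :=
    key.trans (mul_le_of_le_one_right' prob_le_one)
  have key3 : μ.real E * 2 ^ n ≤ 2 ^ visits a z n := by
    have := ENNReal.toReal_mono (by finiteness) key2
    simpa [measureReal_def] using this
  have hw : w = itinerary (tent a) (piece a) n z := hz.1.symm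
  rw [hw, sum_pieceCost_itinerary ha, show -(((n : ℝ) - visits a z n) * Real.log 2)
    = visits a z n * Real.log 2 - n * Real.log 2 by ring, Real.exp_sub, Real.exp_nat_mul,
    Real.exp_nat_mul, Real.exp_log two_pos, le_div_iff₀ (by positivity)]
  exact key3

lemma le_entropyOfPartition_piece (ha : a ∈ Icc (√2) 2) (hμ : IsFairMeasure a μ) :
    ((2 * Real.log 2 * μ.real (Iic 0) : ℝ) : EReal) ≤
      entropyOfPartition (tent a) μ (piece a) := by
  have := hμ.isProbabilityMeasure
  have mf := (continuous_tent a).measurable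
  refine le_limsup_of_frequently_le (Eventually.frequently ?_)
  filter_upwards [eventually_ge_atTop 1] with n hn
  rw [EReal.coe_le_coe_iff, le_div_iff₀ (by positivity)]
  have h1 := le_partitionEntropy (fun w => hμ.measureReal_cylinder_le ha (n := n) w)
  simp only [Real.log_exp, neg_neg] at h1
  rw [← integral_comp_fintype (measurable_itinerary mf (measurable_piece a) n)
    (fun w => ∑ i, pieceCost (w i)), hμ.integral_sum_pieceCost ha] at h1
  linarith

/-- Every finite measurable partition is approximated by functions of long itineraries, because the
cylinders shrink. -/
lemma exists_approx (ha : a ∈ Icc (√2) 2) (hμ : IsFairMeasure a μ) {k : ℕ} {P : ℝ → Fin k}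
    (hP : Measurable P) {δ : ℝ} (hδ : 0 < δ) :
    ∃ (m : ℕ) (φ : (Fin m → Fin 3) → Fin k),
      μ.real {x | P x ≠ φ (itinerary (tent a) (piece a) m x)} ≤ δ := by
  classical
  have := hμ.isProbabilityMeasure
  have hb := param_bounds ha
  have hk : 0 < k := (P 0).pos
  have hδk : 0 < δ / k := by positivity
  have hK : ∀ i, ∃ K ⊆ P ⁻¹' {i}, IsCompact K ∧ μ (P ⁻¹' {i} \ K) < ENNReal.ofReal (δ / k) :=
    fun i => (hP (measurableSet_singleton i)).exists_isCompact_sdiff_lt (measure_ne_top _ _)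
      (ENNReal.ofReal_pos.2 hδk).ne'
  choose K hKs hKc hKm using hK
  have sep : ∀ i j, ∀ᶠ m : ℕ in atTop, i ≠ j → ∀ x ∈ K i ∩ Icc (1 - a) 1,
      ∀ y ∈ K j ∩ Icc (1 - a) 1,
      itinerary (tent a) (piece a) m x ≠ itinerary (tent a) (piece a) m y := by
    intro i j
    by_cases hij : i = j
    · exact Eventually.of_forall fun _ h => absurd hij h
    have hd : Disjoint (K i) (K j) := disjoint_left.2 fun x hx hx' =>
      hij ((hKs i hx).symm.trans (hKs j hx'))
    obtain ⟨r, hr, hrd⟩ := Metric.exists_pos_forall_lt_edist (hKc i) (hKc j).isClosed hd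
    obtain ⟨M, hM⟩ := pow_unbounded_of_one_lt (a / r) (show 1 < a by linarith)
    filter_upwards [eventually_ge_atTop M] with m hm _ x hx y hy hxy
    have h1 := abs_iterate_sub_of_itinerary ha hxy
    have h2 := iterate_mem ha hx.2 m
    have h3 := iterate_mem ha hy.2 m
    have h4 : |(tent a)^[m] x - (tent a)^[m] y| ≤ a :=
      abs_le.2 ⟨by linarith [h2.1, h3.2], by linarith [h2.2, h3.1]⟩
    have h5 := hrd x hx.1 y hy.1
    rw [edist_dist, Real.dist_eq, ← ENNReal.ofReal_coe_nnreal] at h5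
    replace h5 := (ENNReal.ofReal_lt_ofReal_iff_of_nonneg r.coe_nonneg).1 h5
    have h6 : a ^ M ≤ a ^ m := pow_le_pow_right₀ (by linarith) hm
    have hr' : (0 : ℝ) < r := hr
    rw [div_lt_iff₀ hr'] at hM
    have h7 : a ^ M * r ≤ a ^ m * |x - y| := mul_le_mul h6 h5.le r.2 (pow_nonneg (by linarith) m)
    linarith
  obtain ⟨m, hm⟩ := (eventually_all.2 fun i => eventually_all.2 fun j => sep i j).exists
  let φ : (Fin m → Fin 3) → Fin k := fun w =>
    if h : ∃ i, ∃ x ∈ K i ∩ Icc (1 - a) 1, itinerary (tent a) (piece a) m x = w then h.choose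
    else P 0
  refine ⟨m, φ, ?_⟩
  have hφ : ∀ i, ∀ x ∈ K i ∩ Icc (1 - a) 1, φ (itinerary (tent a) (piece a) m x) = i := by
    intro i x hx
    have h : ∃ j, ∃ y ∈ K j ∩ Icc (1 - a) 1,
      itinerary (tent a) (piece a) m y = itinerary (tent a) (piece a) m x := ⟨i, x, hx, rfl⟩
    simp only [φ]
    rw [dif_pos h]
    obtain ⟨y, hy, hyx⟩ := h.choose_spec
    by_contra hne
    exact hm _ _ hne y hy x hx hyx
  have hsub : {x | P x ≠ φ (itinerary (tent a) (piece a) m x)} ⊆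
      (⋃ i, P ⁻¹' {i} \ K i) ∪ (Icc (1 - a) 1)ᶜ := by
    intro x hx
    by_contra h
    rw [mem_union, not_or, mem_iUnion, not_exists, notMem_compl_iff] at h
    have hxK : x ∈ K (P x) := by
      by_contra h'
      exact h.1 (P x) ⟨rfl, h'⟩
    exact hx (hφ _ x ⟨hxK, h.2⟩).symm
  have hle : μ {x | P x ≠ φ (itinerary (tent a) (piece a) m x)} ≤ ENNReal.ofReal δ := by
    calc _ ≤ μ (⋃ i, P ⁻¹' {i} \ K i) + μ (Icc (1 - a) 1)ᶜ :=
          (measure_mono hsub).trans (measure_union_le _ _)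
      _ ≤ ∑ i : Fin k, μ (P ⁻¹' {i} \ K i) := by
          rw [hμ.concentrated, add_zero]; exact measure_iUnion_fintype_le _ _
      _ ≤ ∑ i : Fin k, ENNReal.ofReal (δ / k) := Finset.sum_le_sum fun i _ => (hKm i).le
      _ = ENNReal.ofReal δ := by
          rw [Finset.sum_const, Finset.card_univ, Fintype.card_fin, nsmul_eq_mul,
            ← ENNReal.ofReal_natCast, ← ENNReal.ofReal_mul (by positivity)]
          congr 1
          field_simp
  exact ENNReal.toReal_le_of_le_ofReal hδ.le hle

/-- The Gibbs inequality for the itineraries of an arbitrary partition `P`, with a weight on words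
that combines the masses of the cylinders of the tent map with the errors of an approximation of `P`
by itineraries of length `m`. -/
lemma partitionEntropy_itinerary_le (ha : a ∈ Icc (√2) 2) (hμ : IsFairMeasure a μ) {k m : ℕ}
    {P : ℝ → Fin k} (hP : Measurable P) (φ : (Fin m → Fin 3) → Fin k) (c : Fin k → Fin k → ℝ)
    (hc : ∀ j, ∑ i, Real.exp (-c i j) ≤ 1) (n : ℕ) :
    partitionEntropy μ (itinerary (tent a) P n) ≤ Real.log (n + m + 1)
      + (n + m) * (2 * Real.log 2 * μ.real (Iic 0))
      + n * ∫ x, c (P x) (φ (itinerary (tent a) (piece a) m x)) ∂μ := by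
  classical
  have := hμ.isProbabilityMeasure
  have mf := (continuous_tent a).measurable
  have mp := measurable_piece a
  have hN : (0 : ℝ) < ((n + m : ℕ) : ℝ) + 1 := by positivity
  let sub : (Fin (n + m) → Fin 3) → Fin n → Fin m → Fin 3 := fun w i j =>
    w ⟨i + j, by omega⟩
  let Z : ℝ → (Fin n → Fin k) × (Fin (n + m) → Fin 3) := fun x =>
    (itinerary (tent a) P n x, itinerary (tent a) (piece a) (n + m) x)
  have hZ : Measurable Z := (measurable_itinerary mf hP n).prodMk (measurable_itinerary mf mp _)
  let cost : (Fin n → Fin k) × (Fin (n + m) → Fin 3) → ℝ := fun z =>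
    Real.log (((n + m : ℕ) : ℝ) + 1) + ∑ i, pieceCost (z.2 i) + ∑ i, c (z.1 i) (φ (sub z.2 i))
  let q : (Fin n → Fin k) × (Fin (n + m) → Fin 3) → ℝ := fun z =>
    if z.2 ∈ words a (n + m) then Real.exp (-cost z) else 0
  have hq0 : ∀ z, 0 ≤ q z := by
    intro z
    simp only [q]
    split_ifs
    · exact (Real.exp_pos _).le
    · exact le_rfl
  have hcost : ∀ z, Real.exp (-cost z) = (((n + m : ℕ) : ℝ) + 1)⁻¹
      * (∏ i, Real.exp (-pieceCost (z.2 i))) * ∏ i, Real.exp (-c (z.1 i) (φ (sub z.2 i))) := by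
    intro z
    simp only [cost]
    rw [neg_add, neg_add, Real.exp_add, Real.exp_add, Real.exp_neg (Real.log _), Real.exp_log hN,
      ← Finset.sum_neg_distrib, ← Finset.sum_neg_distrib, Real.exp_sum, Real.exp_sum]
  have hq1 : ∑ z, q z ≤ 1 := by
    rw [Fintype.sum_prod_type_right]
    have inner : ∀ w : Fin (n + m) → Fin 3, ∑ v : Fin n → Fin k, q (v, w) ≤
        (((n + m : ℕ) : ℝ) + 1)⁻¹ *
          (if w ∈ words a (n + m) then ∏ i, Real.exp (-pieceCost (w i)) else 0) := by
      intro w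
      by_cases hw : w ∈ words a (n + m)
      · simp only [q, hw, if_true, hcost]
        rw [← Finset.mul_sum]
        refine mul_le_of_le_one_right ?_ ?_
        · exact mul_nonneg (inv_nonneg.2 hN.le) (Finset.prod_nonneg fun i _ => (Real.exp_pos _).le)
        · have := Finset.prod_univ_sum (fun _ : Fin n => (Finset.univ : Finset (Fin k)))
            (fun i j => Real.exp (-c j (φ (sub w i))))
          rw [Fintype.piFinset_univ] at this
          rw [← this]
          exact Finset.prod_le_one (fun i _ => Finset.sum_nonneg fun j _ => (Real.exp_pos _).le)
            fun i _ => hc _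
      · simp [q, hw]
    refine (Finset.sum_le_sum fun w _ => inner w).trans ?_
    rw [← Finset.mul_sum, inv_mul_le_one₀ hN]
    exact sum_words_le ha (n + m)
  have hnull : ∀ z, z.2 ∉ words a (n + m) → μ.real (Z ⁻¹' {z}) = 0 := by
    intro z hz
    rw [measureReal_def, ENNReal.toReal_eq_zero_iff]
    left
    refine measure_mono_null (t := (Icc (1 - a) 1)ᶜ) (fun x hx hxI => hz ?_) hμ.concentrated
    exact ⟨x, hxI, congrArg Prod.snd (show Z x = z from hx)⟩
  have gibbs := partitionEntropy_comp_le (μ := μ) hZ Prod.fst hq0 hq1 (fun z hz => by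
    by_cases hw : z.2 ∈ words a (n + m)
    · simp only [q, hw, if_true]; exact Real.exp_pos _
    · exact absurd (hnull z hw) hz)
  refine gibbs.trans (le_of_eq ?_)
  have e1 : ∑ z, μ.real (Z ⁻¹' {z}) * -Real.log (q z) = ∑ z, μ.real (Z ⁻¹' {z}) * cost z := by
    refine Finset.sum_congr rfl fun z _ => ?_
    by_cases hw : z.2 ∈ words a (n + m)
    · simp only [q, hw, if_true, Real.log_exp, neg_neg]
    · rw [hnull z hw, zero_mul, zero_mul]
  rw [e1, ← integral_comp_fintype hZ cost]
  have i1 : Integrable (fun x => ∑ i, pieceCost (itinerary (tent a) (piece a) (n + m) x i)) μ :=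
    integrable_comp_fintype (measurable_itinerary mf mp (n + m)) fun w => ∑ i, pieceCost (w i)
  have mW : Measurable fun x => (P x, itinerary (tent a) (piece a) m x) :=
    hP.prodMk (measurable_itinerary mf mp m)
  have e2 : ∀ x, cost (Z x) = Real.log (((n + m : ℕ) : ℝ) + 1)
      + ∑ i, pieceCost (itinerary (tent a) (piece a) (n + m) x i)
      + ∑ i : Fin n, c (P ((tent a)^[i] x))
          (φ (itinerary (tent a) (piece a) m ((tent a)^[i] x))) := by
    intro x
    have : ∀ i : Fin n, sub (itinerary (tent a) (piece a) (n + m) x) i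
        = itinerary (tent a) (piece a) m ((tent a)^[i] x) := by
      intro i
      funext j
      simp only [sub, itinerary]
      rw [← Function.iterate_add_apply, Nat.add_comm]
    simp only [cost, Z, this]
    rfl
  have mG : Measurable fun x => c (P x) (φ (itinerary (tent a) (piece a) m x)) :=
    (Measurable.of_discrete (f := fun z : Fin k × (Fin m → Fin 3) => c z.1 (φ z.2))).comp mW
  have i2 : ∀ i : Fin n, Integrable (fun x => c (P ((tent a)^[i] x))
      (φ (itinerary (tent a) (piece a) m ((tent a)^[i] x)))) μ := fun i =>
    integrable_comp_fintype (mW.comp (mf.iterate i))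
      (fun z : Fin k × (Fin m → Fin 3) => c z.1 (φ z.2))
  simp only [e2]
  have i0 : Integrable (fun x => Real.log (((n + m : ℕ) : ℝ) + 1)
      + ∑ i, pieceCost (itinerary (tent a) (piece a) (n + m) x i)) μ := (integrable_const _).add i1
  rw [integral_add i0 (integrable_finsetSum _ fun i _ => i2 i),
    integral_add (integrable_const _) i1, hμ.integral_sum_pieceCost ha,
    integral_finsetSum _ fun i _ => i2 i]
  have e3 : ∀ i : Fin n, ∫ x, c (P ((tent a)^[i] x))
      (φ (itinerary (tent a) (piece a) m ((tent a)^[i] x))) ∂μ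
      = ∫ x, c (P x) (φ (itinerary (tent a) (piece a) m x)) ∂μ := fun i =>
    hμ.integral_comp_iterate ha mG i
  simp only [e3]
  simp

lemma entropyOfPartition_le (ha : a ∈ Icc (√2) 2) (hμ : IsFairMeasure a μ) {k : ℕ}
    {P : ℝ → Fin k} (hP : Measurable P) :
    entropyOfPartition (tent a) μ P ≤ ((2 * Real.log 2 * μ.real (Iic 0) : ℝ) : EReal) := by
  have := hμ.isProbabilityMeasure
  have mf := (continuous_tent a).measurable
  set L := 2 * Real.log 2 * μ.real (Iic 0) with hL
  have hk : 0 < k := (P 0).pos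
  have hk' : (1 : ℝ) ≤ k := by exact_mod_cast hk
  have main : ∀ γ : ℝ, 0 < γ → entropyOfPartition (tent a) μ P ≤ ((L + 2 * γ : ℝ) : EReal) := by
    intro γ hγ
    -- the transition costs `c i j` have mean at most `γ` if the approximation is good
    set ε := 1 - Real.exp (-(γ / 2)) with hε
    have hε0 : 0 < ε := by
      have : Real.exp (-(γ / 2)) < 1 := by
        rw [← Real.exp_zero]; exact Real.exp_lt_exp.2 (by linarith)
      linarith
    have hε1 : ε < 1 := by have := Real.exp_pos (-(γ / 2)); linarith
    set B := -Real.log (ε / k) with hB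
    have hB0 : 0 ≤ B := by
      rw [hB, neg_nonneg]
      exact Real.log_nonpos (by positivity) ((div_le_self hε0.le hk').trans hε1.le)
    obtain ⟨m, φ, hφ⟩ := hμ.exists_approx ha hP (show 0 < γ / (2 * (B + 1)) by positivity)
    let c : Fin k → Fin k → ℝ := fun i j => if i = j then γ / 2 else B
    have hc : ∀ j, ∑ i, Real.exp (-c i j) ≤ 1 := by
      intro j
      have hle : ∀ i, Real.exp (-c i j) ≤ (if i = j then 1 - ε else 0) + ε / k := by
        intro i
        simp only [c]
        split_ifs
        · have : 0 < ε / k := by positivity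
          rw [hε]; linarith
        · rw [hB, neg_neg, Real.exp_log (by positivity)]; linarith
      refine (Finset.sum_le_sum fun i _ => hle i).trans (le_of_eq ?_)
      rw [Finset.sum_add_distrib, Finset.sum_ite_eq', if_pos (Finset.mem_univ _), Finset.sum_const,
        Finset.card_univ, Fintype.card_fin, nsmul_eq_mul]
      field_simp
      ring
    have mW : Measurable fun x => (P x, itinerary (tent a) (piece a) m x) :=
      hP.prodMk (measurable_itinerary mf (measurable_piece a) m)
    have hint : ∫ x, c (P x) (φ (itinerary (tent a) (piece a) m x)) ∂μ ≤ γ := by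
      set bad := {x | P x ≠ φ (itinerary (tent a) (piece a) m x)} with hbad
      have mbad : MeasurableSet bad :=
        mW (MeasurableSet.of_discrete (s := {z : Fin k × (Fin m → Fin 3) | z.1 ≠ φ z.2}))
      have ib : Integrable (bad.indicator fun _ => B) μ := (integrable_const B).indicator mbad
      calc ∫ x, c (P x) (φ (itinerary (tent a) (piece a) m x)) ∂μ
          ≤ ∫ x, (γ / 2 + bad.indicator (fun _ => B) x) ∂μ := by
            refine integral_mono (integrable_comp_fintype mW
              (fun z : Fin k × (Fin m → Fin 3) => c z.1 (φ z.2))) ((integrable_const _).add ib) ?_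
            intro x
            simp only [c]
            by_cases hx : P x = φ (itinerary (tent a) (piece a) m x)
            · rw [if_pos hx, indicator_of_notMem (by simpa [hbad] using hx)]; linarith
            · rw [if_neg hx, indicator_of_mem (by simpa [hbad] using hx)]; linarith
        _ = γ / 2 + μ.real bad * B := by
            rw [integral_add (integrable_const _) ib, integral_indicator_const _ mbad]
            simp
        _ ≤ γ / 2 + γ / (2 * (B + 1)) * (B + 1) := by
            gcongr
            linarith
        _ = γ := by field_simp; ring
    have hlim : Tendsto (fun n : ℕ => (Real.log (n + m + 1) + m * L) / n) atTop (𝓝 0) := by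
      have h1 := (Real.tendsto_pow_log_div_mul_add_atTop 1 (-((m : ℝ) + 1)) 1 one_ne_zero).comp
        (tendsto_natCast_atTop_atTop.atTop_add (tendsto_const_nhds (x := (m : ℝ) + 1)))
      have h2 := tendsto_const_div_atTop_nhds_zero_nat ((m : ℝ) * L)
      have h3 := h1.add h2
      rw [add_zero] at h3
      refine h3.congr fun n => ?_
      simp only [Function.comp_apply, pow_one]
      rw [add_div, add_assoc (n : ℝ)]
      congr 2
      ring
    refine limsup_le_of_le (h := ?_)
    filter_upwards [eventually_ge_atTop 1, hlim.eventually (eventually_le_nhds hγ)] with n hn hn2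
    have hn0 : (0 : ℝ) < n := by exact_mod_cast hn
    rw [EReal.coe_le_coe_iff, div_le_iff₀ hn0]
    rw [div_le_iff₀ hn0] at hn2
    have h1 := hμ.partitionEntropy_itinerary_le ha hP φ c hc n
    have h2 := mul_le_mul_of_nonneg_left hint hn0.le
    rw [← hL] at h1
    linarith
  refine le_of_forall_gt_imp_ge_of_dense fun y hy => ?_
  obtain ⟨z, hz1, hz2⟩ := EReal.lt_iff_exists_real_btwn.1 hy
  rw [EReal.coe_lt_coe_iff] at hz1
  have := main ((z - L) / 2) (by linarith)
  rw [show L + 2 * ((z - L) / 2) = z by ring] at this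
  exact this.trans hz2.le

/-- The entropy of a fair measure is the mean logarithm of its Jacobian, `2 log 2 · μ [1 - a, 0]`. -/
theorem measureEntropy_eq (ha : a ∈ Icc (√2) 2) (hμ : IsFairMeasure a μ) :
    measureEntropy (tent a) μ = ((2 * Real.log 2 * μ.real (Iic 0) : ℝ) : EReal) :=
  le_antisymm (iSup_le fun _ => iSup_le fun _ => iSup_le fun hP => hμ.entropyOfPartition_le ha hP)
    ((hμ.le_entropyOfPartition_piece ha).trans
      (le_iSup_of_le 3 (le_iSup_of_le (piece a) (le_iSup_of_le (measurable_piece a) le_rfl))))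

end IsFairMeasure

theorem fairEntropy_eq {a : ℝ} (ha : a ∈ Icc (√2) 2) : fairEntropy a = fairCdf a 0 := by
  rw [fairEntropy, (isFairMeasure_fairMeasure ha).measureEntropy_eq ha, EReal.toReal_coe, fairCdf]
  have := (Real.log_pos one_lt_two).ne'
  field_simp

/-! ### The window parameters -/

/-- While the critical orbit is negative it escapes linearly from the fixed point `-1 / (a - 1)`. -/
lemma critOrbit_closed {a : ℝ} {k : ℕ} (h2 : 2 ≤ k)
    (hk : ∀ j, 2 ≤ j → j < k → critOrbit a j < 0) :
    (a - 1) * critOrbit a k = a ^ (k - 1) * (2 - a) - 1 := by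
  induction k, h2 using Nat.le_induction with
  | base => rw [critOrbit_two]; norm_num; ring
  | succ k h2 ih =>
    have ih' := ih fun j hj hjk => hk j hj (by omega)
    rw [critOrbit_succ, tent_of_nonpos (hk k h2 (by omega)).le,
      show k + 1 - 1 = (k - 1) + 1 by omega, pow_succ]
    linear_combination a * ih'

lemma critOrbit_lt_of_lt {a a' : ℝ} {r k : ℕ} (ha : a ∈ Icc (√2) 2) (haa : a < a')
    (hneg : ∀ j, 2 ≤ j → j ≤ r → critOrbit a j < 0) (h2 : 2 ≤ k) (hk : k ≤ r + 1) :
    critOrbit a' k < critOrbit a k := by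
  have hb := (param_bounds ha).1
  induction k, h2 using Nat.le_induction with
  | base => rw [critOrbit_two, critOrbit_two]; linarith
  | succ k h2 ih =>
    have ih' := ih (by omega)
    have hn := hneg k h2 (by omega)
    rw [critOrbit_succ, critOrbit_succ, tent_of_nonpos hn.le, tent_of_nonpos (ih'.trans hn).le]
    nlinarith

lemma critOrbit_le_of_le {a a' : ℝ} {r k : ℕ} (ha : a ∈ Icc (√2) 2) (haa : a ≤ a')
    (hneg : ∀ j, 2 ≤ j → j ≤ r → critOrbit a j < 0) (h2 : 2 ≤ k) (hk : k ≤ r + 1) :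
    critOrbit a' k ≤ critOrbit a k := by
  rcases haa.eq_or_lt with rfl | h
  · exact le_rfl
  · exact (critOrbit_lt_of_lt ha h hneg h2 hk).le

lemma IsWindowParameter.neg {r : ℕ} {a : ℝ} (h : IsWindowParameter r a) {k : ℕ} (h2 : 2 ≤ k)
    (hk : k ≤ r) : critOrbit a k < 0 := by
  obtain ⟨n, rfl⟩ := Nat.exists_eq_add_of_le hk
  clear hk
  have : ∀ j ≤ n, critOrbit a (k + n - j) < 0 := by
    intro j
    induction j with
    | zero => intro _; exact h.2.1
    | succ j ih =>
      intro hj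
      have h1 := h.1 (k + n - (j + 1)) (by omega) (by omega)
      rw [show k + n - (j + 1) + 1 = k + n - j by omega] at h1
      exact h1.trans (ih (by omega))
  simpa using this n le_rfl

lemma IsWindowParameter.critOrbit_succ_eq {r : ℕ} {a : ℝ} (h : IsWindowParameter r a) :
    critOrbit a (r + 1) = a - 1 := by
  rw [h.2.2.2, critOrbit_two]; ring

lemma IsWindowParameter.unique {r : ℕ} (hr : 2 ≤ r) {a a' : ℝ} (ha : a ∈ Icc (√2) 2)
    (ha' : a' ∈ Icc (√2) 2) (h : IsWindowParameter r a) (h' : IsWindowParameter r a') : a = a' := by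
  have aux : ∀ {a a' : ℝ}, a ∈ Icc (√2) 2 → IsWindowParameter r a → IsWindowParameter r a' →
      ¬ a < a' := by
    intro a a' ha h h' hlt
    have h1 := critOrbit_lt_of_lt ha hlt (fun j h2 hj => h.neg h2 hj) (by omega : 2 ≤ r + 1) le_rfl
    rw [h.critOrbit_succ_eq, h'.critOrbit_succ_eq] at h1
    linarith
  exact le_antisymm (not_lt.1 (aux ha' h' h)) (not_lt.1 (aux ha h h'))

lemma exists_isWindowParameter {r : ℕ} (hr : 2 ≤ r) : ∃ a ∈ Icc (√2) 2, IsWindowParameter r a := by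
  have hs2 : √2 * √2 = 2 := Real.mul_self_sqrt (by norm_num)
  have hs : √2 ∈ Icc (√2) 2 := ⟨le_rfl, by nlinarith [Real.sqrt_nonneg 2]⟩
  have hsb := param_bounds hs
  have hcont : Continuous fun a : ℝ => a ^ r * (2 - a) - 1 - (a - 1) ^ 2 := by fun_prop
  obtain ⟨a, ha, hroot⟩ := intermediate_value_Icc' hs.2 hcont.continuousOn
    (show (0 : ℝ) ∈ Icc _ _ from ⟨by norm_num, by
      have : √2 ^ 2 ≤ √2 ^ r := pow_le_pow_right₀ (by linarith) hr
      nlinarith⟩)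
  dsimp only at hroot
  obtain ⟨h1, h2, h3⟩ := param_bounds ha
  have ha2 : a < 2 := by
    refine lt_of_le_of_ne h2 fun h => ?_
    rw [h] at hroot
    norm_num at hroot
  have hlt : a ^ (r - 1) * (2 - a) < 1 := by
    have e : a * (a ^ (r - 1) * (2 - a)) = 1 + (a - 1) ^ 2 := by
      rw [← mul_assoc, ← pow_succ', Nat.sub_add_cancel (by omega)]
      linarith
    have : 1 + (a - 1) ^ 2 < a * 1 := by nlinarith
    rw [← e] at this
    exact lt_of_mul_lt_mul_left this (by linarith)
  have hneg : ∀ k, 2 ≤ k → k ≤ r → critOrbit a k < 0 := by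
    intro k
    induction k using Nat.strong_induction_on with
    | _ k ih =>
      intro h2 hk
      have hc := critOrbit_closed (a := a) h2 fun j hj hjk => ih j hjk hj (by omega)
      have : a ^ (k - 1) ≤ a ^ (r - 1) := pow_le_pow_right₀ (by linarith) (by omega)
      have : a ^ (k - 1) * (2 - a) ≤ a ^ (r - 1) * (2 - a) :=
        mul_le_mul_of_nonneg_right this (by linarith)
      have : (a - 1) * critOrbit a k < 0 := by linarith
      exact neg_of_mul_neg_right this (by linarith)
  have hclosed : ∀ k, 2 ≤ k → k ≤ r + 1 → (a - 1) * critOrbit a k = a ^ (k - 1) * (2 - a) - 1 :=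
    fun k h2 hk => critOrbit_closed h2 fun j hj hjk => hneg j hj (by omega)
  have hlast : critOrbit a (r + 1) = a - 1 := by
    have := hclosed (r + 1) (by omega) le_rfl
    rw [Nat.add_sub_cancel] at this
    have h4 : (a - 1) * critOrbit a (r + 1) = (a - 1) * (a - 1) := by linarith
    exact mul_left_cancel₀ (by linarith) h4
  refine ⟨a, ha, fun k h2 hk => ?_, hneg r hr le_rfl, by linarith, by rw [hlast, critOrbit_two]; ring⟩
  have e1 := hclosed k h2 (by omega)
  have e2 := hclosed (k + 1) (by omega) (by omega)
  have : a ^ (k - 1) < a ^ (k + 1 - 1) := pow_lt_pow_right₀ (by linarith) (by omega)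
  have : a ^ (k - 1) * (2 - a) < a ^ (k + 1 - 1) * (2 - a) :=
    mul_lt_mul_of_pos_right this (by linarith)
  have : (a - 1) * critOrbit a k < (a - 1) * critOrbit a (k + 1) := by linarith
  exact lt_of_mul_lt_mul_left this (by linarith)

open Classical in
/-- The window parameter of order `r`, i.e. the solution `a` of `c_{r+1}(a) = a - 1` for which
`c_2(a), …, c_r(a)` are negative. -/
noncomputable def windowParam (r : ℕ) : ℝ :=
  if h : ∃ a ∈ Icc (√2) 2, IsWindowParameter r a then h.choose else √2

lemma windowParam_spec {r : ℕ} (hr : 2 ≤ r) :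
    windowParam r ∈ Icc (√2) 2 ∧ IsWindowParameter r (windowParam r) := by
  have h := exists_isWindowParameter hr
  rw [windowParam, dif_pos h]
  exact h.choose_spec

lemma setOf_isWindowParameter {r : ℕ} (hr : 2 ≤ r) :
    {a ∈ Icc (√2) 2 | IsWindowParameter r a} = {windowParam r} := by
  have h := windowParam_spec hr
  ext a
  constructor
  · rintro ⟨ha, h'⟩
    exact h'.unique hr ha h.1 h.2
  · rintro rfl
    exact h

lemma windowParam_two : windowParam 2 = √2 := by
  have hs2 : √2 * √2 = 2 := Real.mul_self_sqrt (by norm_num)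
  have hs : √2 ∈ Icc (√2) 2 := ⟨le_rfl, by nlinarith [Real.sqrt_nonneg 2]⟩
  have hb := param_bounds hs
  have h3 : critOrbit (√2) (2 + 1) = √2 - 1 := by rw [critOrbit_three hs]; linarith
  have h : IsWindowParameter 2 (√2) := by
    refine ⟨fun k h2 hk => by omega, ?_, ?_, ?_⟩
    · rw [critOrbit_two]; linarith
    · rw [h3]; linarith
    · rw [h3, critOrbit_two]; ring
  exact (windowParam_spec le_rfl).2.unique le_rfl (windowParam_spec le_rfl).1 hs h

lemma windowParam_lt_succ {r : ℕ} (hr : 2 ≤ r) : windowParam r < windowParam (r + 1) := by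
  obtain ⟨ha, h⟩ := windowParam_spec hr
  obtain ⟨ha', h'⟩ := windowParam_spec (show 2 ≤ r + 1 by omega)
  by_contra hle
  have h1 := critOrbit_le_of_le ha' (not_lt.1 hle) (fun j h2 hj => h'.neg h2 hj)
    (by omega : 2 ≤ r + 1) (by omega)
  have h2 := h'.neg (by omega : 2 ≤ r + 1) le_rfl
  linarith [h.2.2.1]

lemma windowParam_strictMonoOn : StrictMonoOn windowParam (Ici 2) := by
  intro m hm n _ hmn
  induction n, hmn using Nat.le_induction with
  | base => exact windowParam_lt_succ hm
  | succ n hmn ih =>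
    have : 2 ≤ n := le_trans hm (by omega)
    exact (ih this).trans (windowParam_lt_succ this)

lemma IsLongRun.of_windowParam_le {r : ℕ} (hr : 2 ≤ r) {a : ℝ} (h : windowParam r ≤ a) :
    IsLongRun r a := by
  obtain ⟨hw, h'⟩ := windowParam_spec hr
  refine ⟨fun k h2 hk => ?_, ?_⟩
  · exact (critOrbit_le_of_le hw h (fun j h2 hj => h'.neg h2 hj) h2 (by omega)).trans_lt (h'.neg h2 hk)
  · have := critOrbit_le_of_le hw h (fun j h2 hj => h'.neg h2 hj) (by omega : 2 ≤ r + 1) le_rfl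
    rw [h'.critOrbit_succ_eq] at this
    linarith

/-- The critical value `c_r` is bounded away from `0` to the right of the window parameter. -/
lemma exists_critOrbit_le_neg {r : ℕ} (hr : 2 ≤ r) :
    ∃ η > 0, ∀ a, windowParam r ≤ a → critOrbit a r ≤ -η := by
  obtain ⟨hw, h'⟩ := windowParam_spec hr
  refine ⟨-critOrbit (windowParam r) r, by linarith [h'.2.1], fun a h => ?_⟩
  rw [neg_neg]
  exact critOrbit_le_of_le hw h (fun j h2 hj => h'.neg h2 hj) hr (by omega)

/-- Below the next window parameter, the negative preimage of `a - 1` lies to the left of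
`c_{r+1}`. -/
lemma lt_critOrbit_of_lt_windowParam {r : ℕ} (hr : 2 ≤ r) {a : ℝ} (ha : a ∈ Icc (√2) 2)
    (h : windowParam r ≤ a) (h' : a < windowParam (r + 1)) : a - 1 < 1 + a * critOrbit a (r + 1) := by
  have hb := param_bounds ha
  obtain ⟨-, hw⟩ := windowParam_spec (show 2 ≤ r + 1 by omega)
  have hl := IsLongRun.of_windowParam_le hr h
  rcases lt_or_ge (critOrbit a (r + 1)) 0 with hc | hc
  · have h1 : ∀ j, 2 ≤ j → j ≤ r + 1 → critOrbit a j < 0 := by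
      intro j h2 hj
      rcases Nat.lt_or_ge r j with h3 | h3
      · rwa [show j = r + 1 by omega]
      · exact hl.1 j h2 h3
    have h2 := critOrbit_lt_of_lt ha h' h1 (by omega : 2 ≤ r + 1 + 1) le_rfl
    rw [hw.critOrbit_succ_eq, critOrbit_succ, tent_of_nonpos hc.le] at h2
    linarith
  · have : a < 2 := h'.trans_le (windowParam_spec (show 2 ≤ r + 1 by omega)).1.2
    have := mul_nonneg (show 0 ≤ a by linarith) hc
    linarith

lemma tendsto_windowParam : Tendsto windowParam atTop (𝓝 2) := by
  have hlow : ∀ᶠ r : ℕ in atTop, 2 - 2 * (5 / 7) ^ r ≤ windowParam r := by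
    filter_upwards [eventually_ge_atTop 2] with r hr
    obtain ⟨ha, h⟩ := windowParam_spec hr
    obtain ⟨h1, h2, -⟩ := param_bounds ha
    set a := windowParam r
    have hc := critOrbit_closed (a := a) (by omega : 2 ≤ r + 1) fun j h2 hj => h.neg h2 (by omega)
    rw [h.critOrbit_succ_eq, Nat.add_sub_cancel] at hc
    have h4 : (7 / 5 : ℝ) ^ r ≤ a ^ r := pow_le_pow_left₀ (by norm_num) h1.le r
    have h5 : (7 / 5 : ℝ) ^ r * (2 - a) ≤ 2 := by
      have := mul_le_mul_of_nonneg_right h4 (show 0 ≤ 2 - a by linarith)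
      nlinarith
    have h6 : (5 / 7 : ℝ) ^ r * ((7 / 5 : ℝ) ^ r * (2 - a)) ≤ (5 / 7) ^ r * 2 :=
      mul_le_mul_of_nonneg_left h5 (by positivity)
    rw [← mul_assoc, ← mul_pow] at h6
    norm_num at h6
    linarith
  have hup : ∀ᶠ r : ℕ in atTop, windowParam r ≤ 2 := by
    filter_upwards [eventually_ge_atTop 2] with r hr using (windowParam_spec hr).1.2
  refine tendsto_of_tendsto_of_tendsto_of_le_of_le' ?_ tendsto_const_nhds hlow hup
  have := (tendsto_pow_atTop_nhds_zero_of_lt_one (show (0 : ℝ) ≤ 5 / 7 by norm_num)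
    (by norm_num)).const_mul 2 |>.const_sub 2
  simpa using this

/-! ### Intervals on which an iterate is affine -/

/-- If the orbits of the end points of an interval stay on the same side of the turning point for
`n` steps, then the `n`-th iterate is affine on the interval. -/
lemma iterate_of_same_side {a x y : ℝ} (ha : a ∈ Icc (√2) 2) (hxy : x ≤ y) {n : ℕ}
    (hs : ∀ k < n, 0 ≤ (tent a)^[k] x * (tent a)^[k] y) :
    (∀ z ∈ Icc x y, (tent a)^[n] z ∈ uIcc ((tent a)^[n] x) ((tent a)^[n] y)) ∧
    ∀ z ∈ Icc x y, ∀ w ∈ Icc x y,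
      |(tent a)^[n] z - (tent a)^[n] w| = a ^ n * |z - w| := by
  have h0 : 0 ≤ a := by linarith [(param_bounds ha).1]
  induction n with
  | zero => simp [uIcc_of_le hxy]
  | succ n ih =>
    obtain ⟨ih1, ih2⟩ := ih fun k hk => hs k (by omega)
    simp only [Function.iterate_succ_apply']
    rcases mul_nonneg_iff.1 (hs n n.lt_succ_self) with ⟨h1, h2⟩ | ⟨h1, h2⟩
    · have h3 : ∀ z ∈ Icc x y, 0 ≤ (tent a)^[n] z := fun z hz =>
        (le_inf h1 h2).trans (ih1 z hz).1
      constructor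
      · intro z hz
        rw [tent_of_nonneg h1, tent_of_nonneg h2, tent_of_nonneg (h3 z hz)]
        rcases mem_uIcc.1 (ih1 z hz) with ⟨h4, h5⟩ | ⟨h4, h5⟩
        · exact mem_uIcc.2 (Or.inr ⟨by nlinarith, by nlinarith⟩)
        · exact mem_uIcc.2 (Or.inl ⟨by nlinarith, by nlinarith⟩)
      · intro z hz w hw
        rw [tent_of_nonneg (h3 z hz), tent_of_nonneg (h3 w hw), pow_succ', mul_assoc,
          ← ih2 z hz w hw, ← abs_of_nonneg h0, ← abs_mul, abs_of_nonneg h0, ← abs_neg]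
        congr 1; ring
    · have h3 : ∀ z ∈ Icc x y, (tent a)^[n] z ≤ 0 := fun z hz =>
        (ih1 z hz).2.trans (sup_le h1 h2)
      constructor
      · intro z hz
        rw [tent_of_nonpos h1, tent_of_nonpos h2, tent_of_nonpos (h3 z hz)]
        rcases mem_uIcc.1 (ih1 z hz) with ⟨h4, h5⟩ | ⟨h4, h5⟩
        · exact mem_uIcc.2 (Or.inl ⟨by nlinarith, by nlinarith⟩)
        · exact mem_uIcc.2 (Or.inr ⟨by nlinarith, by nlinarith⟩)
      · intro z hz w hw
        rw [tent_of_nonpos (h3 z hz), tent_of_nonpos (h3 w hw), pow_succ', mul_assoc,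
          ← ih2 z hz w hw, ← abs_of_nonneg h0, ← abs_mul, abs_of_nonneg h0]
        congr 1; ring

lemma measureReal_Icc_eq_fairCdf_sub {a x y : ℝ} (ha : a ∈ Icc (√2) 2) (hxy : x ≤ y) :
    (fairMeasure a).real (Icc x y) = fairCdf a y - fairCdf a x :=
  (isFairMeasure_fairMeasure ha).measureReal_Icc hxy

/-- The mass of an interval on which `f_a^n` is affine, compared with the mass of its image. -/
lemma fairCdf_sub_mul_le {a x y : ℝ} (ha : a ∈ Icc (√2) 2) (hx : 1 - a ≤ x) (hxy : x ≤ y)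
    (hy : y ≤ 1) {n m : ℕ} (hs : ∀ k < n, 0 ≤ (tent a)^[k] x * (tent a)^[k] y)
    (hv : ∀ z ∈ Icc x y, visits a z n ≤ m) :
    (fairCdf a y - fairCdf a x) * 2 ^ n ≤
      2 ^ m * |fairCdf a ((tent a)^[n] x) - fairCdf a ((tent a)^[n] y)| := by
  have hμ := isFairMeasure_fairMeasure ha
  have := hμ.isProbabilityMeasure
  have h0 : 0 < a := by linarith [(param_bounds ha).1]
  obtain ⟨h1, h2⟩ := iterate_of_same_side ha hxy hs
  have hinj : InjOn (tent a)^[n] (Icc x y) := by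
    intro z hz w hw hzw
    have := h2 z hz w hw
    rw [hzw, sub_self, abs_zero] at this
    have h3 : |z - w| = 0 := by
      rcases mul_eq_zero.1 this.symm with h | h
      · exact absurd h (by positivity)
      · exact h
    linarith [abs_eq_zero.1 h3]
  have key := hμ.measure_mul_le ha n m (Icc x y) measurableSet_Icc (Icc_subset_Icc hx hy) hinj hv
  have key2 : fairMeasure a (Icc x y) * 2 ^ n ≤
      2 ^ m * fairMeasure a (uIcc ((tent a)^[n] x) ((tent a)^[n] y)) :=
    key.trans (mul_le_mul_right (measure_mono (by
      rintro _ ⟨z, hz, rfl⟩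
      exact h1 z hz)) _)
  have key3 := ENNReal.toReal_mono (ENNReal.mul_ne_top (by simp) (measure_ne_top _ _)) key2
  rw [ENNReal.toReal_mul, ENNReal.toReal_mul] at key3
  simp only [ENNReal.toReal_pow, ENNReal.toReal_ofNat] at key3
  rw [← measureReal_def, ← measureReal_def, measureReal_Icc_eq_fairCdf_sub ha hxy] at key3
  refine key3.trans (mul_le_mul_of_nonneg_left ?_ (by positivity))
  rcases le_total ((tent a)^[n] x) ((tent a)^[n] y) with h | h
  · rw [uIcc_of_le h, measureReal_Icc_eq_fairCdf_sub ha h, abs_sub_comm]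
    exact le_abs_self _
  · rw [uIcc_of_ge h, measureReal_Icc_eq_fairCdf_sub ha h]
    exact le_abs_self _

/-- The two sides of the turning point carry half the mass of their common image. -/
lemma abs_fairCdf_sub_zero {a p : ℝ} (ha : a ∈ Icc (√2) 2) (hp : |p| ≤ a - 1) :
    |fairCdf a p - fairCdf a 0| = (1 - fairCdf a (tent a p)) / 2 := by
  have hF := isFairCdf_fairCdf ha
  have hp' := abs_le.1 hp
  have hm : tent a p ∈ Icc (1 - a) 1 :=
    tent_mem ha ⟨by linarith, by linarith [(param_bounds ha).2.1]⟩
  have h1 := (hF.mem_Icc ha hm).2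
  rcases le_total p 0 with h | h
  · have := hF.nonpos p ⟨by linarith, h⟩
    rw [abs_of_nonpos (by linarith)]
    linarith
  · have := hF.center p ⟨h, hp'.2⟩
    rw [abs_of_nonneg (by linarith)]
    linarith

/-- An interval is iterated until it contains the turning point in its interior or has length
greater than `ε`. -/
lemma exists_first_large {a x y ε : ℝ} (ha : a ∈ Icc (√2) 2) (hxy : x < y) :
    ∃ n, (∀ k < n, 0 ≤ (tent a)^[k] x * (tent a)^[k] y) ∧ (ε < a ^ n * (y - x) ∨
      (a ^ n * (y - x) ≤ ε ∧ (tent a)^[n] x * (tent a)^[n] y < 0)) := by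
  classical
  have hex : ∃ n, ε < a ^ n * (y - x) ∨ (tent a)^[n] x * (tent a)^[n] y < 0 := by
    obtain ⟨n, hn⟩ := pow_unbounded_of_one_lt (ε / (y - x)) (show 1 < a by
      linarith [(param_bounds ha).1])
    exact ⟨n, Or.inl ((div_lt_iff₀ (by linarith)).1 hn)⟩
  refine ⟨Nat.find hex, fun k hk => ?_, ?_⟩
  · have := Nat.find_min hex hk
    push Not at this
    exact this.2
  · rcases lt_or_ge ε (a ^ Nat.find hex * (y - x)) with h | h
    · exact Or.inl h
    · exact Or.inr ⟨h, (Nat.find_spec hex).resolve_left (not_lt.2 h)⟩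

/-! ### Visits to the one-to-one part along orbit segments ending near the turning point -/

lemma IsLongRun.critOrbit_mono {r : ℕ} {a : ℝ} (ha : a ∈ Icc (√2) 2) (h : IsLongRun r a) {k : ℕ}
    (h2 : 2 ≤ k) (hk : k ≤ r) : critOrbit a k ≤ critOrbit a r := by
  have hb := param_bounds ha
  have e1 := critOrbit_closed (a := a) h2 fun j h2 hj => h.1 j h2 (by omega)
  have e2 := critOrbit_closed (a := a) (h2.trans hk) fun j h2 hj => h.1 j h2 (by omega)
  have h3 : a ^ (k - 1) ≤ a ^ (r - 1) := pow_le_pow_right₀ (by linarith) (by omega)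
  have h4 := mul_le_mul_of_nonneg_right h3 (show 0 ≤ 2 - a by linarith)
  exact le_of_mul_le_mul_left (show (a - 1) * critOrbit a k ≤ (a - 1) * critOrbit a r by linarith)
    (by linarith)

lemma IsLongRun.visits_mul_le_of_end {r : ℕ} {a : ℝ} (ha : a ∈ Icc (√2) 2) (hr : 2 ≤ r)
    (h : IsLongRun r a) (n : ℕ) (z : ℝ) (hz : critOrbit a r ≤ (tent a)^[n] z) :
    r * visits a z n ≤ n + 1 := by
  induction n using Nat.strong_induction_on generalizing z with
  | _ n ih =>
    rcases n with _ | n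
    · simp [visits_zero]
    by_cases hx : a - 1 < z
    · rcases Nat.lt_or_ge n (r - 1) with hn | hn
      · have h1 := h.visits_le_one ha hx (show n + 1 ≤ r by omega)
        rcases Nat.lt_or_ge (n + 1) (r - 1) with h2 | h2
        · have h3 := h.iterate_lt ha hx (show 1 ≤ n + 1 by omega) (by omega)
          have h4 := h.critOrbit_mono ha (show 2 ≤ n + 1 + 2 by omega) (by omega)
          linarith
        · nlinarith [Nat.mul_le_mul_left r h1, Nat.sub_add_cancel (show 1 ≤ r by omega)]
      · have h1 := h.visits_le_one ha hx le_rfl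
        have h2 := ih (n + 1 - r) (by omega) ((tent a)^[r] z) (by
          rwa [← Function.iterate_add_apply, Nat.sub_add_cancel (by omega)])
        have h3 : visits a z (n + 1) = visits a z r + visits a ((tent a)^[r] z) (n + 1 - r) := by
          rw [← visits_add]; congr 1; omega
        rw [h3]
        have h4 := Nat.mul_le_mul_left r h1
        rw [mul_add]
        omega
    · rw [visits_succ', if_neg hx, add_zero]
      have := ih n (by omega) (tent a z) hz
      omega

/-- In the extremal case of `IsLongRun.visits_mul_le_of_end` the orbit segment starts in
`(a - 1, 1]` and either has length `r - 1` or is extremal again after `r` steps. -/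
lemma IsLongRun.of_lt_visits {r : ℕ} {a : ℝ} (ha : a ∈ Icc (√2) 2) (hr : 2 ≤ r)
    (h : IsLongRun r a) {n : ℕ} {z : ℝ} (hz : critOrbit a r ≤ (tent a)^[n] z)
    (hv : n < r * visits a z n) :
    a - 1 < z ∧ (n + 1 = r ∨ (r ≤ n ∧ n - r < r * visits a ((tent a)^[r] z) (n - r))) := by
  rcases n with _ | n
  · simp [visits_zero] at hv
  have hx : a - 1 < z := by
    by_contra hx
    rw [visits_succ', if_neg hx, add_zero] at hv
    have := h.visits_mul_le_of_end ha hr n (tent a z) hz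
    omega
  refine ⟨hx, ?_⟩
  rcases Nat.lt_or_ge (n + 1) r with hn | hn
  · left
    have h1 := h.visits_le_one ha hx hn.le
    have h2 := h.visits_mul_le_of_end ha hr _ z hz
    have h3 : visits a z (n + 1) = 1 := by
      by_contra h3
      rw [show visits a z (n + 1) = 0 by omega] at hv
      omega
    rw [h3] at h2
    omega
  · right
    refine ⟨hn, ?_⟩
    have h1 := Nat.mul_le_mul_left r (h.visits_le_one ha hx (le_refl r))
    have h3 : visits a z (n + 1) = visits a z r + visits a ((tent a)^[r] z) (n + 1 - r) := by
      rw [← visits_add]; congr 1; omega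
    rw [h3, mul_add] at hv
    omega

/-- A point that shadows the orbit of `1` until this orbit is close to the turning point visits
`(a - 1, 1]` with frequency at most `1 / r`, without an additive error. -/
lemma IsLongRun.visits_mul_le_of_near_one {r : ℕ} {a ε t : ℝ} (ha : a ∈ Icc (√2) 2) (hr : 2 ≤ r)
    (h : IsLongRun r a) (hε : ε ≤ 1 / 20) (hεr : critOrbit a r < -ε) {n : ℕ} {z : ℝ}
    (hzt : |z - 1| ≤ t) (hn : a ^ n * t ≤ ε) (hz : |(tent a)^[n] z| ≤ ε)
    (h1 : |(tent a)^[n] 1| ≤ ε) : r * visits a z n ≤ n := by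
  obtain ⟨hb1, hb2, hb3⟩ := param_bounds ha
  have ht : 0 ≤ t := (abs_nonneg _).trans hzt
  have hzr : ∀ {m : ℕ}, m ≤ n → critOrbit a r ≤ (tent a)^[n - m] ((tent a)^[m] z) := by
    intro m hm
    rw [← Function.iterate_add_apply, Nat.sub_add_cancel hm]
    linarith [(abs_le.1 hz).1]
  have hpow : ∀ {k : ℕ}, k ≤ n → a ^ k * t ≤ ε := fun {k} hk =>
    (mul_le_mul_of_nonneg_right (pow_le_pow_right₀ (by linarith) hk) ht).trans hn
  have shadow : ∀ {k : ℕ}, k ≤ n → |(tent a)^[k] z - critOrbit a (k + 1)| ≤ a ^ k * t := by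
    intro k hk
    rw [← iterate_one_eq]
    exact (abs_iterate_sub_le ha z 1 k).trans (mul_le_mul_of_nonneg_left hzt (by positivity))
  by_contra hv
  obtain ⟨-, h2⟩ := h.of_lt_visits ha hr (hzr (Nat.zero_le n)) (not_le.1 hv)
  have hrn : r ≤ n ∧ n - r < r * visits a ((tent a)^[r] z) (n - r) := by
    rcases h2 with h2 | h2
    · rw [iterate_one_eq, show n + 1 = r by omega] at h1
      linarith [(abs_le.1 h1).1]
    · exact h2
  obtain ⟨hrn, hv2⟩ := hrn
  obtain ⟨hR, h3⟩ := h.of_lt_visits ha hr (hzr hrn) hv2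
  have hs := shadow hrn
  have hcr := h.2
  rcases Nat.eq_or_lt_of_le hr with rfl | hr3
  · -- the fixed point `1 / (1 + a)` lies between `c_3` and `f_a^2 z`
    set p := 1 / (1 + a) with hp
    have hpa : p * (1 + a) = 1 := by rw [hp]; field_simp
    have hp1 : 1 / 3 ≤ p := by
      rw [hp]; exact one_div_le_one_div_of_le (by linarith) (by linarith)
    have hp2 : p ≤ a - 1 := by nlinarith
    have hp3 : critOrbit a 3 ≤ p := by rw [critOrbit_three ha]; nlinarith
    have hfix : tent a p = p := by rw [tent_of_nonneg (by linarith)]; linarith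
    have h4 : |(tent a)^[2] z - p| ≤ a ^ 2 * t := by
      rw [abs_of_nonneg (by linarith)]
      have := (abs_le.1 hs).2
      linarith
    have h5 := abs_iterate_sub_le ha ((tent a)^[2] z) p (n - 2)
    rw [← Function.iterate_add_apply, Nat.sub_add_cancel hrn, Function.iterate_fixed hfix] at h5
    have h6 : a ^ (n - 2) * |(tent a)^[2] z - p| ≤ ε := by
      refine (mul_le_mul_of_nonneg_left h4 (by positivity)).trans ?_
      rw [← mul_assoc, ← pow_add, Nat.sub_add_cancel hrn]
      exact hn
    have h7 := (abs_le.1 (h5.trans h6)).1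
    linarith [(abs_le.1 hz).2]
  · have hc3 : critOrbit a 3 < 0 := h.1 3 (by omega) (by omega)
    have hε0 : 0 ≤ ε := (abs_nonneg _).trans h1
    have hlow : a - 1 - ε ≤ critOrbit a (r + 1) := by
      linarith [(abs_le.1 hs).2, hpow hrn]
    -- after `r - 1` further steps the orbit is close to `c_{r+1}` again
    have hreturn : r + (r - 1) ≤ n → a - 1 - 2 * ε ≤ (tent a)^[r + (r - 1)] z := by
      intro hle
      have e1 : (tent a)^[r - 1] (a - 1) = critOrbit a (r + 1) := by
        obtain ⟨m, rfl⟩ : ∃ m, r = m + 2 := ⟨r - 2, by omega⟩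
        rw [show m + 2 - 1 = m + 1 by omega, Function.iterate_succ_apply, tent_sub_one ha,
          iterate_critOrbit]
        congr 1; omega
      have h4 := abs_iterate_sub_le ha ((tent a)^[r] z) (a - 1) (r - 1)
      rw [e1, ← Function.iterate_add_apply, Nat.add_comm (r - 1) r] at h4
      have h5 : |(tent a)^[r] z - (a - 1)| ≤ a ^ r * t := by
        rw [abs_of_nonneg (by linarith)]
        linarith [(abs_le.1 hs).2]
      have h6 : a ^ (r - 1) * |(tent a)^[r] z - (a - 1)| ≤ ε := by
        refine (mul_le_mul_of_nonneg_left h5 (by positivity)).trans ?_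
        rw [← mul_assoc, ← pow_add, Nat.add_comm (r - 1) r]
        exact hpow hle
      linarith [(abs_le.1 (h4.trans h6)).1]
    rcases h3 with h3 | ⟨h3, hv3⟩
    · have h4 := hreturn (by omega)
      rw [show r + (r - 1) = n by omega] at h4
      linarith [(abs_le.1 hz).2]
    · rw [← Function.iterate_add_apply, show n - r - r = n - (r + r) by omega] at hv3
      obtain ⟨h5, -⟩ := h.of_lt_visits ha hr (hzr (show r + r ≤ n by omega)) hv3
      have h4 := hreturn (by omega)
      rw [show r + r = (r + (r - 1)) + 1 by omega, Function.iterate_succ_apply',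
        tent_of_nonneg (by linarith)] at h5
      rw [critOrbit_three ha] at hc3
      nlinarith

/-! ### Hölder continuity of the distribution functions -/

lemma holderExponent_pos {r : ℕ} (hr : 2 ≤ r) {b : ℝ} (hb : 1 < b) : 0 < holderExponent r b := by
  have h1 : (2 : ℝ) ≤ r := by exact_mod_cast hr
  have h2 := Real.log_pos one_lt_two
  have h3 := Real.log_pos hb
  unfold holderExponent
  exact div_pos (mul_pos (by linarith) h2) (mul_pos (by linarith) h3)

/-- The decay rate `2^{(r-1)/r}` per step of the mass of small intervals: it is halved at all but
one of `r` steps. -/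
noncomputable def decayRate (r : ℕ) : ℝ := 2 ^ (((r : ℝ) - 1) / r)

lemma decayRate_pos (r : ℕ) : 0 < decayRate r := Real.rpow_pos_of_pos two_pos _

lemma rpow_holderExponent {r : ℕ} (hr : 2 ≤ r) {b : ℝ} (hb : 1 < b) :
    b ^ holderExponent r b = decayRate r := by
  have h1 : (2 : ℝ) ≤ r := by exact_mod_cast hr
  have h3 := Real.log_pos hb
  rw [decayRate, Real.rpow_def_of_pos (by linarith), Real.rpow_def_of_pos two_pos, holderExponent]
  congr 1
  field_simp

lemma decayRate_pow {r : ℕ} (hr : 2 ≤ r) : decayRate r ^ r = 2 ^ (r - 1) := by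
  have h1 : (2 : ℝ) ≤ r := by exact_mod_cast hr
  rw [decayRate, ← Real.rpow_natCast, ← Real.rpow_mul zero_le_two, div_mul_cancel₀ _ (by linarith),
    ← Real.rpow_natCast, Nat.cast_sub (by omega), Nat.cast_one]

lemma decayRate_le_two {r : ℕ} (hr : 2 ≤ r) : decayRate r ≤ 2 := by
  have : decayRate r ^ r ≤ 2 ^ r := by
    rw [decayRate_pow hr]; exact pow_le_pow_right₀ one_le_two (by omega)
  exact le_of_pow_le_pow_left₀ (by omega) two_pos.le this

lemma two_le_decayRate_sq {r : ℕ} (hr : 2 ≤ r) : 2 ≤ decayRate r ^ 2 := by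
  have : (2 : ℝ) ^ r ≤ (decayRate r ^ 2) ^ r := by
    rw [← pow_mul, mul_comm, pow_mul, decayRate_pow hr, ← pow_mul]
    exact pow_le_pow_right₀ one_le_two (by omega)
  exact le_of_pow_le_pow_left₀ (by omega) (by positivity) this

lemma one_le_decayRate {r : ℕ} (hr : 2 ≤ r) : 1 ≤ decayRate r := by
  by_contra hlt
  have h1 := two_le_decayRate_sq hr
  nlinarith [decayRate_pos r]

lemma two_pow_mul_decayRate_le {r m n : ℕ} (hr : 2 ≤ r) (h : r * m ≤ n) :
    2 ^ m * decayRate r ^ n ≤ 2 ^ n := by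
  have h0 := decayRate_pos r
  refine le_of_pow_le_pow_left₀ (show r ≠ 0 by omega) (by positivity) ?_
  rw [mul_pow, ← pow_mul, ← pow_mul, mul_comm n r, pow_mul (decayRate r), decayRate_pow hr,
    ← pow_mul, ← pow_mul, ← pow_add]
  refine pow_le_pow_right₀ one_le_two ?_
  obtain ⟨s, rfl⟩ : ∃ s, r = s + 1 := ⟨r - 1, by omega⟩
  rw [Nat.add_sub_cancel]
  nlinarith

lemma two_pow_mul_decayRate_le' {r m n : ℕ} (hr : 2 ≤ r) (h : r * m + 1 ≤ n + r) :
    2 ^ m * decayRate r ^ n ≤ 2 * 2 ^ n := by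
  rcases m with _ | m
  · have := two_pow_mul_decayRate_le (m := 0) (n := n) hr (by omega)
    have h2 : (0 : ℝ) < 2 ^ n := by positivity
    linarith
  · have := two_pow_mul_decayRate_le (m := m) (n := n) hr (by rw [mul_add] at h; omega)
    rw [pow_succ]
    linarith

lemma two_pow_le_mul_decayRate {r m n : ℕ} (hr : 2 ≤ r) (h : n + 1 ≤ r * m + r) :
    2 ^ n ≤ 2 * 2 ^ m * decayRate r ^ n := by
  have h0 := decayRate_pos r
  refine le_of_pow_le_pow_left₀ (show r ≠ 0 by omega) (by positivity) ?_
  rw [mul_pow, mul_pow, ← pow_mul, ← pow_mul, ← pow_mul, mul_comm n r, pow_mul (decayRate r),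
    decayRate_pow hr, ← pow_mul, ← pow_add, ← pow_add]
  refine pow_le_pow_right₀ one_le_two ?_
  obtain ⟨s, rfl⟩ : ∃ s, r = s + 1 := ⟨r - 1, by omega⟩
  rw [Nat.add_sub_cancel]
  nlinarith

lemma pow_mul_rpow {a t α : ℝ} (ha : 0 ≤ a) (ht : 0 ≤ t) (n : ℕ) :
    (a ^ n * t) ^ α = (a ^ α) ^ n * t ^ α := by
  rw [Real.mul_rpow (by positivity) ht, ← Real.rpow_natCast, ← Real.rpow_mul ha, mul_comm (n : ℝ),
    Real.rpow_mul ha, Real.rpow_natCast]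

lemma pow_mul_rpow_le {a q t α : ℝ} (ha : 0 ≤ a) (hq : a ^ α ≤ q) (ht : 0 ≤ t) (n : ℕ) :
    (a ^ n * t) ^ α ≤ q ^ n * t ^ α := by
  rw [pow_mul_rpow ha ht]
  exact mul_le_mul_of_nonneg_right (pow_le_pow_left₀ (Real.rpow_nonneg ha _) hq n)
    (Real.rpow_nonneg ht _)

lemma half_add_rpow_le {a u v α : ℝ} (ha : 0 ≤ a) (ha2 : a ≤ 2) (hα : 0 < α) (haα : a ^ α ≤ 2)
    (hu : 0 ≤ u) (hv : 0 ≤ v) : ((a * u) ^ α + (a * v) ^ α) / 2 ≤ (u + v) ^ α := by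
  rcases le_total α 1 with h | h
  · have hc := (Real.concaveOn_rpow hα.le h).2 (x := a * u) (y := a * v)
      (mem_Ici.2 (by positivity)) (mem_Ici.2 (by positivity)) (by norm_num : (0 : ℝ) ≤ 1 / 2)
      (by norm_num : (0 : ℝ) ≤ 1 / 2) (by norm_num)
    simp only [smul_eq_mul] at hc
    have : (1 / 2 * (a * u) + 1 / 2 * (a * v)) ^ α ≤ (u + v) ^ α :=
      Real.rpow_le_rpow (by positivity) (by nlinarith) hα.le
    linarith
  · have h1 := Real.add_rpow_le_rpow_add hu hv h
    have h2 : 0 ≤ u ^ α + v ^ α := by positivity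
    rw [Real.mul_rpow ha hu, Real.mul_rpow ha hv]
    nlinarith

lemma IsLongRun.exists_visits_bound {r : ℕ} {a : ℝ} (ha : a ∈ Icc (√2) 2) (hr : 2 ≤ r)
    (h : IsLongRun r a) (n : ℕ) : ∃ m, r * m + 1 ≤ n + r ∧ ∀ z, visits a z n ≤ m := by
  refine ⟨(n + r - 1) / r, ?_, fun z => ?_⟩
  · have := Nat.mul_div_le (n + r - 1) r
    omega
  · rw [Nat.le_div_iff_mul_le (by omega), mul_comm]
    have := h.visits_mul_le ha (by omega) n z
    omega

lemma fairCdf_sub_le_of_large {r : ℕ} {a α ε x y : ℝ} (ha : a ∈ Icc (√2) 2) (hr : 2 ≤ r)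
    (h : IsLongRun r a) (hα : 0 < α) (hq : a ^ α ≤ decayRate r) (hε : 0 < ε) (hx : 1 - a ≤ x)
    (hxy : x ≤ y) (hy : y ≤ 1) {n : ℕ} (hs : ∀ k < n, 0 ≤ (tent a)^[k] x * (tent a)^[k] y)
    (hn : ε < a ^ n * (y - x)) :
    fairCdf a y - fairCdf a x ≤ 2 / ε ^ α * (y - x) ^ α := by
  have h0 : 0 < a := by linarith [(param_bounds ha).1]
  have hF := isFairCdf_fairCdf ha
  have hd := decayRate_pos r
  obtain ⟨m, hm, hv⟩ := h.exists_visits_bound ha hr n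
  have key := fairCdf_sub_mul_le ha hx hxy hy hs fun z _ => hv z
  have m1 := hF.mem_Icc ha (iterate_mem ha ⟨hx, hxy.trans hy⟩ n)
  have m2 := hF.mem_Icc ha (iterate_mem ha ⟨hx.trans hxy, hy⟩ n)
  have habs : |fairCdf a ((tent a)^[n] x) - fairCdf a ((tent a)^[n] y)| ≤ 1 :=
    abs_le.2 ⟨by linarith [m1.1, m2.2], by linarith [m1.2, m2.1]⟩
  have h2 := two_pow_mul_decayRate_le' hr hm
  have hle : (fairCdf a y - fairCdf a x) * decayRate r ^ n ≤ 2 := by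
    have e1 : (fairCdf a y - fairCdf a x) * 2 ^ n ≤ 2 ^ m :=
      key.trans (mul_le_of_le_one_right (by positivity) habs)
    have e2 := mul_le_mul_of_nonneg_right e1 (show 0 ≤ decayRate r ^ n by positivity)
    have e3 := e2.trans h2
    have hp : (0 : ℝ) < 2 ^ n := by positivity
    refine le_of_mul_le_mul_right ?_ hp
    linarith
  have h3 : ε ^ α ≤ decayRate r ^ n * (y - x) ^ α :=
    (Real.rpow_le_rpow hε.le hn.le hα.le).trans (pow_mul_rpow_le h0.le hq (by linarith) n)
  have hεα : 0 < ε ^ α := Real.rpow_pos_of_pos hε α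
  have hxα : 0 ≤ (y - x) ^ α := Real.rpow_nonneg (by linarith) α
  have hdn : 0 < decayRate r ^ n := by positivity
  rw [div_mul_eq_mul_div, le_div_iff₀ hεα]
  have hmono : 0 ≤ fairCdf a y - fairCdf a x := by
    rw [← measureReal_Icc_eq_fairCdf_sub ha hxy]; exact measureReal_nonneg
  calc (fairCdf a y - fairCdf a x) * ε ^ α
      ≤ (fairCdf a y - fairCdf a x) * (decayRate r ^ n * (y - x) ^ α) :=
        mul_le_mul_of_nonneg_left h3 hmono
    _ = (fairCdf a y - fairCdf a x) * decayRate r ^ n * (y - x) ^ α := by ring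
    _ ≤ 2 * (y - x) ^ α := mul_le_mul_of_nonneg_right hle hxα

/-- Once an iterate of an interval contains the turning point, its mass is controlled by the mass of
small intervals at the right end point `1`. -/
lemma fairCdf_sub_mul_le_of_crossing {a α C δ q x y : ℝ} (ha : a ∈ Icc (√2) 2) (hα : 0 < α)
    (hq : a ^ α ≤ q) (hq2 : q ≤ 2) (hC : 0 ≤ C)
    (hK : ∀ z ∈ Icc (1 - a) 1, 1 - fairCdf a z ≤ C * (1 - z) ^ α + δ) (hx : 1 - a ≤ x)
    (hxy : x ≤ y) (hy : y ≤ 1) {n m : ℕ} (hs : ∀ k < n, 0 ≤ (tent a)^[k] x * (tent a)^[k] y)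
    (hn : a ^ n * (y - x) ≤ 1 / 20) (hneg : (tent a)^[n] x * (tent a)^[n] y < 0)
    (hv : ∀ z ∈ Icc x y, visits a z n ≤ m) :
    (fairCdf a y - fairCdf a x) * 2 ^ n ≤ 2 ^ m * (C * (q ^ n * (y - x) ^ α) + δ) := by
  obtain ⟨hb1, hb2, hb3⟩ := param_bounds ha
  refine (fairCdf_sub_mul_le ha hx hxy hy hs hv).trans
    (mul_le_mul_of_nonneg_left ?_ (by positivity))
  have hlen := (iterate_of_same_side ha hxy hs).2 x ⟨le_rfl, hxy⟩ y ⟨hxy, le_rfl⟩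
  set p := (tent a)^[n] x with hp
  set p' := (tent a)^[n] y with hp'
  have hsum : |p| + |p'| = a ^ n * (y - x) := by
    rw [abs_sub_comm x y, abs_of_nonneg (show 0 ≤ y - x by linarith)] at hlen
    rw [← hlen]
    rcases mul_neg_iff.1 hneg with ⟨h1, h2⟩ | ⟨h1, h2⟩
    · rw [abs_of_pos h1, abs_of_neg h2, abs_of_pos (by linarith)]; ring
    · rw [abs_of_neg h1, abs_of_pos h2, abs_of_neg (by linarith)]; ring
  have bound : ∀ w, |w| ≤ 1 / 20 → |fairCdf a w - fairCdf a 0| ≤ (C * (a * |w|) ^ α + δ) / 2 := by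
    intro w hw
    rw [abs_fairCdf_sub_zero ha (by linarith)]
    have hw' := abs_le.1 hw
    have := hK (tent a w) (tent_mem ha ⟨by linarith, by linarith⟩)
    rw [show 1 - tent a w = a * |w| by unfold tent; ring] at this
    linarith
  have b1 := bound p (by linarith [abs_nonneg p'])
  have b2 := bound p' (by linarith [abs_nonneg p])
  rw [abs_sub_comm] at b2
  have h3 := half_add_rpow_le (by linarith) hb2 hα (hq.trans hq2) (abs_nonneg p) (abs_nonneg p')
  have h4 : (|p| + |p'|) ^ α ≤ q ^ n * (y - x) ^ α := by
    rw [hsum]; exact pow_mul_rpow_le (by linarith) hq (by linarith) n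
  have h5 := abs_sub_le (fairCdf a p) (fairCdf a 0) (fairCdf a p')
  have h6 := mul_le_mul_of_nonneg_left (h3.trans h4) hC
  linarith

/-- The mass of intervals at the right end point `1`. The bound is improved at every return to the
turning point; there the frequency of visits to `(a - 1, 1]` is at most `1 / r` exactly, so that
the constant is not increased by infinitely many returns. -/
lemma exists_one_sub_fairCdf_le {r : ℕ} (hr : 2 ≤ r) :
    ∃ ε > 0, ε ≤ 1 / 20 ∧ ∀ a ∈ Icc (√2) 2, windowParam r ≤ a →
      ∀ α : ℝ, 0 < α → a ^ α ≤ decayRate r →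
      ∀ z ∈ Icc (1 - a) 1, 1 - fairCdf a z ≤ 2 / ε ^ α * (1 - z) ^ α := by
  obtain ⟨η, hη, hcr⟩ := exists_critOrbit_le_neg hr
  refine ⟨min (η / 2) (1 / 20), by positivity, min_le_right _ _, fun a ha har α hα hq => ?_⟩
  set ε := min (η / 2) (1 / 20) with hε
  have hε0 : 0 < ε := by positivity
  have hε1 : ε ≤ 1 / 20 := min_le_right _ _
  have hε2 : ε < η := (min_le_left _ _).trans_lt (by linarith)
  have h := IsLongRun.of_windowParam_le hr har
  obtain ⟨hb1, hb2, hb3⟩ := param_bounds ha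
  have hF := isFairCdf_fairCdf ha
  have hd := decayRate_pos r
  have hC : 0 ≤ 2 / ε ^ α := by positivity
  have main : ∀ j : ℕ, ∀ z ∈ Icc (1 - a) 1,
      1 - fairCdf a z ≤ 2 / ε ^ α * (1 - z) ^ α + (1 / 2) ^ j := by
    intro j
    induction j with
    | zero =>
      intro z hz
      have h1 := (hF.mem_Icc ha hz).1
      have h2 : 0 ≤ 2 / ε ^ α * (1 - z) ^ α :=
        mul_nonneg hC (Real.rpow_nonneg (by linarith [hz.2]) α)
      rw [pow_zero]; linarith
    | succ j ih =>
      intro z hz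
      rcases hz.2.eq_or_lt with rfl | hz1
      · rw [hF.map_one, sub_self, Real.zero_rpow hα.ne']
        positivity
      obtain ⟨n, hs, hn | ⟨hn, hneg⟩⟩ := exists_first_large (ε := ε) ha hz1
      · have := fairCdf_sub_le_of_large ha hr h hα hq hε0 hz.1 hz.2 le_rfl hs hn
        rw [hF.map_one] at this
        have h2 : (0 : ℝ) ≤ (1 / 2) ^ (j + 1) := by positivity
        linarith
      · obtain ⟨hmem, hlen⟩ := iterate_of_same_side ha hz.2 hs
        have hsmall : ∀ w ∈ Icc z 1, |(tent a)^[n] w| ≤ ε := by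
          intro w hw
          have hzw : |(tent a)^[n] z - (tent a)^[n] 1| ≤ ε := by
            rw [hlen z ⟨le_rfl, hz.2⟩ 1 ⟨hz.2, le_rfl⟩, abs_sub_comm,
              abs_of_nonneg (by linarith : (0 : ℝ) ≤ 1 - z)]
            exact hn
          have hzw' := abs_le.1 hzw
          rcases mul_neg_iff.1 hneg with ⟨h1, h2⟩ | ⟨h1, h2⟩ <;>
          rcases mem_uIcc.1 (hmem w hw) with ⟨h3, h4⟩ | ⟨h3, h4⟩ <;>
          exact abs_le.2 ⟨by linarith, by linarith⟩
        have hvis : ∀ w ∈ Icc z 1, visits a w n ≤ n / r := by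
          intro w hw
          rw [Nat.le_div_iff_mul_le (by omega), mul_comm]
          refine h.visits_mul_le_of_near_one ha hr hε1 (by linarith [hcr a har]) (t := 1 - z) ?_ hn
            (hsmall w hw) (hsmall 1 ⟨hz.2, le_rfl⟩)
          rw [abs_sub_comm, abs_of_nonneg (by linarith [hw.2])]
          linarith [hw.1]
        have key := fairCdf_sub_mul_le_of_crossing ha hα hq (decayRate_le_two hr) hC ih hz.1 hz.2
          le_rfl hs (hn.trans hε1) hneg hvis
        rw [hF.map_one] at key
        have hpow := two_pow_mul_decayRate_le hr (Nat.mul_div_le n r)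
        -- the crossing occurs at time at least two
        have hn2 : 2 ≤ n := by
          by_contra hlt
          have h1 := (hsmall 1 ⟨hz.2, le_rfl⟩).trans hε1
          have h1' := abs_le.1 h1
          obtain rfl | rfl : n = 0 ∨ n = 1 := by omega
          · rw [Function.iterate_zero, id] at h1'; linarith [h1'.2]
          · rw [Function.iterate_one, tent_one] at h1'; linarith [h1'.1]
        have hq2 : 2 ≤ decayRate r ^ n := by
          exact (two_le_decayRate_sq hr).trans (pow_le_pow_right₀ (one_le_decayRate hr) hn2)
        set X := 2 / ε ^ α * (decayRate r ^ n * (1 - z) ^ α) + (1 / 2) ^ j with hX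
        have hX0 : 0 ≤ X := by
          have : 0 ≤ (1 - z) ^ α := Real.rpow_nonneg (by linarith) α
          positivity
        have e1 : (1 - fairCdf a z) * decayRate r ^ n ≤ X := by
          have hp : (0 : ℝ) < 2 ^ n := by positivity
          refine le_of_mul_le_mul_right ?_ hp
          calc (1 - fairCdf a z) * decayRate r ^ n * 2 ^ n
              = (1 - fairCdf a z) * 2 ^ n * decayRate r ^ n := by ring
            _ ≤ 2 ^ (n / r) * X * decayRate r ^ n :=
              mul_le_mul_of_nonneg_right key (by positivity)
            _ = (2 ^ (n / r) * decayRate r ^ n) * X := by ring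
            _ ≤ 2 ^ n * X := mul_le_mul_of_nonneg_right hpow hX0
            _ = X * 2 ^ n := mul_comm _ _
        have hdn : 0 < decayRate r ^ n := by positivity
        refine le_of_mul_le_mul_right (e1.trans ?_) hdn
        have hj : (0 : ℝ) < (1 / 2) ^ j := by positivity
        rw [hX, pow_succ]
        nlinarith
  intro z hz
  refine le_of_forall_pos_le_add fun δ hδ => ?_
  obtain ⟨j, hj⟩ := exists_pow_lt_of_lt_one hδ (by norm_num : (1 / 2 : ℝ) < 1)
  linarith [main j z hz]

/-- The distribution functions are Hölder continuous, uniformly in the parameter. -/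
theorem exists_fairCdf_sub_le {r : ℕ} (hr : 2 ≤ r) {α : ℝ} (hα : 0 < α) :
    ∃ C ≥ 0, ∀ a ∈ Icc (√2) 2, windowParam r ≤ a → a ^ α ≤ decayRate r →
      ∀ x y, 1 - a ≤ x → x ≤ y → y ≤ 1 → fairCdf a y - fairCdf a x ≤ C * (y - x) ^ α := by
  obtain ⟨ε, hε, hε1, hK⟩ := exists_one_sub_fairCdf_le hr
  have hC : 0 ≤ 2 / ε ^ α := by positivity
  refine ⟨2 * (2 / ε ^ α), by positivity, fun a ha har hq x y hx hxy hy => ?_⟩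
  have h := IsLongRun.of_windowParam_le hr har
  have hd := decayRate_pos r
  rcases hxy.eq_or_lt with rfl | hlt
  · rw [sub_self, sub_self, Real.zero_rpow hα.ne', mul_zero]
  have hxα : 0 ≤ (y - x) ^ α := Real.rpow_nonneg (by linarith) α
  obtain ⟨n, hs, hn | ⟨hn, hneg⟩⟩ := exists_first_large (ε := ε) ha hlt
  · have := fairCdf_sub_le_of_large ha hr h hα hq hε hx hxy hy hs hn
    nlinarith [mul_nonneg hC hxα]
  · obtain ⟨m, hm, hv⟩ := h.exists_visits_bound ha hr n
    have key := fairCdf_sub_mul_le_of_crossing (δ := 0) ha hα hq (decayRate_le_two hr) hC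
      (fun z hz => by simpa using hK a ha har α hα hq z hz) hx hxy hy hs (hn.trans hε1) hneg
      fun z _ => hv z
    rw [add_zero] at key
    have hpow := two_pow_mul_decayRate_le' hr hm
    have hp : (0 : ℝ) < 2 ^ n := by positivity
    refine le_of_mul_le_mul_right (key.trans ?_) hp
    calc 2 ^ m * (2 / ε ^ α * (decayRate r ^ n * (y - x) ^ α))
        = (2 ^ m * decayRate r ^ n) * (2 / ε ^ α * (y - x) ^ α) := by ring
      _ ≤ 2 * 2 ^ n * (2 / ε ^ α * (y - x) ^ α) :=
        mul_le_mul_of_nonneg_right hpow (by positivity)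
      _ = _ := by ring

/-! ### Hölder continuity of the fair entropy -/

lemma abs_critOrbit_sub_le {a a' b : ℝ} (ha : a ∈ Icc (√2) 2) (ha' : a' ∈ Icc (√2) 2) (hb : a ≤ b)
    (n : ℕ) : |critOrbit a' n - critOrbit a n| + 5 / 2 * |a' - a| ≤ 5 / 2 * b ^ n * |a' - a| := by
  have h0 := (param_bounds ha).1
  induction n with
  | zero => simp [critOrbit]
  | succ n ih =>
    rw [critOrbit_succ, critOrbit_succ]
    have e : tent a' (critOrbit a' n) - tent a (critOrbit a n) =
        (tent a (critOrbit a' n) - tent a (critOrbit a n)) - (a' - a) * |critOrbit a' n| := by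
      unfold tent; ring
    have h1 := abs_tent_sub_le ha (critOrbit a' n) (critOrbit a n)
    have h2 := abs_le_one_of_mem ha' (critOrbit_mem ha' n)
    have h3 : |(a' - a) * (|critOrbit a' n|)| ≤ |a' - a| := by
      rw [abs_mul, abs_abs]
      exact mul_le_of_le_one_right (abs_nonneg _) h2
    have h4 := abs_sub (tent a (critOrbit a' n) - tent a (critOrbit a n))
      ((a' - a) * |critOrbit a' n|)
    have h5 : a * |critOrbit a' n - critOrbit a n| ≤ b * |critOrbit a' n - critOrbit a n| :=
      mul_le_mul_of_nonneg_right hb (abs_nonneg _)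
    have h6 := mul_le_mul_of_nonneg_left ih (show 0 ≤ b by linarith)
    have h7 : 7 / 5 * |a' - a| ≤ b * |a' - a| :=
      mul_le_mul_of_nonneg_right (by linarith) (abs_nonneg _)
    rw [e, pow_succ]
    linarith

lemma samePiece_or {a a' : ℝ} (x x' : ℝ) : SamePiece a x a' x' ∨ (x < 0 ∧ 0 < x') ∨
    (x' < 0 ∧ 0 < x) ∨ (0 ≤ x ∧ x ≤ a - 1 ∧ a' - 1 < x') ∨ (0 ≤ x' ∧ x' ≤ a' - 1 ∧ a - 1 < x) := by
  unfold SamePiece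
  rcases lt_or_ge x 0 with h1 | h1
  · rcases le_or_gt x' 0 with h2 | h2
    · exact Or.inl (Or.inl ⟨h1.le, h2⟩)
    · exact Or.inr (Or.inl ⟨h1, h2⟩)
  rcases lt_or_ge x' 0 with h2 | h2
  · rcases h1.eq_or_lt with h3 | h3
    · exact Or.inl (Or.inl ⟨h3.ge, h2.le⟩)
    · exact Or.inr (Or.inr (Or.inl ⟨h2, h3⟩))
  rcases le_or_gt x (a - 1) with h3 | h3 <;> rcases le_or_gt x' (a' - 1) with h4 | h4
  · exact Or.inl (Or.inr (Or.inl ⟨h1, h3, h2, h4⟩))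
  · exact Or.inr (Or.inr (Or.inr (Or.inl ⟨h1, h3, h4⟩)))
  · exact Or.inr (Or.inr (Or.inr (Or.inr ⟨h2, h4, h3⟩)))
  · exact Or.inl (Or.inr (Or.inr ⟨h3, h4⟩))

/-- The critical orbits of two parameters with different fair entropies visit different pieces at
some time. -/
lemma exists_not_samePiece {a a' : ℝ} (ha : a ∈ Icc (√2) 2) (ha' : a' ∈ Icc (√2) 2)
    (h : fairCdf a' 0 ≠ fairCdf a 0) :
    ∃ k, 3 ≤ k ∧ ¬ SamePiece a (critOrbit a k) a' (critOrbit a' k) := by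
  by_contra hall
  push Not at hall
  have hF := isFairCdf_fairCdf ha
  have hF' := isFairCdf_fairCdf ha'
  have hpos : 0 < |fairCdf a' 0 - fairCdf a 0| := abs_pos.2 (sub_ne_zero.2 h)
  obtain ⟨m, hm⟩ := pow_unbounded_of_one_lt (1 / |fairCdf a' 0 - fairCdf a 0|)
    (one_lt_two (α := ℝ))
  have key := hF.amplify ha ha' hF' (2 * m) fun k h3 _ => hall k h3
  have hv := (isLongRun_two ha).visits_mul_le ha (by norm_num) (2 * m) (critOrbit a 4)
  have hv' : visits a (critOrbit a 4) (2 * m) ≤ m := by omega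
  have h2 : (2 : ℝ) ^ visits a (critOrbit a 4) (2 * m) ≤ 2 ^ m :=
    pow_le_pow_right₀ one_le_two hv'
  have m1 := hF.mem_Icc ha (critOrbit_mem ha (4 + 2 * m))
  have m2 := hF'.mem_Icc ha' (critOrbit_mem ha' (4 + 2 * m))
  have h3 : |fairCdf a' (critOrbit a' (4 + 2 * m)) - fairCdf a (critOrbit a (4 + 2 * m))| ≤ 1 :=
    abs_le.2 ⟨by linarith [m1.2, m2.1], by linarith [m1.1, m2.2]⟩
  rw [div_lt_iff₀ hpos] at hm
  have hpm : (0 : ℝ) < 2 ^ m := by positivity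
  have h4 : (|fairCdf a' (critOrbit a' (4 + 2 * m)) - fairCdf a (critOrbit a (4 + 2 * m))|
      - 2 * |fairCdf a' 0 - fairCdf a 0|) * 2 ^ visits a (critOrbit a 4) (2 * m) ≤ 1 * 2 ^ m :=
    (mul_le_mul_of_nonneg_right (by linarith) (by positivity)).trans
      (mul_le_mul_of_nonneg_left h2 zero_le_one)
  rw [show (2 : ℝ) ^ (2 * m) = 2 ^ m * 2 ^ m by rw [two_mul, pow_add]] at key
  nlinarith

/-- When the pieces differ, the difference of the images under the two distribution functions is
almost that of the images of the separating points: `F' 0 - F 0` if these are the turning points,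
`2 (F' 0 - F 0)` if these are `a - 1` and `a' - 1`. -/
lemma abs_fairCdf_sub_le_of_not_samePiece {a a' α C x x' : ℝ} (ha : a ∈ Icc (√2) 2)
    (ha' : a' ∈ Icc (√2) 2) (hα : 0 < α) (hC : 0 ≤ C)
    (hH : ∀ x y, 1 - a ≤ x → x ≤ y → y ≤ 1 → fairCdf a y - fairCdf a x ≤ C * (y - x) ^ α)
    (hH' : ∀ x y, 1 - a' ≤ x → x ≤ y → y ≤ 1 → fairCdf a' y - fairCdf a' x ≤ C * (y - x) ^ α)
    (hx : x ∈ Icc (1 - a) 1) (hx' : x' ∈ Icc (1 - a') 1) (hne : ¬ SamePiece a x a' x') :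
    (((x < 0 ∧ 0 < x') ∨ (x' < 0 ∧ 0 < x)) ∧
      |(fairCdf a' x' - fairCdf a x) - (fairCdf a' 0 - fairCdf a 0)| ≤
        2 * C * (|x' - x| + |a' - a|) ^ α) ∨
    ((a - 1 < x ∨ a' - 1 < x') ∧
      |(fairCdf a' x' - fairCdf a x) - 2 * (fairCdf a' 0 - fairCdf a 0)| ≤
        2 * C * (|x' - x| + |a' - a|) ^ α) := by
  have hb := param_bounds ha
  have hb' := param_bounds ha'
  have hF := isFairCdf_fairCdf ha
  have hF' := isFairCdf_fairCdf ha'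
  have hs := hF.map_sub_one ha
  have hs' := hF'.map_sub_one ha'
  have mono : ∀ {u}, 0 ≤ u → u ≤ |x' - x| + |a' - a| →
      C * u ^ α ≤ C * (|x' - x| + |a' - a|) ^ α := fun h0 hu =>
    mul_le_mul_of_nonneg_left (Real.rpow_le_rpow h0 hu hα.le) hC
  have n1 := abs_nonneg (a' - a)
  have n2 := le_abs_self (a' - a)
  have n3 := neg_abs_le (a' - a)
  have n4 := le_abs_self (x' - x)
  have n5 := neg_abs_le (x' - x)
  have mono1 : ∀ {u v}, 1 - a ≤ u → u ≤ v → v ≤ 1 → 0 ≤ fairCdf a v - fairCdf a u :=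
    fun h1 h2 h3 => by
      rw [← measureReal_Icc_eq_fairCdf_sub ha h2]; exact measureReal_nonneg
  have mono2 : ∀ {u v}, 1 - a' ≤ u → u ≤ v → v ≤ 1 → 0 ≤ fairCdf a' v - fairCdf a' u :=
    fun h1 h2 h3 => by
      rw [← measureReal_Icc_eq_fairCdf_sub ha' h2]; exact measureReal_nonneg
  rcases (samePiece_or x x').resolve_left hne with ⟨h1, h2⟩ | ⟨h1, h2⟩ | ⟨h1, h2, h3⟩ | ⟨h1, h2, h3⟩
  · left
    refine ⟨Or.inl ⟨h1, h2⟩, ?_⟩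
    have e1 := hH x 0 hx.1 h1.le zero_le_one
    have e2 := hH' 0 x' (by linarith) h2.le hx'.2
    have e3 := mono (u := 0 - x) (by linarith) (by linarith)
    have e4 := mono (u := x' - 0) (by linarith) (by linarith)
    have e5 := mono1 hx.1 h1.le zero_le_one
    have e6 := mono2 (by linarith) h2.le hx'.2
    exact abs_le.2 ⟨by linarith, by linarith⟩
  · left
    refine ⟨Or.inr ⟨h1, h2⟩, ?_⟩
    have e1 := hH' x' 0 hx'.1 h1.le zero_le_one
    have e2 := hH 0 x (by linarith) h2.le hx.2
    have e3 := mono (u := 0 - x') (by linarith) (by linarith)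
    have e4 := mono (u := x - 0) (by linarith) (by linarith)
    have e5 := mono2 hx'.1 h1.le zero_le_one
    have e6 := mono1 (by linarith) h2.le hx.2
    exact abs_le.2 ⟨by linarith, by linarith⟩
  · right
    refine ⟨Or.inr h3, ?_⟩
    have e1 := hH x (a - 1) hx.1 h2 (by linarith)
    have e2 := hH' (a' - 1) x' (by linarith) h3.le hx'.2
    have e3 := mono (u := a - 1 - x) (by linarith) (by linarith)
    have e4 := mono (u := x' - (a' - 1)) (by linarith) (by linarith)
    have e5 := mono1 hx.1 h2 (by linarith)
    have e6 := mono2 (by linarith) h3.le hx'.2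
    exact abs_le.2 ⟨by linarith, by linarith⟩
  · right
    refine ⟨Or.inl h3, ?_⟩
    have e1 := hH' x' (a' - 1) hx'.1 h2 (by linarith)
    have e2 := hH (a - 1) x (by linarith) h3.le hx.2
    have e3 := mono (u := a' - 1 - x') (by linarith) (by linarith)
    have e4 := mono (u := x - (a - 1)) (by linarith) (by linarith)
    have e5 := mono2 hx'.1 h2 (by linarith)
    have e6 := mono1 (by linarith) h3.le hx.2
    exact abs_le.2 ⟨by linarith, by linarith⟩

theorem exists_abs_fairCdf_zero_sub_le {r : ℕ} (hr : 2 ≤ r) {b : ℝ} (hrb : windowParam r < b)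
    (hb2 : b ≤ 2) : ∃ C ≥ 0, ∀ a ∈ Icc (windowParam r) b, ∀ a' ∈ Icc (windowParam r) b,
      |fairCdf a' 0 - fairCdf a 0| ≤ C * |a' - a| ^ holderExponent r b := by
  have hw := (windowParam_spec hr).1
  have hb1 : 7 / 5 < b := (param_bounds hw).1.trans hrb
  set α := holderExponent r b with hαdef
  have hα : 0 < α := holderExponent_pos hr (by linarith)
  have hbα : b ^ α = decayRate r := rpow_holderExponent hr (by linarith)
  obtain ⟨C, hC, hH⟩ := exists_fairCdf_sub_le hr hα
  have hK : 0 ≤ C * (7 / 2 : ℝ) ^ α := by positivity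
  refine ⟨16 * (C * (7 / 2) ^ α), by positivity, fun a har a' har' => ?_⟩
  have mem : ∀ {a}, a ∈ Icc (windowParam r) b → a ∈ Icc (√2) 2 ∧ a ^ α ≤ decayRate r :=
    fun {a} h => ⟨⟨hw.1.trans h.1, h.2.trans hb2⟩, by
      rw [← hbα]
      exact Real.rpow_le_rpow (by linarith [(param_bounds hw).1, h.1]) h.2 hα.le⟩
  obtain ⟨ha, hq⟩ := mem har
  obtain ⟨ha', hq'⟩ := mem har'
  have hδ : 0 ≤ |a' - a| ^ α := Real.rpow_nonneg (abs_nonneg _) α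
  by_cases h0 : fairCdf a' 0 = fairCdf a 0
  · rw [h0, sub_self, abs_zero]; positivity
  classical
  have hex := exists_not_samePiece ha ha' h0
  set N := Nat.find hex with hN
  obtain ⟨hN3, hNne⟩ := Nat.find_spec hex
  have hmin : ∀ k, 3 ≤ k → k < N → SamePiece a (critOrbit a k) a' (critOrbit a' k) := by
    intro k h3 hk
    have := Nat.find_min hex hk
    push Not at this
    exact this h3
  rw [← hN] at hN3 hNne
  have hF := isFairCdf_fairCdf ha
  have hF' := isFairCdf_fairCdf ha'
  have hd := decayRate_pos r
  have hcases := abs_fairCdf_sub_le_of_not_samePiece ha ha' hα hC (hH a ha har.1 hq)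
    (hH a' ha' har'.1 hq') (critOrbit_mem ha N) (critOrbit_mem ha' N) hNne
  set d := fairCdf a' (critOrbit a' N) - fairCdf a (critOrbit a N) with hdd
  set h := fairCdf a' 0 - fairCdf a 0 with hh
  have hE : 2 * C * (|critOrbit a' N - critOrbit a N| + |a' - a|) ^ α ≤
      2 * (C * (7 / 2) ^ α * |a' - a| ^ α) * decayRate r ^ N := by
    have h1 := abs_critOrbit_sub_le ha ha' har.2 N
    have h2 : 1 ≤ b ^ N := one_le_pow₀ (by linarith)
    have h3 : |critOrbit a' N - critOrbit a N| + |a' - a| ≤ b ^ N * (7 / 2 * |a' - a|) := by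
      nlinarith [abs_nonneg (a' - a)]
    have h4 := (Real.rpow_le_rpow (by positivity) h3 hα.le).trans
      (pow_mul_rpow_le (by linarith) hbα.le (by positivity) N)
    rw [Real.mul_rpow (by norm_num) (abs_nonneg _)] at h4
    have := mul_le_mul_of_nonneg_left h4 (show 0 ≤ 2 * C by linarith)
    linarith
  set K := C * (7 / 2) ^ α * |a' - a| ^ α with hKdef
  have hK0 : 0 ≤ K := by positivity
  have hq2 := decayRate_le_two hr
  have hgoal : 16 * (C * (7 / 2) ^ α) * |a' - a| ^ α = 16 * K := by rw [hKdef]; ring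
  rw [hgoal]
  rcases Nat.eq_or_lt_of_le hN3 with h3 | h3
  · -- at time three only the turning point can separate the two orbits
    have hd3 : d = -2 * h := by
      rw [hdd, ← h3, critOrbit_succ a 2, critOrbit_succ a' 2, critOrbit_two, critOrbit_two,
        hF.nonpos _ ⟨le_rfl, by linarith [(param_bounds ha).1]⟩,
        hF'.nonpos _ ⟨le_rfl, by linarith [(param_bounds ha').1]⟩, hF.map_left, hF'.map_left, hh]
      ring
    rcases hcases with ⟨-, h4⟩ | ⟨h4, -⟩
    · rw [hd3, show -2 * h - h = -(3 * h) by ring, abs_neg, abs_mul,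
        abs_of_pos (by norm_num : (0 : ℝ) < 3)] at h4
      have h5 : decayRate r ^ N ≤ 8 := by
        rw [← h3]
        exact (pow_le_pow_left₀ hd.le hq2 3).trans (by norm_num)
      have h6 := mul_le_mul_of_nonneg_left h5 hK0
      linarith
    · rw [← h3] at h4
      rcases h4 with h4 | h4
      · linarith [critOrbit_three_le ha]
      · linarith [critOrbit_three_le ha']
  · have hd2 : |d| - 2 * |h| ≤ 2 * K * decayRate r ^ N := by
      have h5 := abs_nonneg h
      rcases hcases with ⟨-, h4⟩ | ⟨-, h4⟩
      · have := abs_sub_abs_le_abs_sub d h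
        linarith
      · have := abs_sub_abs_le_abs_sub d (2 * h)
        rw [abs_mul, abs_two] at this
        linarith
    obtain ⟨n, hn⟩ := Nat.exists_eq_add_of_le h3
    rw [show 3 + 1 + n = 4 + n by omega] at hn
    have key := hF.amplify ha ha' hF' n fun k h3 hk => hmin k h3 (by omega)
    rw [← hn, ← hdd, ← hh] at key
    have hv := (IsLongRun.of_windowParam_le hr har.1).visits_mul_le ha (by omega) n (critOrbit a 4)
    have hpow := two_pow_mul_decayRate_le' hr hv
    have e1 := key.trans (mul_le_mul_of_nonneg_right hd2 (by positivity))
    have hp : (0 : ℝ) < 2 ^ n := by positivity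
    have hdn : 0 < decayRate r ^ n := by positivity
    have e2 : 4 * |h| * 2 ^ n ≤ 4 * K * decayRate r ^ 4 * 2 ^ n := by
      refine e1.trans ?_
      rw [hn, pow_add]
      have := mul_le_mul_of_nonneg_left hpow (show 0 ≤ 2 * K * decayRate r ^ 4 by positivity)
      linarith
    have e3 := le_of_mul_le_mul_right e2 hp
    have h5 : decayRate r ^ 4 ≤ 16 := (pow_le_pow_left₀ hd.le hq2 4).trans (by norm_num)
    have h6 := mul_le_mul_of_nonneg_left h5 hK0
    linarith

lemma isHolderOn_iff {α : ℝ} (hα : 0 ≤ α) {f : ℝ → ℝ} {s : Set ℝ} :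
    IsHolderOn α f s ↔ ∃ C ≥ 0, ∀ x ∈ s, ∀ y ∈ s, |f y - f x| ≤ C * |y - x| ^ α := by
  constructor
  · rintro ⟨C, hC⟩
    refine ⟨C, C.2, fun x hx y hy => ?_⟩
    have := hC.dist_le hy hx
    rwa [Real.dist_eq, Real.dist_eq, Real.coe_toNNReal α hα] at this
  · rintro ⟨C, hC, h⟩
    refine ⟨C.toNNReal, fun x hx y hy => ?_⟩
    have h1 := h y hy x hx
    rw [← Real.dist_eq, ← Real.dist_eq] at h1
    rw [edist_dist, edist_dist, ENNReal.ofReal_rpow_of_nonneg dist_nonneg (NNReal.coe_nonneg _),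
      Real.coe_toNNReal α hα, ENNReal.ofNNReal_toNNReal, ← ENNReal.ofReal_mul hC]
    exact ENNReal.ofReal_le_ofReal h1

theorem isHolderOn_fairEntropy {r : ℕ} (hr : 2 ≤ r) {b : ℝ} (hrb : windowParam r < b)
    (hb2 : b ≤ 2) : IsHolderOn (holderExponent r b) fairEntropy (Icc (windowParam r) b) := by
  have hw := (windowParam_spec hr).1
  have hb1 : 7 / 5 < b := (param_bounds hw).1.trans hrb
  rw [isHolderOn_iff (holderExponent_pos hr (by linarith)).le]
  obtain ⟨C, hC, h⟩ := exists_abs_fairCdf_zero_sub_le hr hrb hb2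
  refine ⟨C, hC, fun a ha a' ha' => ?_⟩
  rw [fairEntropy_eq ⟨hw.1.trans ha.1, ha.2.trans hb2⟩,
    fairEntropy_eq ⟨hw.1.trans ha'.1, ha'.2.trans hb2⟩]
  exact h a ha a' ha'

lemma holderExponent_two_two : holderExponent 2 2 = 1 / 2 := by
  have := Real.log_pos one_lt_two
  unfold holderExponent
  field_simp
  norm_num

/-! ### Dependence of the critical orbit on the parameter -/

lemma continuous_critOrbit (n : ℕ) : Continuous fun a => critOrbit a n := by
  induction n with
  | zero => simpa [critOrbit] using continuous_const
  | succ n ih =>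
    simp only [critOrbit_succ, tent]
    exact continuous_const.sub (continuous_id.mul ih.abs)

lemma abs_critOrbit_succ_sub {s t : ℝ} (n : ℕ) (hn : 0 ≤ critOrbit s n * critOrbit t n) :
    |critOrbit t (n + 1) - critOrbit s (n + 1)| =
      |t * (critOrbit t n - critOrbit s n) + (t - s) * critOrbit s n| := by
  rw [critOrbit_succ, critOrbit_succ]
  rcases mul_nonneg_iff.1 hn with ⟨h1, h2⟩ | ⟨h1, h2⟩
  · rw [tent_of_nonneg h1, tent_of_nonneg h2, ← abs_neg]
    congr 1; ring
  · rw [tent_of_nonpos h1, tent_of_nonpos h2]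
    congr 1; ring

lemma le_abs_critOrbit_succ_sub {s t : ℝ} (hs : s ∈ Icc (√2) 2) (ht : t ∈ Icc (√2) 2) (hst : s ≤ t)
    (n : ℕ) (hn : 0 ≤ critOrbit s n * critOrbit t n) :
    t * |critOrbit t n - critOrbit s n| - (t - s) ≤
      |critOrbit t (n + 1) - critOrbit s (n + 1)| := by
  have ht1 := (param_bounds ht).1
  rw [abs_critOrbit_succ_sub n hn]
  have h1 := abs_sub_abs_le_abs_add (t * (critOrbit t n - critOrbit s n)) ((t - s) * critOrbit s n)
  have h2 : |(t - s) * critOrbit s n| ≤ t - s := by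
    rw [abs_mul, abs_of_nonneg (sub_nonneg.2 hst)]
    exact mul_le_of_le_one_right (sub_nonneg.2 hst) (abs_le_one_of_mem hs (critOrbit_mem hs n))
  rw [abs_mul, abs_of_pos (show 0 < t by linarith)] at h1
  linarith

lemma critOrbit_three_sub {s t : ℝ} (hs : s ∈ Icc (√2) 2) (ht : t ∈ Icc (√2) 2) :
    critOrbit t 3 - critOrbit s 3 = -((s + t - 1) * (t - s)) := by
  rw [critOrbit_three hs, critOrbit_three ht]; ring

/-- The first steps of the expansion in parameter space. -/
lemma abs_critOrbit_sub_four_five {s t : ℝ} (hs : s ∈ Icc (√2) 2) (ht : t ∈ Icc (√2) 2)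
    (hst : s ≤ t) (h3 : 0 ≤ critOrbit s 3 * critOrbit t 3) :
    t - s ≤ |critOrbit t 4 - critOrbit s 4| ∧ (0 ≤ critOrbit s 4 * critOrbit t 4 →
      63 / 25 * (t - s) ≤ |critOrbit t 5 - critOrbit s 5|) := by
  obtain ⟨s1, s2, s3⟩ := param_bounds hs
  obtain ⟨t1, t2, t3⟩ := param_bounds ht
  have hδ := sub_nonneg.2 hst
  have e3 := critOrbit_three_sub hs ht
  have e4 := abs_critOrbit_succ_sub 3 h3
  rw [e3] at e4
  norm_num only at e4
  rcases mul_nonneg_iff.1 h3 with ⟨h1, h2⟩ | ⟨h1, h2⟩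
  · have c3 := critOrbit_three hs
    have c3' := critOrbit_three ht
    have c4 : critOrbit s 4 = 1 - s * critOrbit s 3 := by
      rw [critOrbit_succ s 3, tent_of_nonneg h1]
    have c4' : critOrbit t 4 = 1 - t * critOrbit t 3 := by
      rw [critOrbit_succ t 3, tent_of_nonneg h2]
    set x := critOrbit s 3 with hx
    have hd4 : critOrbit t 4 - critOrbit s 4 = (t * (s + t - 1) - x) * (t - s) := by
      rw [c4, c4']; linear_combination (-t) * e3
    have hq : s * (2 * s - 1) ≤ t * (s + t - 1) := by nlinarith
    have hx1 : x ≤ s - 1 := critOrbit_three_le hs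
    have h4s : 0 ≤ critOrbit s 4 := by
      rw [c4]; nlinarith
    have h4t : 0 ≤ critOrbit t 4 := by
      have := critOrbit_three_le ht
      rw [c4']; nlinarith
    have hpos : 1 ≤ t * (s + t - 1) - x := by nlinarith
    constructor
    · rw [hd4, abs_of_nonneg (mul_nonneg (by linarith) hδ)]
      nlinarith
    · intro _
      have e5 := abs_critOrbit_succ_sub 4 (mul_nonneg h4s h4t)
      norm_num only at e5
      rw [e5, hd4, show t * ((t * (s + t - 1) - x) * (t - s)) + (t - s) * critOrbit s 4 =
        (t * (t * (s + t - 1) - x) + critOrbit s 4) * (t - s) by ring]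
      have : 63 / 25 ≤ t * (t * (s + t - 1) - x) + critOrbit s 4 := by
        have e6 : s * (s * (2 * s - 1) - x) ≤ t * (t * (s + t - 1) - x) :=
          mul_le_mul hst (by linarith) (by nlinarith) (by linarith)
        have e7 : 63 / 25 ≤ s * (s * (2 * s - 1) - x) + critOrbit s 4 := by
          rw [c4, c3]
          nlinarith [mul_nonneg (show 0 ≤ s - 7 / 5 by linarith) (show 0 ≤ s - 7 / 5 by linarith)]
        linarith
      rw [abs_of_nonneg (mul_nonneg (by linarith) hδ)]
      exact mul_le_mul_of_nonneg_right this hδ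
  · have h4 : 63 / 25 * (t - s) ≤ |critOrbit t 4 - critOrbit s 4| := by
      rw [e4, show t * -((s + t - 1) * (t - s)) + (t - s) * critOrbit s 3 =
        -((t * (s + t - 1) - critOrbit s 3) * (t - s)) by ring, abs_neg]
      have : 63 / 25 ≤ t * (s + t - 1) - critOrbit s 3 := by nlinarith
      rw [abs_of_nonneg (mul_nonneg (by linarith) hδ)]
      exact mul_le_mul_of_nonneg_right this hδ
    refine ⟨by linarith, fun h => ?_⟩
    have h5 := le_abs_critOrbit_succ_sub hs ht hst 4 h
    norm_num only at h5
    nlinarith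

/-- As long as two critical orbits stay on the same side of the turning point, they separate
exponentially. -/
lemma mul_le_abs_critOrbit_sub {s t : ℝ} (hs : s ∈ Icc (√2) 2) (ht : t ∈ Icc (√2) 2)
    (hst : s ≤ t) {n : ℕ} (hn : 5 ≤ n)
    (h : ∀ k, 2 ≤ k → k < n → 0 ≤ critOrbit s k * critOrbit t k) :
    (5 / 2 + s ^ (n - 5) / 50) * (t - s) ≤ |critOrbit t n - critOrbit s n| := by
  obtain ⟨s1, s2, s3⟩ := param_bounds hs
  have hδ := sub_nonneg.2 hst
  induction n, hn using Nat.le_induction with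
  | base =>
    have := (abs_critOrbit_sub_four_five hs ht hst (h 3 (by omega) (by omega))).2
      (h 4 (by omega) (by omega))
    norm_num at this ⊢
    linarith
  | succ n hn ih =>
    have ih' := ih fun k h2 hk => h k h2 (by omega)
    have h1 := le_abs_critOrbit_succ_sub hs ht hst n (h n (by omega) (by omega))
    refine le_trans ?_ h1
    rw [show n + 1 - 5 = (n - 5) + 1 by omega, pow_succ]
    have hp : 0 ≤ s ^ (n - 5) := by positivity
    have h2 := mul_le_mul_of_nonneg_left ih' (show 0 ≤ t by linarith)
    have h3 : s * ((5 / 2 + s ^ (n - 5) / 50) * (t - s)) ≤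
        t * ((5 / 2 + s ^ (n - 5) / 50) * (t - s)) :=
      mul_le_mul_of_nonneg_right hst (by positivity)
    have h4 : 7 / 5 * (t - s) ≤ s * (t - s) := mul_le_mul_of_nonneg_right s1.le hδ
    linarith

lemma critOrbit_ne_of_same_signs {s t : ℝ} (hs : s ∈ Icc (√2) 2) (ht : t ∈ Icc (√2) 2)
    (hst : s < t) {n : ℕ} (hn : 2 ≤ n)
    (h : ∀ k, 2 ≤ k → k < n → 0 ≤ critOrbit s k * critOrbit t k) :
    critOrbit t n ≠ critOrbit s n := by
  obtain ⟨s1, s2, s3⟩ := param_bounds hs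
  have hδ := sub_pos.2 hst
  suffices 0 < |critOrbit t n - critOrbit s n| from sub_ne_zero.1 (abs_pos.1 this)
  rcases Nat.lt_or_ge n 5 with hlt | hge
  · obtain rfl | rfl | rfl : n = 2 ∨ n = 3 ∨ n = 4 := by omega
    · rw [critOrbit_two, critOrbit_two, abs_pos]; linarith
    · rw [critOrbit_three_sub hs ht, abs_neg]
      exact abs_pos.2 (mul_pos (by linarith) hδ).ne'
    · exact hδ.trans_le (abs_critOrbit_sub_four_five hs ht hst.le (h 3 (by omega) (by omega))).1
  · refine lt_of_lt_of_le ?_ (mul_le_abs_critOrbit_sub hs ht hst.le hge h)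
    positivity

/-- For the parameters in `[s, t]` the critical orbits do not cross the turning point strictly
before time `n`. -/
def NoCrossing (s t : ℝ) (n : ℕ) : Prop :=
  ∀ k, 2 ≤ k → k < n → ∀ u ∈ Icc s t, ∀ v ∈ Icc s t, 0 ≤ critOrbit u k * critOrbit v k

lemma NoCrossing.mono {s t s' t' : ℝ} {n : ℕ} (h : NoCrossing s t n) (h' : Icc s' t' ⊆ Icc s t) :
    NoCrossing s' t' n :=
  fun k h2 hk u hu v hv => h k h2 hk u (h' hu) v (h' hv)

lemma NoCrossing.succ {s t : ℝ} {n : ℕ} (h : NoCrossing s t n)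
    (h' : ∀ u ∈ Icc s t, ∀ v ∈ Icc s t, 0 ≤ critOrbit u n * critOrbit v n) :
    NoCrossing s t (n + 1) := by
  intro k h2 hk
  rcases Nat.lt_succ_iff_lt_or_eq.1 hk with hk | rfl
  · exact h k h2 hk
  · exact h'

/-- A parameter interval can be continued one step, or it is divided into two such intervals by a
parameter for which the turning point is periodic. -/
lemma NoCrossing.split {s t : ℝ} (hs : √2 ≤ s) (hst : s < t) (ht : t ≤ 2) {n : ℕ} (hn : 2 ≤ n)
    (h : NoCrossing s t n) : NoCrossing s t (n + 1) ∨
      ∃ z ∈ Ioo s t, critOrbit z n = 0 ∧ NoCrossing s z (n + 1) ∧ NoCrossing z t (n + 1) := by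
  have hsub : Icc s t ⊆ Icc (√2) 2 := Icc_subset_Icc hs ht
  have hinj : InjOn (fun a => critOrbit a n) (Icc s t) := by
    intro u hu v hv huv
    by_contra hne
    rcases lt_or_gt_of_ne hne with hlt | hlt
    · exact critOrbit_ne_of_same_signs (hsub hu) (hsub hv) hlt hn
        (fun k h2 hk => h k h2 hk u hu v hv) huv.symm
    · exact critOrbit_ne_of_same_signs (hsub hv) (hsub hu) hlt hn
        (fun k h2 hk => h k h2 hk v hv u hu) huv
  by_cases hall : ∀ u ∈ Icc s t, ∀ v ∈ Icc s t, 0 ≤ critOrbit u n * critOrbit v n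
  · exact Or.inl (h.succ hall)
  right
  push Not at hall
  obtain ⟨u, hu, v, hv, huv⟩ := hall
  have hcont := (continuous_critOrbit n).continuousOn (s := uIcc u v)
  have h0 : (0 : ℝ) ∈ uIcc (critOrbit u n) (critOrbit v n) := by
    rcases mul_neg_iff.1 huv with ⟨h1, h2⟩ | ⟨h1, h2⟩
    · exact mem_uIcc.2 (Or.inr ⟨h2.le, h1.le⟩)
    · exact mem_uIcc.2 (Or.inl ⟨h1.le, h2.le⟩)
  obtain ⟨z, hz, hz0⟩ := intermediate_value_uIcc hcont h0
  dsimp only at hz0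
  have hzu : z ≠ u := by rintro rfl; simp [hz0] at huv
  have hzv : z ≠ v := by rintro rfl; simp [hz0] at huv
  have hzI : z ∈ Ioo s t := by
    rcases mem_uIcc.1 hz with ⟨h1, h2⟩ | ⟨h1, h2⟩
    · exact ⟨hu.1.trans_lt (lt_of_le_of_ne h1 hzu.symm), (lt_of_le_of_ne h2 hzv).trans_le hv.2⟩
    · exact ⟨hv.1.trans_lt (lt_of_le_of_ne h1 hzv.symm), (lt_of_le_of_ne h2 hzu).trans_le hu.2⟩
  have hzc := Ioo_subset_Icc_self hzI
  have hl : Icc s z ⊆ Icc s t := Icc_subset_Icc le_rfl hzI.2.le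
  have hr : Icc z t ⊆ Icc s t := Icc_subset_Icc hzI.1.le le_rfl
  refine ⟨z, hzI, hz0, (h.mono hl).succ ?_, (h.mono hr).succ ?_⟩ <;>
  rcases (continuous_critOrbit n).continuousOn.strictMonoOn_of_injOn_Icc' hst.le hinj with hm | hm <;>
  intro u hu v hv
  · have h1 := hm.monotoneOn (hl hu) hzc hu.2
    have h2 := hm.monotoneOn (hl hv) hzc hv.2
    rw [hz0] at h1 h2
    exact mul_nonneg_of_nonpos_of_nonpos h1 h2
  · have h1 := hm.antitoneOn (hl hu) hzc hu.2
    have h2 := hm.antitoneOn (hl hv) hzc hv.2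
    rw [hz0] at h1 h2
    exact mul_nonneg h1 h2
  · have h1 := hm.monotoneOn hzc (hr hu) hu.1
    have h2 := hm.monotoneOn hzc (hr hv) hv.1
    rw [hz0] at h1 h2
    exact mul_nonneg h1 h2
  · have h1 := hm.antitoneOn hzc (hr hu) hu.1
    have h2 := hm.antitoneOn hzc (hr hv) hv.1
    rw [hz0] at h1 h2
    exact mul_nonneg_of_nonpos_of_nonpos h1 h2

/-! ### A periodic orbit with the maximal frequency of visits -/

/-- The negative point of period `r` whose orbit visits `(a - 1, 1]` once per period and is
negative otherwise. -/
noncomputable def leftPeriodicPoint (r : ℕ) (a : ℝ) : ℝ := critOrbit a r / (1 + a ^ r)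

section

variable {r : ℕ} {a : ℝ}

lemma leftPeriodicPoint_mul (ha : a ∈ Icc (√2) 2) :
    leftPeriodicPoint r a * (1 + a ^ r) = critOrbit a r := by
  have := (param_bounds ha).1
  have : 0 < 1 + a ^ r := by positivity
  rw [leftPeriodicPoint, div_mul_cancel₀ _ this.ne']

lemma leftPeriodicPoint_neg (ha : a ∈ Icc (√2) 2) (hr : 2 ≤ r) (h : IsLongRun r a) :
    leftPeriodicPoint r a < 0 := by
  have := (param_bounds ha).1
  exact div_neg_of_neg_of_pos (h.1 r hr le_rfl) (by positivity)

lemma critOrbit_sub_neg (ha : a ∈ Icc (√2) 2) (hr : 2 ≤ r) (h : IsLongRun r a) {j : ℕ} (h2 : 2 ≤ j)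
    (hj : j ≤ r) : critOrbit a j - a ^ j * leftPeriodicPoint r a < 0 := by
  have hb := (param_bounds ha).1
  obtain ⟨i, rfl⟩ := Nat.exists_eq_add_of_le hj
  clear hj
  have hmul := leftPeriodicPoint_mul (r := j + i) ha
  have hneg := leftPeriodicPoint_neg ha hr h
  set y := leftPeriodicPoint (j + i) a
  have key : ∀ m ≤ i, critOrbit a (j + i - m) - a ^ (j + i - m) * y < 0 := by
    intro m
    induction m with
    | zero => intro _; rw [Nat.sub_zero]; linarith
    | succ m ih =>
      intro hm
      have h1 := ih (by omega)
      rw [show j + i - m = (j + i - (m + 1)) + 1 by omega, critOrbit_succ,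
        tent_of_nonpos (h.1 _ (by omega) (by omega)).le, pow_succ] at h1
      have h3 : a * (critOrbit a (j + i - (m + 1)) - a ^ (j + i - (m + 1)) * y) < 0 := by linarith
      exact neg_of_mul_neg_right h3 (by linarith)
  have := key i le_rfl
  rwa [Nat.add_sub_cancel] at this

lemma lt_tent_leftPeriodicPoint (ha : a ∈ Icc (√2) 2) (hr : 2 ≤ r) (h : IsLongRun r a)
    (hw : a - 1 < 1 + a * critOrbit a (r + 1)) : a - 1 < 1 + a * leftPeriodicPoint r a := by
  have hb := (param_bounds ha).1
  have hmul := leftPeriodicPoint_mul (r := r) ha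
  set y := leftPeriodicPoint r a
  by_contra hle
  have key : ∀ j, 2 ≤ j → j ≤ r → critOrbit a (j + 1) ≤ critOrbit a j - a ^ j * y := by
    intro j h2
    induction j, h2 using Nat.le_induction with
    | base =>
      intro _
      rw [critOrbit_two, critOrbit_three ha]
      nlinarith
    | succ j h2 ih =>
      intro hj
      have h1 := ih (by omega)
      rw [critOrbit_succ a (j + 1), tent_of_nonpos (h.1 (j + 1) (by omega) hj).le, critOrbit_succ a j,
        tent_of_nonpos (h.1 j h2 (by omega)).le, pow_succ]
      rw [critOrbit_succ a j, tent_of_nonpos (h.1 j h2 (by omega)).le] at h1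
      have := mul_le_mul_of_nonneg_left h1 (show 0 ≤ a by linarith)
      linarith
  have h1 := key r hr le_rfl
  have h2 : critOrbit a (r + 1) ≤ y := by linarith
  nlinarith

lemma iterate_leftPeriodicPoint (ha : a ∈ Icc (√2) 2) (hr : 2 ≤ r) (h : IsLongRun r a)
    (hw : a - 1 < 1 + a * critOrbit a (r + 1)) {j : ℕ} (h2 : 2 ≤ j) (hj : j ≤ r) :
    (tent a)^[j] (leftPeriodicPoint r a) = critOrbit a j - a ^ j * leftPeriodicPoint r a := by
  have hb := (param_bounds ha).1
  have hneg := leftPeriodicPoint_neg ha hr h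
  have hR := lt_tent_leftPeriodicPoint ha hr h hw
  induction j, h2 using Nat.le_induction with
  | base =>
    rw [Function.iterate_succ_apply', Function.iterate_one, tent_of_nonpos hneg.le,
      tent_of_nonneg (by linarith), critOrbit_two]
    ring
  | succ j h2 ih =>
    rw [Function.iterate_succ_apply', ih (by omega),
      tent_of_nonpos (critOrbit_sub_neg ha hr h h2 (by omega)).le, critOrbit_succ,
      tent_of_nonpos (h.1 j h2 (by omega)).le, pow_succ]
    ring

lemma isPeriodicPt_leftPeriodicPoint (ha : a ∈ Icc (√2) 2) (hr : 2 ≤ r) (h : IsLongRun r a)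
    (hw : a - 1 < 1 + a * critOrbit a (r + 1)) :
    Function.IsPeriodicPt (tent a) r (leftPeriodicPoint r a) := by
  rw [Function.IsPeriodicPt, Function.IsFixedPt, iterate_leftPeriodicPoint ha hr h hw hr le_rfl]
  linarith [leftPeriodicPoint_mul (r := r) ha]

lemma iterate_leftPeriodicPoint_neg_or (ha : a ∈ Icc (√2) 2) (hr : 2 ≤ r) (h : IsLongRun r a)
    (hw : a - 1 < 1 + a * critOrbit a (r + 1)) (k : ℕ) :
    (tent a)^[k] (leftPeriodicPoint r a) < 0 ∨ a - 1 < (tent a)^[k] (leftPeriodicPoint r a) := by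
  rw [← (isPeriodicPt_leftPeriodicPoint ha hr h hw).iterate_mod_apply]
  have hneg := leftPeriodicPoint_neg ha hr h
  have hk := Nat.mod_lt k (show 0 < r by omega)
  generalize k % r = j at hk
  rcases Nat.lt_or_ge j 2 with hj | hj
  · obtain rfl | rfl : j = 0 ∨ j = 1 := by omega
    · exact Or.inl hneg
    · right
      rw [Function.iterate_one, tent_of_nonpos hneg.le]
      exact lt_tent_leftPeriodicPoint ha hr h hw
  · left
    rw [iterate_leftPeriodicPoint ha hr h hw hj hk.le]
    exact critOrbit_sub_neg ha hr h hj hk.le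

lemma le_visits_leftPeriodicPoint (ha : a ∈ Icc (√2) 2) (hr : 2 ≤ r) (h : IsLongRun r a)
    (hw : a - 1 < 1 + a * critOrbit a (r + 1)) (n : ℕ) :
    n + 1 ≤ r * visits a (leftPeriodicPoint r a) n + r := by
  induction n using Nat.strong_induction_on with
  | _ n ih =>
    rcases Nat.lt_or_ge n r with hn | hn
    · omega
    · have h1 : 1 ≤ visits a (leftPeriodicPoint r a) r := by
        obtain ⟨m, rfl⟩ : ∃ m, r = 2 + m := ⟨r - 2, by omega⟩
        have e : a - 1 < (tent a)^[1] (leftPeriodicPoint (2 + m) a) := by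
          rw [Function.iterate_one, tent_of_nonpos (leftPeriodicPoint_neg ha hr h).le]
          exact lt_tent_leftPeriodicPoint ha hr h hw
        rw [visits_add, visits_succ, if_pos e]
        omega
      have h2 := ih (n - r) (by omega)
      have h3 : visits a (leftPeriodicPoint r a) n =
          visits a (leftPeriodicPoint r a) r + visits a (leftPeriodicPoint r a) (n - r) := by
        conv_lhs => rw [show n = r + (n - r) by omega, visits_add,
          (isPeriodicPt_leftPeriodicPoint ha hr h hw).eq]
      rw [h3, mul_add]
      have := Nat.mul_le_mul_left r h1
      omega

end

/-! ### Parameters whose critical orbit is eventually periodic -/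

lemma mem_of_window {r : ℕ} (hr : 2 ≤ r) {a : ℝ} (h : windowParam r ≤ a)
    (h' : a < windowParam (r + 1)) : a ∈ Icc (√2) 2 ∧ IsLongRun r a ∧
      a - 1 < 1 + a * critOrbit a (r + 1) := by
  have ha : a ∈ Icc (√2) 2 := ⟨(windowParam_spec hr).1.1.trans h,
    h'.le.trans (windowParam_spec (show 2 ≤ r + 1 by omega)).1.2⟩
  exact ⟨ha, IsLongRun.of_windowParam_le hr h, lt_critOrbit_of_lt_windowParam hr ha h h'⟩

/-- Every parameter interval between two consecutive window parameters contains a parameter for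
which the critical orbit falls on the orbit of `leftPeriodicPoint`. Otherwise no `c_n` would pass
through `±leftPeriodicPoint` on the interval, so that a crossing of the turning point at time `n`
forces `c_{n+1} > 0 > c_{n+2}` on the whole interval. Then the loss by bisecting the interval at
every crossing is outweighed by the expansion in the three or more steps between two crossings. -/
theorem exists_critOrbit_eq_leftPeriodicPoint {r : ℕ} (hr : 2 ≤ r) {x₀ x₁ : ℝ}
    (h₀ : windowParam r ≤ x₀) (hx : x₀ < x₁) (h₁ : x₁ < windowParam (r + 1)) :
    ∃ a ∈ Icc x₀ x₁, ∃ n, 2 ≤ n ∧ critOrbit a n = leftPeriodicPoint r a := by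
  by_contra hno
  push Not at hno
  have hI : ∀ a ∈ Icc x₀ x₁, a ∈ Icc (√2) 2 ∧ IsLongRun r a ∧
      a - 1 < 1 + a * critOrbit a (r + 1) := fun a ha =>
    mem_of_window hr (h₀.trans ha.1) (ha.2.trans_lt h₁)
  have hx₀ := (hI x₀ ⟨le_rfl, hx.le⟩).1
  have hx₁ := (hI x₁ ⟨hx.le, le_rfl⟩).1
  have hne : ∀ n, 2 ≤ n → ∀ a ∈ Icc x₀ x₁, |critOrbit a n| ≠ |leftPeriodicPoint r a| := by
    intro n hn a ha habs
    obtain ⟨ha2, hl, hw⟩ := hI a ha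
    refine hno a ha (n + r) (by omega) ?_
    have e1 : critOrbit a (n + 1) = tent a (leftPeriodicPoint r a) := by
      rw [critOrbit_succ, tent, habs, tent]
    have e2 := (isPeriodicPt_leftPeriodicPoint ha2 hr hl hw).eq
    obtain ⟨m, rfl⟩ : ∃ m, r = m + 1 := ⟨r - 1, by omega⟩
    rw [show n + (m + 1) = n + 1 + m by omega, ← iterate_critOrbit, e1,
      ← Function.iterate_succ_apply]
    exact e2
  have hcontY : ContinuousOn (leftPeriodicPoint r) (Icc x₀ x₁) := by
    refine (continuous_critOrbit r).continuousOn.div (by fun_prop) fun a ha => ?_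
    have := (param_bounds (hI a ha).1).1
    positivity
  have hlt : ∀ n, 2 ≤ n → ∀ z ∈ Icc x₀ x₁, critOrbit z n = 0 → ∀ a ∈ Icc x₀ x₁,
      |critOrbit a n| < |leftPeriodicPoint r a| := by
    intro n hn z hz hz0 a ha
    by_contra hle
    have hsub : uIcc z a ⊆ Icc x₀ x₁ := uIcc_subset_Icc hz ha
    have hc : ContinuousOn (fun u => |critOrbit u n| - |leftPeriodicPoint r u|) (uIcc z a) :=
      ((continuous_critOrbit n).abs.continuousOn.sub hcontY.abs).mono hsub
    have hzneg : |critOrbit z n| - |leftPeriodicPoint r z| ≤ 0 := by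
      rw [hz0, abs_zero]; linarith [abs_nonneg (leftPeriodicPoint r z)]
    obtain ⟨w, hw, hw0⟩ := intermediate_value_uIcc hc
      (mem_uIcc.2 (Or.inl ⟨hzneg, sub_nonneg.2 (not_lt.1 hle)⟩))
    exact hne n hn w (hsub hw) (sub_eq_zero.1 hw0)
  have hnext : ∀ n, 2 ≤ n → ∀ z ∈ Icc x₀ x₁, critOrbit z n = 0 → ∀ a ∈ Icc x₀ x₁,
      0 < critOrbit a (n + 1) ∧ critOrbit a (n + 2) < 0 := by
    intro n hn z hz hz0 a ha
    obtain ⟨ha2, hl, hw⟩ := hI a ha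
    have hb := (param_bounds ha2).1
    have h1 := hlt n hn z hz hz0 a ha
    have hneg := leftPeriodicPoint_neg ha2 hr hl
    have hR := lt_tent_leftPeriodicPoint ha2 hr hl hw
    have h2 := critOrbit_sub_neg ha2 hr hl le_rfl hr
    rw [abs_of_neg hneg] at h1
    rw [critOrbit_two] at h2
    have e1 : 1 + a * leftPeriodicPoint r a < critOrbit a (n + 1) := by
      rw [critOrbit_succ, tent]
      nlinarith
    have h3 : 0 < critOrbit a (n + 1) := by linarith
    refine ⟨h3, ?_⟩
    rw [show n + 2 = (n + 1) + 1 by omega, critOrbit_succ, tent_of_nonneg h3.le]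
    nlinarith
  have hstate : ∀ n, 2 ≤ n → ∃ s t, x₀ ≤ s ∧ s < t ∧ t ≤ x₁ ∧ NoCrossing s t n := by
    intro n hn
    induction n, hn using Nat.le_induction with
    | base => exact ⟨x₀, x₁, le_rfl, hx, le_rfl, fun k h2 hk => by omega⟩
    | succ n hn ih =>
      obtain ⟨s, t, h1, h2, h3, h4⟩ := ih
      rcases h4.split (hx₀.1.trans h1) h2 (h3.trans hx₁.2) hn with h5 | ⟨z, hz, -, h5, -⟩
      · exact ⟨s, t, h1, h2, h3, h5⟩
      · exact ⟨s, z, h1, hz.1, hz.2.le.trans h3, h5⟩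
  obtain ⟨m, hm⟩ := pow_unbounded_of_one_lt (2500 : ℝ) (show (1 : ℝ) < 7 / 5 by norm_num)
  have hsep : ∀ n, 5 + m ≤ n → ∀ s t, x₀ ≤ s → s < t → t ≤ x₁ → NoCrossing s t n →
      50 * (t - s) ≤ |critOrbit t n - critOrbit s n| := by
    intro n hn s t h1 h2 h3 h4
    have hs : s ∈ Icc (√2) 2 := (hI s ⟨h1, h2.le.trans h3⟩).1
    have ht : t ∈ Icc (√2) 2 := (hI t ⟨h1.trans h2.le, h3⟩).1
    refine le_trans ?_ (mul_le_abs_critOrbit_sub hs ht h2.le (show 5 ≤ n by omega)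
      fun k h5 h6 => h4 k h5 h6 s ⟨le_rfl, h2.le⟩ t ⟨h2.le, le_rfl⟩)
    have hb := (param_bounds hs).1
    have h5 : (7 / 5 : ℝ) ^ m ≤ s ^ (n - 5) :=
      (pow_le_pow_left₀ (by norm_num) hb.le m).trans
        (pow_le_pow_right₀ (by linarith) (by omega))
    exact mul_le_mul_of_nonneg_right (by linarith) (by linarith)
  have hgrow : ∀ n, 5 + m ≤ n → ∀ s t, x₀ ≤ s → s < t → t ≤ x₁ → NoCrossing s t (n + 1) →
      69 / 50 * |critOrbit t n - critOrbit s n| ≤ |critOrbit t (n + 1) - critOrbit s (n + 1)| := by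
    intro n hn s t h1 h2 h3 h4
    have hs : s ∈ Icc (√2) 2 := (hI s ⟨h1, h2.le.trans h3⟩).1
    have ht : t ∈ Icc (√2) 2 := (hI t ⟨h1.trans h2.le, h3⟩).1
    have h5 := hsep n hn s t h1 h2 h3 fun k h5 h6 => h4 k h5 (by omega)
    have h6 := le_abs_critOrbit_succ_sub hs ht h2.le n
      (h4 n (by omega) (by omega) s ⟨le_rfl, h2.le⟩ t ⟨h2.le, le_rfl⟩)
    have hb := (param_bounds ht).1
    nlinarith [abs_nonneg (critOrbit t n - critOrbit s n)]
  obtain ⟨s₀, t₀, hs₀, hst₀, ht₀, hN₀⟩ := hstate (5 + m) (by omega)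
  have hpos := (mul_pos (by norm_num : (0 : ℝ) < 50) (sub_pos.2 hst₀)).trans_le
    (hsep _ le_rfl s₀ t₀ hs₀ hst₀ ht₀ hN₀)
  set L := |critOrbit t₀ (5 + m) - critOrbit s₀ (5 + m)|
  have main : ∀ i : ℕ, ∃ n, 5 + m ≤ n ∧ ∃ s t, x₀ ≤ s ∧ s < t ∧ t ≤ x₁ ∧ NoCrossing s t n ∧
      L * (11 / 10) ^ i ≤ |critOrbit t n - critOrbit s n| := by
    intro i
    induction i with
    | zero => exact ⟨5 + m, le_rfl, s₀, t₀, hs₀, hst₀, ht₀, hN₀, by rw [pow_zero, mul_one]⟩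
    | succ i ih =>
      obtain ⟨n, hn, s, t, h1, h2, h3, h4, h5⟩ := ih
      have hpi : 0 < L * (11 / 10) ^ i := by positivity
      rw [pow_succ]
      rcases h4.split (hx₀.1.trans h1) h2 (h3.trans hx₁.2) (by omega) with h6 | ⟨z, hz, hz0, h6, h7⟩
      · have := hgrow n hn s t h1 h2 h3 h6
        exact ⟨n + 1, by omega, s, t, h1, h2, h3, h6, by linarith⟩
      have hzI : z ∈ Icc x₀ x₁ := ⟨h1.trans hz.1.le, hz.2.le.trans h3⟩
      have hsigns := hnext n (by omega) z hzI hz0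
      -- one of the two halves retains half of the length
      obtain ⟨s', t', h1', h2', h3', h6', h5'⟩ : ∃ s' t', x₀ ≤ s' ∧ s' < t' ∧ t' ≤ x₁ ∧
          NoCrossing s' t' (n + 1) ∧
          1 / 2 * (L * (11 / 10) ^ i) ≤ |critOrbit t' n - critOrbit s' n| := by
        have htri := abs_sub_le (critOrbit t n) (critOrbit z n) (critOrbit s n)
        rcases le_total (|critOrbit t n - critOrbit z n|) (|critOrbit z n - critOrbit s n|) with h | h
        · exact ⟨s, z, h1, hz.1, hzI.2, h6, by linarith⟩
        · exact ⟨z, t, hzI.1, hz.2, h3, h7, by linarith⟩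
      have hsub : Icc s' t' ⊆ Icc x₀ x₁ := Icc_subset_Icc h1' h3'
      have h8 : NoCrossing s' t' (n + 1 + 1) := h6'.succ fun u hu v hv =>
        (mul_pos (hsigns u (hsub hu)).1 (hsigns v (hsub hv)).1).le
      have h9 : NoCrossing s' t' (n + 1 + 1 + 1) := h8.succ fun u hu v hv =>
        (mul_pos_of_neg_of_neg (hsigns u (hsub hu)).2 (hsigns v (hsub hv)).2).le
      have g1 := hgrow n hn s' t' h1' h2' h3' h6'
      have g2 := hgrow (n + 1) (by omega) s' t' h1' h2' h3' h8
      have g3 := hgrow (n + 1 + 1) (by omega) s' t' h1' h2' h3' h9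
      exact ⟨n + 1 + 1 + 1, by omega, s', t', h1', h2', h3', h9, by linarith⟩
  obtain ⟨i, hi⟩ := pow_unbounded_of_one_lt (2 / L) (show (1 : ℝ) < 11 / 10 by norm_num)
  obtain ⟨n, -, s, t, h1, h2, h3, -, h5⟩ := main i
  rw [div_lt_iff₀ hpos] at hi
  have hs : s ∈ Icc (√2) 2 := (hI s ⟨h1, h2.le.trans h3⟩).1
  have ht : t ∈ Icc (√2) 2 := (hI t ⟨h1.trans h2.le, h3⟩).1
  have b1 := abs_le_one_of_mem hs (critOrbit_mem hs n)
  have b2 := abs_le_one_of_mem ht (critOrbit_mem ht n)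
  have b3 := abs_sub (critOrbit t n) (critOrbit s n)
  linarith

/-! ### Lower bounds for the variation of the fair entropy -/

lemma IsFairCdf.map_tent {a : ℝ} {F : ℝ → ℝ} (ha : a ∈ Icc (√2) 2) (hF : IsFairCdf a F) {x : ℝ}
    (hx : x ∈ Icc (1 - a) 1) :
    F (tent a x) = min (2 * F x + 1 - 2 * F 0) (max (1 - 2 * F x + 2 * F 0) (1 - F x)) := by
  have hb := param_bounds ha
  have h0 := hF.mem_Icc ha (zero_mem_interval ha)
  have hx0 := hF.mem_Icc ha hx
  have hs := hF.map_sub_one ha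
  have ms : a - 1 ∈ Icc (1 - a) 1 := ⟨by linarith, by linarith⟩
  rcases le_total x 0 with h | h
  · have h1 := hF.monotoneOn hx (zero_mem_interval ha) h
    rw [hF.nonpos x ⟨hx.1, h⟩, min_eq_left (le_max_of_le_left (by linarith))]
  · have h1 := hF.monotoneOn (zero_mem_interval ha) hx h
    rcases le_total x (a - 1) with h' | h'
    · have h2 := hF.monotoneOn hx ms h'
      rw [hF.center x ⟨h, h'⟩, max_eq_left (by linarith), min_eq_right (by linarith)]
    · have h2 := hF.monotoneOn ms hx h'
      rw [hF.right x ⟨h', hx.2⟩, max_eq_right (by linarith [h0.1]),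
        min_eq_right (by linarith [h0.1])]

lemma IsFairCdf.abs_sub_tent_le {a a' : ℝ} {F F' : ℝ → ℝ} (ha : a ∈ Icc (√2) 2)
    (ha' : a' ∈ Icc (√2) 2) (hF : IsFairCdf a F) (hF' : IsFairCdf a' F') {x x' : ℝ}
    (hx : x ∈ Icc (1 - a) 1) (hx' : x' ∈ Icc (1 - a') 1) :
    |F' (tent a' x') - F (tent a x)| ≤ 2 * |F' x' - F x| + 2 * |F' 0 - F 0| := by
  rw [hF.map_tent ha hx, hF'.map_tent ha' hx']
  have h1 := abs_le.1 (le_refl |F' x' - F x|)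
  have h2 := abs_le.1 (le_refl |F' 0 - F 0|)
  have h3 := abs_nonneg (F' x' - F x)
  have h4 := abs_nonneg (F' 0 - F 0)
  refine (abs_min_sub_min_le_max _ _ _ _).trans (max_le ?_
    ((abs_max_sub_max_le_max _ _ _ _).trans (max_le ?_ ?_))) <;>
  exact abs_le.2 ⟨by linarith [h1.1, h1.2, h2.1, h2.2], by linarith [h1.1, h1.2, h2.1, h2.2]⟩

lemma IsFairCdf.abs_sub_add_le {a a' : ℝ} {F F' : ℝ → ℝ} (ha : a ∈ Icc (√2) 2)
    (ha' : a' ∈ Icc (√2) 2) (hF : IsFairCdf a F) (hF' : IsFairCdf a' F') {n : ℕ} (hn : 1 ≤ n) :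
    |F' (critOrbit a' n) - F (critOrbit a n)| + 2 * |F' 0 - F 0| ≤ 2 ^ n * |F' 0 - F 0| := by
  induction n, hn using Nat.le_induction with
  | base =>
    rw [critOrbit_one, critOrbit_one, hF.map_one, hF'.map_one, sub_self, abs_zero]
    linarith
  | succ n hn ih =>
    have := hF.abs_sub_tent_le ha ha' hF' (critOrbit_mem ha n) (critOrbit_mem ha' n)
    rw [critOrbit_succ, critOrbit_succ, pow_succ]
    linarith

/-- A counterpart of `IsFairCdf.amplify`: differences of distribution functions along the critical
orbits do not increase at visits to `(a - 1, 1]`. -/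
lemma IsFairCdf.abs_sub_add_mul_le {a a' : ℝ} {F F' : ℝ → ℝ} (ha : a ∈ Icc (√2) 2)
    (ha' : a' ∈ Icc (√2) 2) (hF : IsFairCdf a F) (hF' : IsFairCdf a' F') {m : ℕ} (hm : 1 ≤ m)
    (n : ℕ) (hs : ∀ k, m ≤ k → k < m + n → SamePiece a (critOrbit a k) a' (critOrbit a' k)) :
    (|F' (critOrbit a' (m + n)) - F (critOrbit a (m + n))| + 2 * |F' 0 - F 0|) *
      2 ^ visits a (critOrbit a m) n ≤ 2 ^ n * (2 ^ m * |F' 0 - F 0|) := by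
  induction n with
  | zero => simpa [visits_zero] using hF.abs_sub_add_le ha ha' hF' hm
  | succ n ih =>
    have ih' := ih fun k h1 h2 => hs k h1 (by omega)
    have mx := critOrbit_mem ha (m + n)
    have mx' := critOrbit_mem ha' (m + n)
    have hp : (0 : ℝ) < 2 ^ visits a (critOrbit a m) n := by positivity
    rw [visits_succ, iterate_critOrbit, ← Nat.add_assoc, critOrbit_succ, critOrbit_succ,
      pow_succ 2 n]
    by_cases hR : a - 1 < critOrbit a (m + n)
    · have hR' : a' - 1 < critOrbit a' (m + n) := by
        have hb := param_bounds ha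
        rcases hs (m + n) (by omega) (by omega) with ⟨h1, -⟩ | ⟨-, h1, -⟩ | ⟨-, h1⟩
        · linarith
        · linarith
        · exact h1
      rw [if_pos hR, pow_succ, hF.right _ ⟨hR.le, mx.2⟩, hF'.right _ ⟨hR'.le, mx'.2⟩, ← abs_neg,
        show -(1 - F' (critOrbit a' (m + n)) - (1 - F (critOrbit a (m + n)))) =
          F' (critOrbit a' (m + n)) - F (critOrbit a (m + n)) by ring]
      linarith
    · rw [if_neg hR, add_zero]
      have h1 := mul_le_mul_of_nonneg_right (hF.abs_sub_tent_le ha ha' hF' mx mx') hp.le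
      linarith

/-- When the pieces differ, one of the two distances to the separating points is seen in the
difference of the distribution functions. -/
lemma IsFairCdf.le_abs_sub_add_of_not_samePiece {a a' κ x x' : ℝ} {F F' : ℝ → ℝ}
    (ha : a ∈ Icc (√2) 2) (ha' : a' ∈ Icc (√2) 2) (hF : IsFairCdf a F) (hF' : IsFairCdf a' F')
    (hx : x ∈ Icc (1 - a) 1) (hx' : x' ∈ Icc (1 - a') 1) (hne : ¬ SamePiece a x a' x')
    (hκ : κ ≤ |F x - F 0|) (hκ' : κ ≤ |F x - 2 * F 0|) :
    κ ≤ |F' x' - F x| + 2 * |F' 0 - F 0| := by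
  have hb := param_bounds ha
  have hb' := param_bounds ha'
  have hs := hF.map_sub_one ha
  have hs' := hF'.map_sub_one ha'
  have m0 := zero_mem_interval ha
  have m0' := zero_mem_interval ha'
  have ms : a - 1 ∈ Icc (1 - a) 1 := ⟨by linarith, by linarith⟩
  have ms' : a' - 1 ∈ Icc (1 - a') 1 := ⟨by linarith, by linarith⟩
  have n1 := le_abs_self (F' x' - F x)
  have n2 := neg_abs_le (F' x' - F x)
  have n3 := le_abs_self (F' 0 - F 0)
  have n4 := neg_abs_le (F' 0 - F 0)
  have n5 := abs_nonneg (F' 0 - F 0)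
  rcases (samePiece_or x x').resolve_left hne with ⟨h1, h2⟩ | ⟨h1, h2⟩ | ⟨h1, h2, h3⟩ | ⟨h1, h2, h3⟩
  · have e1 := hF.monotoneOn hx m0 h1.le
    have e2 := hF'.monotoneOn m0' hx' h2.le
    rw [abs_of_nonpos (by linarith)] at hκ
    linarith
  · have e1 := hF.monotoneOn m0 hx h2.le
    have e2 := hF'.monotoneOn hx' m0' h1.le
    rw [abs_of_nonneg (by linarith)] at hκ
    linarith
  · have e1 := hF.monotoneOn hx ms h2
    have e2 := hF'.monotoneOn ms' hx' h3.le
    rw [abs_of_nonpos (by linarith)] at hκ'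
    linarith
  · have e1 := hF.monotoneOn ms hx h3.le
    have e2 := hF'.monotoneOn hx' ms' h2
    rw [abs_of_nonneg (by linarith)] at hκ'
    linarith

lemma SamePiece.mul_nonneg {a a' x x' : ℝ} (ha : a ∈ Icc (√2) 2) (ha' : a' ∈ Icc (√2) 2)
    (h : SamePiece a x a' x') : 0 ≤ x * x' := by
  have hb := param_bounds ha
  have hb' := param_bounds ha'
  rcases h with ⟨h1, h2⟩ | ⟨h1, -, h2, -⟩ | ⟨h1, h2⟩
  · exact mul_nonneg_of_nonpos_of_nonpos h1 h2
  · exact _root_.mul_nonneg h1 h2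
  · exact _root_.mul_nonneg (by linarith) (by linarith)

lemma pow_mul_abs_sub_le {s t x₀ : ℝ} (hs : s ∈ Icc (√2) 2) (ht : t ∈ Icc (√2) 2)
    (hx₀ : x₀ ∈ Icc (√2) 2) (h₀s : x₀ ≤ s) (h₀t : x₀ ≤ t) {n : ℕ}
    (h : ∀ k, 2 ≤ k → k < n → 0 ≤ critOrbit s k * critOrbit t k) :
    x₀ ^ n * |t - s| ≤ 3200 := by
  wlog hst : s ≤ t generalizing s t
  · rw [abs_sub_comm]
    exact this ht hs h₀t h₀s (fun k h2 hk => by rw [mul_comm]; exact h k h2 hk) (le_of_not_ge hst)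
  have hb := param_bounds hs
  have hb' := param_bounds ht
  have hb0 := param_bounds hx₀
  have hδ := sub_nonneg.2 hst
  rw [abs_of_nonneg hδ]
  have h5 : x₀ ^ 5 ≤ 32 := (pow_le_pow_left₀ (by linarith) hb0.2.1 5).trans (by norm_num)
  rcases Nat.lt_or_ge n 5 with hn | hn
  · have h6 : x₀ ^ n ≤ x₀ ^ 5 := pow_le_pow_right₀ (by linarith) hn.le
    have h7 : x₀ ^ n * (t - s) ≤ 32 * 1 :=
      mul_le_mul (h6.trans h5) (by linarith) hδ (by norm_num)
    linarith
  · have key := mul_le_abs_critOrbit_sub hs ht hst hn h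
    have b1 := abs_le_one_of_mem hs (critOrbit_mem hs n)
    have b2 := abs_le_one_of_mem ht (critOrbit_mem ht n)
    have b3 := abs_sub (critOrbit t n) (critOrbit s n)
    have h6 : x₀ ^ (n - 5) ≤ s ^ (n - 5) := pow_le_pow_left₀ (by linarith) h₀s _
    have h7 := mul_le_mul_of_nonneg_right h6 hδ
    have h8 : x₀ ^ (n - 5) * (t - s) ≤ 100 := by linarith
    have h9 : 0 ≤ x₀ ^ (n - 5) * (t - s) := by
      have : 0 ≤ x₀ := by linarith
      positivity
    have h10 := mul_le_mul h5 h8 h9 (by norm_num)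
    rw [← mul_assoc, ← pow_add, show 5 + (n - 5) = n by omega] at h10
    linarith

/-- The periodic orbit of `leftPeriodicPoint` stays away from the separating points `0` and `a - 1`,
also in terms of the fair measure. -/
lemma exists_le_abs_fairCdf_iterate_sub {r : ℕ} {a : ℝ} (ha : a ∈ Icc (√2) 2) (hr : 2 ≤ r)
    (h : IsLongRun r a) (hw : a - 1 < 1 + a * critOrbit a (r + 1))
    (hy : leftPeriodicPoint r a ∈ Icc (1 - a) 1) :
    ∃ κ > 0, ∀ k, κ ≤ |fairCdf a ((tent a)^[k] (leftPeriodicPoint r a)) - fairCdf a 0| ∧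
      κ ≤ |fairCdf a ((tent a)^[k] (leftPeriodicPoint r a)) - 2 * fairCdf a 0| := by
  have hb := param_bounds ha
  have hF := isFairCdf_fairCdf ha
  have hm := fairCdf_strictMonoOn ha
  have hs := hF.map_sub_one ha
  have m0 := zero_mem_interval ha
  have ms : a - 1 ∈ Icc (1 - a) 1 := ⟨by linarith, by linarith⟩
  have h0s := hm m0 ms (by linarith)
  set y := leftPeriodicPoint r a with hydef
  let g : ℕ → ℝ := fun k => min |fairCdf a ((tent a)^[k] y) - fairCdf a 0|
    |fairCdf a ((tent a)^[k] y) - 2 * fairCdf a 0|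
  have hg : ∀ k, 0 < g k := by
    intro k
    have hk := iterate_mem ha hy k
    rcases iterate_leftPeriodicPoint_neg_or ha hr h hw k with h1 | h1
    · have := hm hk m0 h1
      exact lt_min (abs_pos.2 (by linarith)) (abs_pos.2 (by linarith))
    · have := hm ms hk h1
      exact lt_min (abs_pos.2 (by linarith)) (abs_pos.2 (by linarith))
  obtain ⟨k₀, -, hk₀⟩ := (Finset.range r).exists_min_image g ⟨0, Finset.mem_range.2 (by omega)⟩
  refine ⟨g k₀, hg k₀, fun k => ?_⟩
  have h1 := hk₀ (k % r) (Finset.mem_range.2 (Nat.mod_lt k (by omega)))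
  rw [← (isPeriodicPt_leftPeriodicPoint ha hr h hw).iterate_mod_apply k]
  exact ⟨h1.trans (min_le_left _ _), h1.trans (min_le_right _ _)⟩

/-- In every parameter interval between two consecutive window parameters there is a parameter at
which the local Hölder exponent is at most `holderExponent r x₀`. -/
theorem exists_mul_rpow_le_abs_fairCdf_zero_sub {r : ℕ} (hr : 2 ≤ r) {x₀ x₁ : ℝ}
    (h₀ : windowParam r ≤ x₀) (hx : x₀ < x₁) (h₁ : x₁ < windowParam (r + 1)) :
    ∃ a ∈ Icc x₀ x₁, ∃ c > 0, ∃ ρ > 0, ∀ a' ∈ Icc x₀ x₁, a' ≠ a → |a' - a| < ρ →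
      c * |a' - a| ^ holderExponent r x₀ ≤ |fairCdf a' 0 - fairCdf a 0| := by
  obtain ⟨a, haI, m, hm, hland⟩ := exists_critOrbit_eq_leftPeriodicPoint hr h₀ hx h₁
  obtain ⟨ha, hl, hw⟩ := mem_of_window hr (h₀.trans haI.1) (haI.2.trans_lt h₁)
  have hx₀ := (mem_of_window hr h₀ (hx.trans h₁)).1
  have hb := param_bounds ha
  have hb₀ := param_bounds hx₀
  have hF := isFairCdf_fairCdf ha
  have horbit : ∀ k, critOrbit a (m + k) = (tent a)^[k] (leftPeriodicPoint r a) := by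
    intro k; rw [← iterate_critOrbit, hland]
  obtain ⟨κ, hκ, hκ'⟩ := exists_le_abs_fairCdf_iterate_sub ha hr hl hw
    (by rw [← hland]; exact critOrbit_mem ha m)
  -- the turning point is not periodic, since its orbit falls on a periodic orbit avoiding it
  have hne : ∀ k, 2 ≤ k → critOrbit a k ≠ 0 := by
    intro k hk h0
    have hper : ∀ j, critOrbit a (k * j) = 0 := by
      intro j
      induction j with
      | zero => rfl
      | succ j ih =>
        rw [mul_add, mul_one, Nat.add_comm, ← iterate_critOrbit, h0]
        exact ih
    have h2 : m ≤ k * m := Nat.le_mul_of_pos_left m (by omega)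
    have h3 := horbit (k * m - m)
    rw [Nat.add_sub_cancel' h2, hper m] at h3
    rcases iterate_leftPeriodicPoint_neg_or ha hr hl hw (k * m - m) with h4 | h4
    · linarith
    · linarith
  have hnear : ∀ᶠ a' in 𝓝 a, ∀ k ∈ Finset.range m, 2 ≤ k → 0 ≤ critOrbit a k * critOrbit a' k := by
    rw [Filter.eventually_all_finset]
    intro k _
    by_cases h2 : 2 ≤ k
    · have hc : ContinuousAt (fun a' => critOrbit a k * critOrbit a' k) a :=
        (continuous_const.mul (continuous_critOrbit k)).continuousAt
      filter_upwards [hc.eventually (lt_mem_nhds (mul_self_pos.2 (hne k h2)))] with a' h3 _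
      exact le_of_lt h3
    · exact Eventually.of_forall fun a' h3 => absurd h3 h2
  obtain ⟨ρ, hρ, hnear⟩ := Metric.eventually_nhds_iff.1 hnear
  set α := holderExponent r x₀ with hαdef
  have hα : 0 < α := holderExponent_pos hr (by linarith)
  have hxα : x₀ ^ α = decayRate r := rpow_holderExponent hr (by linarith)
  have hd := decayRate_pos r
  refine ⟨a, haI, κ / (2 * 2 ^ m * 3200 ^ α), by positivity, ρ, hρ, fun a' ha'I hne' hdist => ?_⟩
  have ha' := (mem_of_window hr (h₀.trans ha'I.1) (ha'I.2.trans_lt h₁)).1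
  have hF' := isFairCdf_fairCdf ha'
  have hδ : 0 < |a' - a| := abs_pos.2 (sub_ne_zero.2 hne')
  have hsep : ∀ q, (∀ k, m ≤ k → k < q → SamePiece a (critOrbit a k) a' (critOrbit a' k)) →
      x₀ ^ q * |a' - a| ≤ 3200 := by
    intro q hq
    refine pow_mul_abs_sub_le ha ha' hx₀ haI.1 ha'I.1 fun k h2 hk => ?_
    rcases Nat.lt_or_ge k m with h3 | h3
    · exact hnear (by rwa [Real.dist_eq]) k (Finset.mem_range.2 h3) h2
    · exact (hq k h3 hk).mul_nonneg ha ha'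
  classical
  have hex : ∃ n, ¬ SamePiece a (critOrbit a (m + n)) a' (critOrbit a' (m + n)) := by
    by_contra hall
    push Not at hall
    obtain ⟨q, hq⟩ := pow_unbounded_of_one_lt (3200 / |a' - a|) (show 1 < x₀ by linarith)
    rw [div_lt_iff₀ hδ] at hq
    have := hsep q fun k h3 _ => by
      have := hall (k - m)
      rwa [Nat.add_sub_cancel' h3] at this
    linarith
  set n := Nat.find hex with hn
  have hnn := Nat.find_spec hex
  rw [← hn] at hnn
  have hsame : ∀ k, m ≤ k → k < m + n → SamePiece a (critOrbit a k) a' (critOrbit a' k) := by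
    intro k h3 hk
    have := Nat.find_min hex (show k - m < Nat.find hex by omega)
    push Not at this
    rwa [Nat.add_sub_cancel' h3] at this
  have e1 := hF.le_abs_sub_add_of_not_samePiece ha ha' hF' (critOrbit_mem ha _)
    (critOrbit_mem ha' _) hnn (κ := κ) (by rw [horbit]; exact (hκ' n).1)
    (by rw [horbit]; exact (hκ' n).2)
  have e2 := hF.abs_sub_add_mul_le ha ha' hF' (show 1 ≤ m by omega) n hsame
  have e3 := two_pow_le_mul_decayRate hr (le_visits_leftPeriodicPoint ha hr hl hw n)
  rw [hland] at e2
  set v := visits a (leftPeriodicPoint r a) n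
  set H := |fairCdf a' 0 - fairCdf a 0| with hH
  have hH0 : 0 ≤ H := abs_nonneg _
  have hv : (0 : ℝ) < 2 ^ v := by positivity
  have e4 : κ ≤ 2 * 2 ^ m * H * decayRate r ^ (m + n) := by
    have h5 := (mul_le_mul_of_nonneg_right e1 hv.le).trans
      (e2.trans (mul_le_mul_of_nonneg_right e3 (by positivity)))
    have h6 : κ * 2 ^ v ≤ 2 * 2 ^ m * H * decayRate r ^ n * 2 ^ v := by linarith
    refine (le_of_mul_le_mul_right h6 hv).trans (mul_le_mul_of_nonneg_left ?_ (by positivity))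
    exact pow_le_pow_right₀ (one_le_decayRate hr) (by omega)
  have e5 : decayRate r ^ (m + n) * |a' - a| ^ α ≤ 3200 ^ α := by
    rw [← hxα, ← pow_mul_rpow (by linarith) hδ.le]
    have : 0 ≤ x₀ := by linarith
    exact Real.rpow_le_rpow (by positivity) (hsep _ hsame) hα.le
  rw [div_mul_eq_mul_div, div_le_iff₀ (by positivity)]
  have h6 : 0 ≤ |a' - a| ^ α := by positivity
  calc κ * |a' - a| ^ α ≤ 2 * 2 ^ m * H * decayRate r ^ (m + n) * |a' - a| ^ α :=
        mul_le_mul_of_nonneg_right e4 h6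
    _ = 2 * 2 ^ m * H * (decayRate r ^ (m + n) * |a' - a| ^ α) := by ring
    _ ≤ 2 * 2 ^ m * H * 3200 ^ α := mul_le_mul_of_nonneg_left e5 (by positivity)
    _ = _ := by ring

lemma holderExponent_le_succ {r : ℕ} (hr : 2 ≤ r) {b : ℝ} (hb : 1 < b) :
    holderExponent r b ≤ holderExponent (r + 1) b := by
  have h1 : (2 : ℝ) ≤ r := by exact_mod_cast hr
  have h2 := Real.log_pos one_lt_two
  have h3 := Real.log_pos hb
  unfold holderExponent
  rw [Nat.cast_add, Nat.cast_one, div_le_div_iff₀ (by positivity) (by positivity)]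
  have : 0 ≤ Real.log 2 * Real.log b := by positivity
  nlinarith

lemma exists_windowParam_lt_le {r : ℕ} (hr : 2 ≤ r) {b : ℝ} (hb : √2 < b)
    (hbr : b ≤ windowParam (r + 1)) : ∃ s, 2 ≤ s ∧ windowParam s < b ∧ b ≤ windowParam (s + 1) ∧
      holderExponent s b ≤ holderExponent r b := by
  have hb1 : 1 < b := by
    have : √2 * √2 = 2 := Real.mul_self_sqrt (by norm_num)
    nlinarith [Real.sqrt_nonneg 2]
  induction r, hr using Nat.le_induction with
  | base => exact ⟨2, le_rfl, by rwa [windowParam_two], hbr, le_rfl⟩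
  | succ r hr ih =>
    rcases lt_or_ge (windowParam (r + 1)) b with h | h
    · exact ⟨r + 1, by omega, h, hbr, le_rfl⟩
    · obtain ⟨s, h1, h2, h3, h4⟩ := ih h
      exact ⟨s, h1, h2, h3, h4.trans (holderExponent_le_succ hr hb1)⟩

theorem not_isHolderOn_fairEntropy {r : ℕ} (hr : 2 ≤ r) {J : Set ℝ} (hJ : J ⊆ Icc (√2) 2)
    (hconn : J.OrdConnected) (hnt : J.Nontrivial) {b : ℝ} (hb : IsLUB J b)
    (hbA : b ≤ windowParam (r + 1)) {α : ℝ} (hα : holderExponent r b < α) :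
    ¬ IsHolderOn α fairEntropy J := by
  obtain ⟨x, hxJ, y, hyJ, hxy⟩ := hnt.exists_lt
  have hxb : x < b := hxy.trans_le (hb.1 hyJ)
  obtain ⟨s, hs, hsb, hbs, hsr⟩ := exists_windowParam_lt_le hr ((hJ hxJ).1.trans_lt hxb) hbA
  have hb1 : 7 / 5 < b := (param_bounds (hJ hxJ)).1.trans hxb
  have hcont : ContinuousAt (holderExponent s) b := by
    have h1 : (2 : ℝ) ≤ s := by exact_mod_cast hs
    have h2 := Real.log_pos (show 1 < b by linarith)
    unfold holderExponent
    exact continuousAt_const.div (continuousAt_const.mul (Real.continuousAt_log (by linarith)))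
      (by positivity)
  have hev : ∀ᶠ x₀ in 𝓝[<] b, holderExponent s x₀ < α ∧ x₀ ∈ Ioo (max x (windowParam s)) b :=
    ((hcont.eventually (gt_mem_nhds (hsr.trans_lt hα))).filter_mono nhdsWithin_le_nhds).and
      (Ioo_mem_nhdsLT (max_lt hxb hsb))
  obtain ⟨x₀, hx₀α, hx₀, hx₀b⟩ := hev.exists
  have hx₀x := (le_max_left _ _).trans_lt hx₀
  have hx₀s := (le_max_right _ _).trans_lt hx₀
  obtain ⟨z, hzJ, hx₀z, hzb⟩ := hb.exists_between hx₀b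
  obtain ⟨x₁, h01, h1z⟩ := exists_between hx₀z
  have hsub : Icc x₀ x₁ ⊆ J := fun w hw => hconn.out hxJ hzJ ⟨hx₀x.le.trans hw.1, hw.2.trans h1z.le⟩
  have hx₀1 : 1 < x₀ := by linarith [(param_bounds (hJ hxJ)).1]
  have hβ0 := holderExponent_pos hs hx₀1
  obtain ⟨a, ha, c, hc, ρ, hρ, hlow⟩ := exists_mul_rpow_le_abs_fairCdf_zero_sub hs hx₀s.le h01
    (h1z.trans_le (hzb.trans hbs))
  rw [isHolderOn_iff (hβ0.trans hx₀α).le]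
  rintro ⟨C, hC, hup⟩
  set β := holderExponent s x₀
  have hsmall : ∀ᶠ δ in 𝓝[>] (0 : ℝ), C * δ ^ (α - β) < c ∧ δ ∈ Ioo 0 (min ρ ((x₁ - x₀) / 2)) := by
    have h1 : ContinuousAt (fun δ : ℝ => C * δ ^ (α - β)) 0 :=
      continuousAt_const.mul (Real.continuousAt_rpow_const 0 (α - β) (Or.inr (by linarith)))
    have h2 : C * (0 : ℝ) ^ (α - β) < c := by
      rw [Real.zero_rpow (by linarith), mul_zero]; exact hc
    exact ((h1.eventually (gt_mem_nhds h2)).filter_mono nhdsWithin_le_nhds).and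
      (Ioo_mem_nhdsGT (lt_min hρ (by linarith)))
  obtain ⟨δ, hδc, hδ0, hδm⟩ := hsmall.exists
  have hδρ := hδm.trans_le (min_le_left _ _)
  have hδx := hδm.trans_le (min_le_right _ _)
  obtain ⟨a', ha', habs⟩ : ∃ a' ∈ Icc x₀ x₁, |a' - a| = δ := by
    rcases le_total a ((x₀ + x₁) / 2) with h | h
    · exact ⟨a + δ, ⟨by linarith [ha.1], by linarith⟩, by
        rw [add_sub_cancel_left, abs_of_pos hδ0]⟩
    · exact ⟨a - δ, ⟨by linarith, by linarith [ha.2]⟩, by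
        rw [sub_sub_cancel_left, abs_neg, abs_of_pos hδ0]⟩
  have hne : a' ≠ a := by
    rintro rfl
    rw [sub_self, abs_zero] at habs
    linarith
  have h1 := hlow a' ha' hne (by rwa [habs])
  have h2 := hup a (hsub ha) a' (hsub ha')
  rw [fairEntropy_eq (hJ (hsub ha)), fairEntropy_eq (hJ (hsub ha'))] at h2
  rw [habs] at h1 h2
  have h3 : δ ^ α = δ ^ (α - β) * δ ^ β := by rw [← Real.rpow_add hδ0, sub_add_cancel]
  have h4 : 0 < δ ^ β := Real.rpow_pos_of_pos hδ0 β
  rw [h3, ← mul_assoc] at h2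
  have h5 := le_of_mul_le_mul_right (h1.trans h2) h4
  linarith

end FairEntropy

theorem theorem1 :
    -- the fair entropy is well defined
    (∀ a ∈ Icc (√2) 2,
      (∃! μ : Measure ℝ, FairEntropy.IsFairMeasure a μ) ∧
      MeasurePreserving (FairEntropy.tent a) (FairEntropy.fairMeasure a)
        (FairEntropy.fairMeasure a) ∧
      FairEntropy.measureEntropy (FairEntropy.tent a) (FairEntropy.fairMeasure a) ≠ ⊤) ∧
    ∃ A : ℕ → ℝ,
      -- the sequence of parameters
      (∀ r, 2 ≤ r → {a ∈ Icc (√2) 2 | FairEntropy.IsWindowParameter r a} = {A r}) ∧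
      A 2 = √2 ∧ StrictMonoOn A (Ici 2) ∧ Tendsto A atTop (𝓝 2) ∧
      -- Hölder continuity
      (∀ r, 2 ≤ r → ∀ b, A r < b → b ≤ 2 →
        FairEntropy.IsHolderOn (FairEntropy.holderExponent r b) FairEntropy.fairEntropy
          (Icc (A r) b)) ∧
      FairEntropy.IsHolderOn (1 / 2) FairEntropy.fairEntropy (Icc (√2) 2) ∧
      -- optimality of the exponents
      (∀ r, 2 ≤ r → ∀ J : Set ℝ, J ⊆ Icc (√2) 2 → J.OrdConnected → J.Nontrivial →
        ∀ b, IsLUB J b → b ≤ A (r + 1) →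
          ∀ α, FairEntropy.holderExponent r b < α →
            ¬ FairEntropy.IsHolderOn α FairEntropy.fairEntropy J) := by
  refine ⟨fun a ha => ⟨FairEntropy.existsUnique_isFairMeasure ha,
    (FairEntropy.isFairMeasure_fairMeasure ha).measurePreserving ha, ?_⟩,
    FairEntropy.windowParam, fun r hr => FairEntropy.setOf_isWindowParameter hr,
    FairEntropy.windowParam_two, FairEntropy.windowParam_strictMonoOn,
    FairEntropy.tendsto_windowParam, fun r hr b hrb hb => FairEntropy.isHolderOn_fairEntropy hr hrb hb,
    ?_, fun r hr J hJ hconn hnt b hb hbA α hα =>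
      FairEntropy.not_isHolderOn_fairEntropy hr hJ hconn hnt hb hbA hα⟩
  · rw [(FairEntropy.isFairMeasure_fairMeasure ha).measureEntropy_eq ha]
    exact EReal.coe_ne_top _
  · have h2 : √2 < 2 := by
      have h : √2 * √2 = 2 := Real.mul_self_sqrt (by norm_num)
      nlinarith [Real.sqrt_nonneg 2]
    have h := FairEntropy.isHolderOn_fairEntropy (r := 2) le_rfl (b := 2)
      (by rwa [FairEntropy.windowParam_two]) le_rfl
    rwa [FairEntropy.windowParam_two, FairEntropy.holderExponent_two_two] at h
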